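/- \textbf{Theorem (Hi-WRAC is solvable in polynomial time).} \emph{Input.} Axis-aligned boxes $B_1,\dots,B_n$, where $B_i$ has a given rational width $w_i>0$ and height $h_i>0$, and a plane embedded directed graph $G$ with vertex set $\{B_1,\dots,B_n\}$ that is acyclic and has exactly one sink (vertex without outgoing edges). Such a $G$ is connected, and its plane embedding is given combinatorially: by the clockwise cyclic order of the neighbours around every vertex (this rotation system has Euler genus $0$) and by its outer face. All numbers are encoded in binary, rationals as fractions of integers. \emph{Task.} A \emph{representation} places each $B_i$ in the plane, by translation, so that no two boxes overlap (their interiors are disjoint); two boxes \emph{touch} if their boundaries share a segment of positive length. A representation \emph{hierarchically realizes} $G$ if (i) two distinct boxes touch if and only if they are adjacent in $G$; (ii) for every directed edge $B_i\to B_j$ of $G$, the top side of $B_i$ and the bottom side of $B_j$ share a segment of positive length (so every contact is horizontal, with the head of the edge on top); (iii) the contacts induce the given embedding: going clockwise around the boundary of each box, one meets its contacts in the given clockwise cyclic order of its neighbours, and the unbounded face of the contact graph is the given outer face. The task is to find a representation that hierarchically realizes $G$, or to report that there is none. \emph{Claim.} There is a deterministic Turing machine that, on every such input, halts after a number of steps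 bounded by a fixed polynomial in the length of the input, and outputs rational coordinates of the bottom-left corners of the boxes in a representation that hierarchically realizes $G$ if such a representation (with real coordinates) exists, and otherwise outputs that none exists. -/

import Mathlib

namespace HiWRAC

/-- A rational number written as a fraction, not necessarily in lowest terms. -/
structure Fraction where
  num : ℤ
  den : ℕ
  den_pos : 0 < den

/-- The value of a fraction. -/
noncomputable def Fraction.val (q : Fraction) : ℝ := (q.num : ℝ) / (q.den : ℝ)

/-- Vertices `0, …, n - 1`, an arc relation, and at every vertex the clockwise list of its
neighbours (only its cyclic order matters). -/
structure RotationSystem (n : ℕ) where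
  arc : Fin n → Fin n → Bool
  rot : Fin n → List (Fin n)
  rot_nodup : ∀ v, (rot v).Nodup
  mem_rot : ∀ v w, w ∈ rot v ↔ (arc v w = true ∨ arc w v = true)

namespace RotationSystem

variable {n : ℕ} (R : RotationSystem n)

/-- `(v, w)` is a dart: an edge traversed from `v` to `w`. -/
def IsDart (d : Fin n × Fin n) : Prop := d.2 ∈ R.rot d.1

/-- The boundary walk of the face on the left of a dart: after `u → v` continue with `v → w`, where
`w` is the clockwise successor of `u` around `v`. -/
def faceNext (d : Fin n × Fin n) : Fin n × Fin n := (d.2, (R.rot d.2).formPerm d.1)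

/-- The darts whose left side is the face on the left of `d`. -/
def faceOf (d : Fin n × Fin n) : Set (Fin n × Fin n) := {e | ∃ k : ℕ, R.faceNext^[k] d = e}

open Classical in
/-- The number of faces; a graph without edges on one vertex has one face. -/
noncomputable def numFaces : ℕ :=
  if ∃ d, R.IsDart d then {F | ∃ d, R.IsDart d ∧ R.faceOf d = F}.ncard else 1

/-- The number of edges. -/
def numEdges : ℕ := (Finset.univ.filter fun d : Fin n × Fin n => R.arc d.1 d.2 = true).card

end RotationSystem

/-- An input: boxes with positive rational width and height, and a plane embedded digraph on them
that is acyclic and has a unique sink. Such a graph is connected, so a plane embedding is, up to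
homeomorphism of the plane, a rotation system of Euler genus `0` together with its outer face. The
outer face is given by a dart that has it on its left (`none` if there is no edge). -/
structure Instance where
  n : ℕ
  width : Fin n → Fraction
  height : Fin n → Fraction
  width_pos : ∀ v, 0 < (width v).num
  height_pos : ∀ v, 0 < (height v).num
  graph : RotationSystem n
  acyclic : ∀ v, ¬ Relation.TransGen (fun a b => graph.arc a b = true) v v
  unique_sink : ∃! v, ∀ w, graph.arc v w = false
  planar : n + graph.numFaces = graph.numEdges + 2
  outer : Option (Fin n × Fin n)
  outer_some : ∀ d, outer = some d → graph.IsDart d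
  outer_none : outer = none → ∀ d, ¬ graph.IsDart d

namespace Instance

variable (I : Instance)

/-! A placement `p` gives the bottom-left corner of each box. -/

/-- The `x`-coordinate of the left side. -/
def left (p : Fin I.n → ℝ × ℝ) (v : Fin I.n) : ℝ := (p v).1

/-- The `x`-coordinate of the right side. -/
noncomputable def right (p : Fin I.n → ℝ × ℝ) (v : Fin I.n) : ℝ := (p v).1 + (I.width v).val

/-- The `y`-coordinate of the bottom side. -/
def low (p : Fin I.n → ℝ × ℝ) (v : Fin I.n) : ℝ := (p v).2

/-- The `y`-coordinate of the top side. -/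
noncomputable def high (p : Fin I.n → ℝ × ℝ) (v : Fin I.n) : ℝ := (p v).2 + (I.height v).val

/-- The interior of a box. -/
def openBox (p : Fin I.n → ℝ × ℝ) (v : Fin I.n) : Set (ℝ × ℝ) :=
  Set.Ioo (I.left p v) (I.right p v) ×ˢ Set.Ioo (I.low p v) (I.high p v)

/-- No two boxes overlap. -/
def IsRepresentation (p : Fin I.n → ℝ × ℝ) : Prop :=
  ∀ v w, v ≠ w → Disjoint (I.openBox p v) (I.openBox p w)

/-- The top side of `v` and the bottom side of `w` share a segment of positive length. -/
def TopContact (p : Fin I.n → ℝ × ℝ) (v w : Fin I.n) : Prop :=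
  I.high p v = I.low p w ∧ max (I.left p v) (I.left p w) < min (I.right p v) (I.right p w)

/-- The right side of `v` and the left side of `w` share a segment of positive length. -/
def SideContact (p : Fin I.n → ℝ × ℝ) (v w : Fin I.n) : Prop :=
  I.right p v = I.left p w ∧ max (I.low p v) (I.low p w) < min (I.high p v) (I.high p w)

/-- Two boxes touch: their boundaries share a segment of positive length. -/
def Touch (p : Fin I.n → ℝ × ℝ) (v w : Fin I.n) : Prop :=
  I.TopContact p v w ∨ I.TopContact p w v ∨ I.SideContact p v w ∨ I.SideContact p w v

/-- The cyclic list `l` is the list of contacts met when going clockwise around the boundary of the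
box `v`, all contacts being horizontal: the top side from left to right, then the bottom side from
right to left. -/
def ClockwiseContacts (p : Fin I.n → ℝ × ℝ) (v : Fin I.n) (l : List (Fin I.n)) : Prop :=
  ∃ above below : List (Fin I.n), l.IsRotated (above ++ below) ∧
    (∀ w ∈ above, I.TopContact p v w) ∧
    above.Pairwise (fun a b => I.left p a < I.left p b) ∧
    (∀ w ∈ below, I.TopContact p w v) ∧
    below.Pairwise (fun a b => I.left p b < I.left p a)

/-- The dart `d` has the unbounded region on its left: it leaves a highest box through the rightmost
contact on its bottom side. (Going clockwise around this box, the corner just before this contact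
contains the top side, above which there is no box.) -/
def IsUnboundedDart (p : Fin I.n → ℝ × ℝ) (d : Fin I.n × Fin I.n) : Prop :=
  (∀ u, I.high p u ≤ I.high p d.1) ∧ I.TopContact p d.2 d.1 ∧
    ∀ u, I.TopContact p u d.1 → I.left p u ≤ I.left p d.2

/-- The placement hierarchically realizes the embedded digraph: no two boxes overlap, the contact
graph is the given graph, every arc `v → w` is a contact of the top side of `v` with `w`, and the
contacts induce the given clockwise orders and the given outer face. -/
structure HierarchicallyRealizes (p : Fin I.n → ℝ × ℝ) : Prop where
  representation : I.IsRepresentation p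
  contact_graph : ∀ v w, v ≠ w →
    (I.Touch p v w ↔ (I.graph.arc v w = true ∨ I.graph.arc w v = true))
  upward : ∀ v w, I.graph.arc v w = true → I.TopContact p v w
  rotation : ∀ v, I.ClockwiseContacts p v (I.graph.rot v)
  outer_face : ∀ d, I.outer = some d → ∃ e, I.IsUnboundedDart p e ∧ e ∈ I.graph.faceOf d

end Instance

/-! Encodings as words over the three-letter alphabet `{0, 1, separator}`. -/

/-- A list of natural numbers in binary, each followed by the separator `none`. -/
def encodeNats (l : List ℕ) : List (Option Bool) :=
  l.flatMap fun k => k.bits.map some ++ [none]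

/-- Sign, absolute value of the numerator, denominator. -/
def Fraction.toNats (q : Fraction) : List ℕ :=
  [if q.num < 0 then 1 else 0, q.num.natAbs, q.den]

/-- For every vertex: width, height, degree, and the clockwise list of neighbours, each with a bit
that tells whether the edge is outgoing. -/
def Instance.vertexToNats (I : Instance) (v : Fin I.n) : List ℕ :=
  (I.width v).toNats ++ (I.height v).toNats ++ [(I.graph.rot v).length] ++
    (I.graph.rot v).flatMap fun w => [w.val, (I.graph.arc v w).toNat]

/-- The encoding of an input: number of vertices, the vertex data, the dart of the outer face. -/
def encodeInstance (I : Instance) : List (Option Bool) :=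
  encodeNats ([I.n] ++ (List.finRange I.n).flatMap I.vertexToNats ++
    (match I.outer with
      | none => []
      | some d => [d.1.val, d.2.val]))

/-- The encoding of an output: `0` for "not realizable", or `1` followed by the coordinates of the
bottom-left corners of the boxes. -/
def encodeOutput (o : Option (List (Fraction × Fraction))) : List (Option Bool) :=
  encodeNats
    (match o with
      | none => [0]
      | some l => [1] ++ l.flatMap fun q => q.1.toNats ++ q.2.toNats)

/-- The output `o` is correct for the input `I`: a placement that hierarchically realizes it, or
`none` if there is no such placement, even with real coordinates. -/
def IsCorrectOutput (I : Instance) : Option (List (Fraction × Fraction)) → Prop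
  | some l => ∃ q : Fin I.n → Fraction × Fraction, l = List.ofFn q ∧
      I.HierarchicallyRealizes fun v => ((q v).1.val, (q v).2.val)
  | none => ¬ ∃ p : Fin I.n → ℝ × ℝ, I.HierarchicallyRealizes p

end HiWRAC

/-! All contacts are horizontal, so an arc `u → v` forces the top of `u` to lie at the height of the
bottom of `v`. Following one out-neighbour from each box (`parent`) always leads to the unique sink.
Hence the vertical positions are forced up to a translation: a box lies `depth` below the sink
(`low_sub_low`). Only the abscissae remain to be found.

Adjacent boxes must overlap horizontally. Non-adjacent boxes whose closed vertical extents meet must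
be separated horizontally, and strictly so if the open extents meet, since otherwise there would be
a side contact. The disjunction "left or right" would be the difficulty, but the embedding resolves
it. Clockwise around a box, starting at an out-neighbour, the boxes below it are met from right to
left (`exists_order_eq`), so the children of each node of the tree of parents are ordered. If one
child lies to the left of another, every descendant of the first lies to the left of every
descendant of the second that it meets vertically (`right_le_left_of_iterate`). Non-adjacent boxes
that meet vertically have distinct children of a common ancestor above them, so they are comparable
(`leftOf_total`). At the sink there is no out-neighbour to start from. All candidates `g` for its
rightmost contact are tried, and the outer face shows that one of them is right.

What remains is a system of difference constraints `x u + p ≤ x v + q` (`bound`). In units of the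
common denominator the widths are integers, and a real solution can be rounded to an integral one
after refining the unit by a factor `n`, so that each strict inequality becomes a gap of one unit
(`exists_int_potential`). If the system is solvable, `n` rounds of Bellman–Ford relaxations solve it
(`relaxation_solves`).

Each candidate solution is then tested against the full definition. Soundness therefore rests on the
test alone (`check_sound`), and the geometry is needed only to show that a realizable instance
yields a candidate that passes (`solutions_ne_nil`).

For the running time, structured programs on four stacks are compiled to the machine model with
exact step counts (`Exec.steps`). Data are binary trees written in preorder. The functions computed
by such programs in polynomial time (`PolyTime`) are closed under composition, pairing, case
distinction and iteration with polynomially bounded intermediate sizes; lists and binary arithmetic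
follow, and the algorithm is assembled from these. `computable_of_polyTime` adds the conversion from
and to plain words. -/

open Turing

namespace HiWRAC

/-! ### Structured programs on four stacks -/

/-- The letters on the stacks. -/
abbrev Sym := Option Bool

/-- Structured programs on four stacks with one register that holds the letter popped last. -/
inductive Prog
  | push (k : Fin 4) (g : Option Sym → Sym)
  | pop (k : Fin 4)
  | seq (p q : Prog)
  | ite (c : Option Sym → Bool) (p q : Prog)
  | loop (c : Option Sym → Bool) (p : Prog)

namespace Prog

/-- Big-step semantics with running time: register, stacks, time, new register, new stacks. -/
inductive Exec : Prog → Option Sym → (Fin 4 → List Sym) → ℕ → Option Sym → (Fin 4 → List Sym) → Prop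
  | push (k g v S) : Exec (push k g) v S 1 v (Function.update S k (g v :: S k))
  | pop (k v S) : Exec (pop k) v S 1 (S k).head? (Function.update S k (S k).tail)
  | seq {p q v S n v' S' m v'' S''} : Exec p v S n v' S' → Exec q v' S' m v'' S'' →
      Exec (seq p q) v S (n + m) v'' S''
  | ite_true {c p q v S n v' S'} : c v = true → Exec p v S n v' S' →
      Exec (ite c p q) v S (n + 1) v' S'
  | ite_false {c p q v S n v' S'} : c v = false → Exec q v S n v' S' →
      Exec (ite c p q) v S (n + 1) v' S'
  | loop_false {c p v S} : c v = false → Exec (loop c p) v S 1 v S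
  | loop_true {c p v S n v' S' m v'' S''} : c v = true → Exec p v S n v' S' →
      Exec (loop c p) v' S' m v'' S'' → Exec (loop c p) v S (n + m + 1) v'' S''

/-- The labels of the compiled program. -/
def Label : Prog → Type
  | push _ _ => Unit
  | pop _ => Unit
  | seq p q => p.Label ⊕ q.Label
  | ite _ p q => Option (p.Label ⊕ q.Label)
  | loop _ p => Option p.Label

/-- There are finitely many labels. -/
@[reducible] def labelFintype : (p : Prog) → Fintype p.Label
  | push _ _ => inferInstanceAs (Fintype Unit)
  | pop _ => inferInstanceAs (Fintype Unit)
  | seq p q => @instFintypeSum _ _ p.labelFintype q.labelFintype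
  | ite _ p q => @instFintypeOption _ (@instFintypeSum _ _ p.labelFintype q.labelFintype)
  | loop _ p => @instFintypeOption _ p.labelFintype

/-- The label where the program starts. -/
def entry : (p : Prog) → p.Label
  | push _ _ => ()
  | pop _ => ()
  | seq p _ => Sum.inl p.entry
  | ite _ _ _ => none
  | loop _ _ => none

/-- The statements of the compiled program, with labels embedded by `ι`, leaving to `e`. -/
def code {L : Type} : (p : Prog) → (p.Label → L) → L → p.Label →
    TM2.Stmt (fun _ : Fin 4 => Sym) L (Option Sym)
  | push k g, _, e, _ => .push k g (.goto fun _ => e)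
  | pop k, _, e, _ => .pop k (fun _ s => s) (.goto fun _ => e)
  | seq p q, ι, e, l => match l with
    | Sum.inl l => p.code (fun a => ι (Sum.inl a)) (ι (Sum.inr q.entry)) l
    | Sum.inr l => q.code (fun a => ι (Sum.inr a)) e l
  | ite c p q, ι, e, l => match l with
    | none => .goto fun v => cond (c v) (ι (some (Sum.inl p.entry))) (ι (some (Sum.inr q.entry)))
    | some (Sum.inl l) => p.code (fun a => ι (some (Sum.inl a))) e l
    | some (Sum.inr l) => q.code (fun a => ι (some (Sum.inr a))) e l
  | loop c p, ι, e, l => match l with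
    | none => .goto fun v => cond (c v) (ι (some p.entry)) e
    | some l => p.code (fun a => ι (some a)) (ι none) l

/-- `n` steps of the machine lead from one configuration to the other. -/
def Steps {L : Type} (M : L → TM2.Stmt (fun _ : Fin 4 => Sym) L (Option Sym)) (n : ℕ)
    (c c' : TM2.Cfg (fun _ : Fin 4 => Sym) L (Option Sym)) : Prop :=
  (flip bind (TM2.step M))^[n] (some c) = some c'

theorem Steps.trans {L : Type} {M : L → TM2.Stmt (fun _ : Fin 4 => Sym) L (Option Sym)} {n m : ℕ}
    {c c' c'' : TM2.Cfg (fun _ : Fin 4 => Sym) L (Option Sym)} (h : Steps M n c c')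
    (h' : Steps M m c' c'') : Steps M (n + m) c c'' := by
  unfold Steps at *
  rw [add_comm, Function.iterate_add_apply, h, h']

/-- Big-step time is machine time exactly: each push, pop and test is one step. The embedding `ι` of
the labels and the exit label `e` are arbitrary, so that the induction hypotheses apply to
subprograms wherever they sit in the machine. -/
theorem Exec.steps {p : Prog} {v S n v' S'} (h : Exec p v S n v' S') :
    ∀ {L : Type} (M : L → TM2.Stmt (fun _ : Fin 4 => Sym) L (Option Sym)) (ι : p.Label → L) (e : L),
      (∀ l, M (ι l) = p.code ι e l) → Steps M n ⟨some (ι p.entry), v, S⟩ ⟨some e, v', S'⟩ := by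
  induction h with
  | push k g v S =>
    intro L M ι e hM
    simp [Steps, flip, TM2.step, hM, code, TM2.stepAux]
  | pop k v S =>
    intro L M ι e hM
    simp [Steps, flip, TM2.step, hM, code, TM2.stepAux]
  | seq _ _ ih₁ ih₂ =>
    intro L M ι e hM
    exact (ih₁ M (fun a => ι (Sum.inl a)) _ fun l => hM (Sum.inl l)).trans
      (ih₂ M (fun a => ι (Sum.inr a)) e fun l => hM (Sum.inr l))
  | @ite_true c p q v S n v' S' hc _ ih =>
    intro L M ι e hM
    rw [add_comm]
    refine Steps.trans (c' := ⟨some (ι (some (Sum.inl p.entry))), v, S⟩) ?_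
      (ih M (fun a => ι (some (Sum.inl a))) e fun l => hM (some (Sum.inl l)))
    change some (TM2.stepAux (M (ι none)) _ _) = _
    rw [show M (ι none) = _ from hM none]
    simp [code, TM2.stepAux, hc]
  | @ite_false c p q v S n v' S' hc _ ih =>
    intro L M ι e hM
    rw [add_comm]
    refine Steps.trans (c' := ⟨some (ι (some (Sum.inr q.entry))), v, S⟩) ?_
      (ih M (fun a => ι (some (Sum.inr a))) e fun l => hM (some (Sum.inr l)))
    change some (TM2.stepAux (M (ι none)) _ _) = _
    rw [show M (ι none) = _ from hM none]
    simp [code, TM2.stepAux, hc]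
  | loop_false hc =>
    intro L M ι e hM
    change some (TM2.stepAux (M (ι none)) _ _) = _
    rw [show M (ι none) = _ from hM none]
    simp [code, TM2.stepAux, hc]
  | @loop_true c p v S n v' S' m v'' S'' hc _ _ ih₁ ih₂ =>
    intro L M ι e hM
    rw [add_comm]
    refine Steps.trans (c' := ⟨some (ι (some p.entry)), v, S⟩) ?_
      ((ih₁ M (fun a => ι (some a)) (ι none) fun l => hM (some l)).trans (ih₂ M ι e hM))
    change some (TM2.stepAux (M (ι none)) _ _) = _
    rw [show M (ι none) = _ from hM none]
    simp [code, TM2.stepAux, hc]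

/-- The Turing machine of a program: the input is on stack `2`, the output on stack `0`. -/
def machine (p : Prog) : FinTM2 where
  K := Fin 4
  k₀ := 2
  k₁ := 0
  Γ := fun _ => Sym
  Λ := Option p.Label
  main := some p.entry
  ΛFin := @instFintypeOption _ p.labelFintype
  σ := Option Sym
  initialState := none
  m := fun l => match l with
    | none => .halt
    | some l => p.code some none l

/-- A halting configuration must have the initial register value and all stacks empty except the
output; hence the demand that the run end with register `none`. The additional step executes `halt`.
-/
theorem machine_outputs {p : Prog} {w w' : List Sym} {n : ℕ}
    (h : Exec p none ![[], [], w, []] n none ![w', [], [], []]) :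
    Nonempty (TM2OutputsInTime p.machine w (some w') (n + 1)) := by
  have h1 := (h.steps p.machine.m some none fun l => rfl)
  have h2 : Steps p.machine.m 1 ⟨some none, none, ![w', [], [], []]⟩ ⟨none, none, ![w', [], [], []]⟩ := rfl
  have h3 := h1.trans h2
  have e1 : initList p.machine w = ⟨some (some p.entry), none, ![[], [], w, []]⟩ := by
    have : ∀ k : Fin 4, (initList p.machine w).stk k = ![[], [], w, []] k := by
      intro k
      fin_cases k <;> rfl
    exact congrArg (TM2.Cfg.mk _ _) (funext this)
  have e2 : haltList p.machine w' = ⟨none, none, ![w', [], [], []]⟩ := by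
    have : ∀ k : Fin 4, (haltList p.machine w').stk k = ![w', [], [], []] k := by
      intro k
      fin_cases k <;> rfl
    exact congrArg (TM2.Cfg.mk _ _) (funext this)
  exact ⟨⟨⟨n + 1, by rw [e1]; exact Eq.trans h3 (congrArg some e2).symm⟩, le_rfl⟩⟩

/-- A program pushes at most one letter in a step. -/
theorem Exec.length_le {p : Prog} {v S n v' S'} (h : Exec p v S n v' S') :
    ∑ k, (S' k).length ≤ ∑ k, (S k).length + n := by
  have key : ∀ (S : Fin 4 → List Sym) (k : Fin 4) (l : List Sym), l.length ≤ (S k).length + 1 →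
      ∑ j, (Function.update S k l j).length ≤ ∑ j, (S j).length + 1 := by
    intro S k l hl
    rw [← Finset.add_sum_erase _ _ (Finset.mem_univ k), ← Finset.add_sum_erase _ (fun j => (S j).length) (Finset.mem_univ k)]
    rw [Finset.sum_congr rfl (g := fun j => (S j).length)]
    · simp only [Function.update_self]; omega
    · intro x hx
      rw [Function.update_of_ne (Finset.ne_of_mem_erase hx)]
  induction h with
  | push k g v S => exact key _ _ _ (by simp)
  | pop k v S => exact key _ _ _ (by simp; omega)
  | seq _ _ h₁ h₂ => omega
  | ite_true _ _ h => omega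
  | ite_false _ _ h => omega
  | loop_false => omega
  | loop_true _ _ _ h₁ h₂ => omega

end Prog

end HiWRAC

/-! ### Runs with time bounds, and basic stack operations -/

namespace HiWRAC

namespace Prog

/-- `p` leads from the stacks `S` to `S'` in at most `n` steps, whatever the register holds. -/
def Run (p : Prog) (S : Fin 4 → List Sym) (n : ℕ) (S' : Fin 4 → List Sym) : Prop :=
  ∀ v, ∃ v', ∃ m ≤ n, Exec p v S m v' S'

/-- `p` leads from `S` to `S'` in at most `n` steps and leaves `v'` in the register. -/
def RunTo (p : Prog) (S : Fin 4 → List Sym) (n : ℕ) (v' : Option Sym) (S' : Fin 4 → List Sym) :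
    Prop :=
  ∀ v, ∃ m ≤ n, Exec p v S m v' S'

variable {p q : Prog} {S S' S'' : Fin 4 → List Sym} {n m : ℕ}

theorem RunTo.run {v : Option Sym} (h : RunTo p S n v S') : Run p S n S' :=
  fun w => ⟨v, h w⟩

theorem Run.mono (h : Run p S n S') (hm : n ≤ m) : Run p S m S' := fun v =>
  let ⟨v', k, hk, e⟩ := h v
  ⟨v', k, hk.trans hm, e⟩

theorem RunTo.mono {v : Option Sym} (h : RunTo p S n v S') (hm : n ≤ m) : RunTo p S m v S' :=
  fun w =>
  let ⟨k, hk, e⟩ := h w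
  ⟨k, hk.trans hm, e⟩

theorem Run.seq (h : Run p S n S') (h' : Run q S' m S'') : Run (.seq p q) S (n + m) S'' := fun v =>
  let ⟨_, _, hk, e⟩ := h v
  let ⟨v'', _, hk', e'⟩ := h' _
  ⟨v'', _, add_le_add hk hk', e.seq e'⟩

theorem Run.seqTo {v : Option Sym} (h : Run p S n S') (h' : RunTo q S' m v S'') :
    RunTo (.seq p q) S (n + m) v S'' := fun w =>
  let ⟨_, _, hk, e⟩ := h w
  let ⟨_, hk', e'⟩ := h' _
  ⟨_, add_le_add hk hk', e.seq e'⟩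

/-- Continue after a program according to the letter it leaves. -/
theorem RunTo.seq_exec {v : Option Sym} (h : RunTo p S n v S')
    (h' : ∃ v', ∃ k ≤ m, Exec q v S' k v' S'') : Run (.seq p q) S (n + m) S'' := fun w =>
  let ⟨_, hk, e⟩ := h w
  let ⟨v'', _, hk', e'⟩ := h'
  ⟨v'', _, add_le_add hk hk', e.seq e'⟩

theorem RunTo.seq_ite_true {v : Option Sym} {c : Option Sym → Bool} {q' : Prog}
    (h : RunTo p S n v S') (hc : c v = true) (h' : Run q S' m S'') :
    Run (.seq p (.ite c q q')) S (n + (m + 1)) S'' :=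
  h.seq_exec (let ⟨v', k, hk, e⟩ := h' v; ⟨v', k + 1, by omega, e.ite_true hc⟩)

theorem RunTo.seq_ite_false {v : Option Sym} {c : Option Sym → Bool} {q' : Prog}
    (h : RunTo p S n v S') (hc : c v = false) (h' : Run q' S' m S'') :
    Run (.seq p (.ite c q q')) S (n + (m + 1)) S'' :=
  h.seq_exec (let ⟨v', k, hk, e⟩ := h' v; ⟨v', k + 1, by omega, e.ite_false hc⟩)

theorem run_push (k : Fin 4) (s : Sym) (S : Fin 4 → List Sym) :
    Run (.push k fun _ => s) S 1 (Function.update S k (s :: S k)) :=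
  fun v => ⟨v, 1, le_rfl, .push k _ v S⟩

theorem upd0 (a b c d x : List Sym) : Function.update ![a, b, c, d] 0 x = ![x, b, c, d] := by
  funext k; fin_cases k <;> rfl

theorem upd1 (a b c d x : List Sym) : Function.update ![a, b, c, d] 1 x = ![a, x, c, d] := by
  funext k; fin_cases k <;> rfl

theorem upd2 (a b c d x : List Sym) : Function.update ![a, b, c, d] 2 x = ![a, b, x, d] := by
  funext k; fin_cases k <;> rfl

theorem upd3 (a b c d x : List Sym) : Function.update ![a, b, c, d] 3 x = ![a, b, c, x] := by
  funext k; fin_cases k <;> rfl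

theorem Exec.push_eq {k : Fin 4} {g : Option Sym → Sym} {v : Option Sym}
    (h : Function.update S k (g v :: S k) = S') : Exec (.push k g) v S 1 v S' :=
  h ▸ .push k g v S

theorem Exec.pop_eq {k : Fin 4} {v v' : Option Sym} (hv : (S k).head? = v')
    (h : Function.update S k (S k).tail = S') : Exec (.pop k) v S 1 v' S' :=
  h ▸ hv ▸ .pop k v S

theorem Exec.cast {v v' w w' : Option Sym} {T T' : Fin 4 → List Sym} (h : Exec p v S n v' S')
    (hv : v = w) (hS : S = T) (hn : n = m) (hv' : v' = w') (hS' : S' = T') :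
    Exec p w T m w' T' := by
  subst hv hS hn hv' hS'; exact h

theorem Run.cast {T T' : Fin 4 → List Sym} (h : Run p S n S') (hS : S = T) (hn : n ≤ m)
    (hS' : S' = T') : Run p T m T' := by
  subst hS hS'; exact h.mono hn

/-- The program that does nothing. -/
def skip : Prog := .loop (fun _ => false) (.pop 0)

theorem run_skip (S : Fin 4 → List Sym) : Run skip S 1 S :=
  fun v => ⟨v, 1, le_rfl, .loop_false rfl⟩

/-- Empty the stack `i` onto the stack `j`. -/
def pour (i j : Fin 4) : Prog :=
  .seq (.pop i) (.loop Option.isSome (.seq (.push j fun v => v.getD none) (.pop i)))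

theorem runTo_pour {i j : Fin 4} (hij : i ≠ j) (S : Fin 4 → List Sym) :
    RunTo (pour i j) S (3 * (S i).length + 2) none
      (Function.update (Function.update S i []) j ((S i).reverse ++ S j)) := by
  have key : ∀ (l : List Sym) (S : Fin 4 → List Sym), S i = l →
      Exec (.loop Option.isSome (.seq (.push j fun v => v.getD none) (.pop i)))
        l.head? (Function.update S i l.tail) (3 * l.length + 1) none
        (Function.update (Function.update S i []) j (l.reverse ++ S j)) := by
    intro l
    induction l with
    | nil =>
      intro S hS
      have : Function.update (Function.update S i []) j (S j) = Function.update S i [] := by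
        rw [Function.update_eq_self_iff, Function.update_of_ne hij.symm]
      simpa [this] using Exec.loop_false (p := .seq (.push j fun v => v.getD none) (.pop i))
        (c := Option.isSome) (v := none) (S := Function.update S i []) rfl
    | cons s l ih =>
      intro S hS
      have e1 : Exec (.push j fun v => v.getD none) (some s) (Function.update S i l) 1 (some s)
          (Function.update (Function.update S i l) j (s :: S j)) :=
        .push_eq (by rw [Function.update_of_ne hij.symm]; rfl)
      have hi : Function.update (Function.update S i l) j (s :: S j) i = l := by
        rw [Function.update_of_ne hij, Function.update_self]
      have e2 := Exec.pop i (some s) (Function.update (Function.update S i l) j (s :: S j))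
      rw [hi] at e2
      have e3 := Exec.loop_true (c := Option.isSome) rfl (e1.seq e2) (ih _ hi)
      have : 1 + 1 + (3 * l.length + 1) + 1 = 3 * (s :: l).length + 1 := by
        simp only [List.length_cons]; omega
      refine e3.cast rfl rfl this rfl ?_
      funext k
      simp only [Function.update_apply]
      split_ifs <;> simp_all
  intro v
  refine ⟨_, le_rfl, ?_⟩
  exact ((Exec.pop i v S).seq (key _ S rfl)).cast rfl rfl (by omega) rfl rfl

/-- Empty the stack `i`. -/
def clear (i : Fin 4) : Prog := .seq (.pop i) (.loop Option.isSome (.pop i))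

theorem runTo_clear (i : Fin 4) (S : Fin 4 → List Sym) :
    RunTo (clear i) S (2 * (S i).length + 2) none (Function.update S i []) := by
  have key : ∀ (l : List Sym) (S : Fin 4 → List Sym), S i = l →
      Exec (.loop Option.isSome (.pop i))
        l.head? (Function.update S i l.tail) (2 * l.length + 1) none (Function.update S i []) := by
    intro l
    induction l with
    | nil =>
      intro S hS
      exact Exec.loop_false rfl
    | cons s l ih =>
      intro S hS
      have e2 := Exec.pop i (some s) (Function.update S i l)
      rw [Function.update_self] at e2
      have e3 := Exec.loop_true (c := Option.isSome) rfl e2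
        (ih (Function.update S i l) (Function.update_self ..))
      rw [Function.update_idem] at e3
      exact e3.cast rfl rfl (by simp only [List.length_cons]; omega) rfl rfl
  intro v
  refine ⟨_, le_rfl, ?_⟩
  exact ((Exec.pop i v S).seq (key _ S rfl)).cast rfl rfl (by omega) rfl rfl

end Prog

/-! ### Binary trees as data -/

/-- Binary trees with a bit at every leaf. -/
inductive BTree
  | leaf (b : Bool)
  | node (l r : BTree)

/-- The word of a tree, in preorder. -/
def BTree.word : BTree → List Sym
  | leaf b => [some b]
  | node l r => none :: (l.word ++ r.word)

namespace Prog

/-- Is the letter an inner node? -/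
def isNode (v : Option Sym) : Bool := v == some none

/-- The loop of `take`: stack `3` counts the trees that remain after the current one. -/
def takeLoop : Prog :=
  .loop Option.isSome (.seq (.pop 0) (.seq (.push 1 fun v => v.getD none)
    (.ite isNode (.push 3 fun _ => none) (.pop 3))))

/-- Stated with a continuation: whatever the loop does once `t` has been moved, it also does with
`t` still on top, five steps per letter later. A node needs two subtrees instead of one, so it adds
one to the unary counter on stack `3`; a leaf completes a tree and removes one. The loop ends when a
pop finds the counter empty. The continuation form lets the two subtrees of a node be handled one
after the other. -/
theorem exec_takeLoop (t : BTree) : ∀ (m x y d : List Sym) (s : Sym) (k : ℕ) (v : Option Sym)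
    (S : Fin 4 → List Sym),
    Exec takeLoop d.head? ![m, t.word.reverse ++ x, y, d.tail] k v S →
    Exec takeLoop (some s) ![t.word ++ m, x, y, d] (k + 5 * t.word.length) v S := by
  induction t with
  | leaf b =>
    intro m x y d s k v S h
    have e1 : Exec (.pop 0) (some s) ![some b :: m, x, y, d] 1 (some (some b)) ![m, x, y, d] :=
      .pop_eq rfl (upd0 ..)
    have e2 : Exec (.push 1 fun v => v.getD none) (some (some b)) ![m, x, y, d] 1 (some (some b))
        ![m, some b :: x, y, d] := .push_eq (upd1 ..)
    have e3 : Exec (.pop 3) (some (some b)) ![m, some b :: x, y, d] 1 d.head?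
        ![m, some b :: x, y, d.tail] := .pop_eq rfl (upd3 ..)
    have e := Exec.loop_true (c := Option.isSome) (v := some s) rfl
      (e1.seq (e2.seq (e3.ite_false (c := isNode) (p := .push 3 fun _ => none) rfl))) h
    refine e.cast rfl rfl ?_ rfl rfl
    simp only [BTree.word, List.length_singleton]
    omega
  | node l r ihl ihr =>
    intro m x y d s k v S h
    have e1 : Exec (.pop 0) (some s) ![none :: (l.word ++ (r.word ++ m)), x, y, d] 1 (some none)
        ![l.word ++ (r.word ++ m), x, y, d] := .pop_eq rfl (upd0 ..)
    have e2 : Exec (.push 1 fun v => v.getD none) (some none) ![l.word ++ (r.word ++ m), x, y, d] 1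
        (some none) ![l.word ++ (r.word ++ m), none :: x, y, d] := .push_eq (upd1 ..)
    have e3 : Exec (.push 3 fun _ => none) (some none) ![l.word ++ (r.word ++ m), none :: x, y, d] 1
        (some none) ![l.word ++ (r.word ++ m), none :: x, y, none :: d] := .push_eq (upd3 ..)
    have h1 := ihr m (l.word.reverse ++ none :: x) y d none k v S (by
      simpa [BTree.word] using h)
    have h2 := ihl (r.word ++ m) (none :: x) y (none :: d) none _ v S h1
    have e := Exec.loop_true (c := Option.isSome) (v := some s) rfl
      (e1.seq (e2.seq (e3.ite_true (c := isNode) (q := .pop 3) rfl))) h2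
    refine e.cast rfl (by simp [BTree.word]) ?_ rfl rfl
    simp only [BTree.word, List.length_cons, List.length_append]
    omega

/-- Move the top tree, reversed, from stack `0` to stack `1`. -/
def take : Prog := .seq (.push 3 fun _ => none) (.seq (.pop 3) takeLoop)

theorem run_take (t : BTree) (m x y : List Sym) :
    Run take ![t.word ++ m, x, y, []] (5 * t.word.length + 3)
      ![m, t.word.reverse ++ x, y, []] := by
  refine Run.mono (n := 1 + (1 + (1 + 5 * t.word.length))) ?_ (by omega)
  have h := run_push 3 none ![t.word ++ m, x, y, []]
  rw [upd3] at h
  -- Pushing a letter on stack `3` and popping it again leaves the counter empty and puts a letter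
  -- into the register, whatever it held, so the loop is entered.
  refine h.seq (RunTo.seq_exec (v := some none) (S' := ![t.word ++ m, x, y, []]) ?_ ?_)
  · intro v
    exact ⟨1, le_rfl, .pop_eq rfl (upd3 ..)⟩
  · exact ⟨none, _, le_rfl, exec_takeLoop t m x y [] none 1 none _ (.loop_false rfl)⟩

/-- The stacks between two operations. -/
abbrev stk (m : List Sym) : Fin 4 → List Sym := ![m, [], [], []]

/-- Remove the top tree. -/
def drop : Prog := .seq take (clear 1)

theorem run_drop (t : BTree) (m : List Sym) :
    Run drop (stk (t.word ++ m)) (10 * t.word.length + 10) (stk m) := by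
  have h := (runTo_clear 1 ![m, t.word.reverse ++ [], [], []]).run
  rw [upd1] at h
  refine ((run_take t m [] []).seq h).mono ?_
  simp
  omega

/-- Exchange the two top trees. -/
def swap : Prog :=
  .seq take (.seq (pour 1 2) (.seq take (.seq (pour 2 3) (.seq (pour 3 0) (pour 1 0)))))

theorem run_swap (t u : BTree) (m : List Sym) :
    Run swap (stk (t.word ++ (u.word ++ m))) (30 * (t.word.length + u.word.length + 1))
      (stk (u.word ++ (t.word ++ m))) := by
  have h2 := (runTo_pour (i := 1) (j := 2) (by decide) ![u.word ++ m, t.word.reverse, [], []]).run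
  rw [upd1, upd2] at h2
  have h4 := (runTo_pour (i := 2) (j := 3) (by decide) ![m, u.word.reverse, t.word, []]).run
  rw [upd2, upd3] at h4
  have h5 := (runTo_pour (i := 3) (j := 0) (by decide) ![m, u.word.reverse, [], t.word.reverse]).run
  rw [upd3, upd0] at h5
  have h6 := (runTo_pour (i := 1) (j := 0) (by decide) ![t.word ++ m, u.word.reverse, [], []]).run
  rw [upd1, upd0] at h6
  refine (((run_take t (u.word ++ m) [] []).cast rfl le_rfl (by simp)).seq (h2.seq
    (((run_take u m [] t.word).cast (by simp) le_rfl (by simp)).seq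
    ((h4.cast rfl le_rfl (by simp)).seq ((h5.cast rfl le_rfl (by simp)).seq h6))))).cast rfl ?_
      (by simp)
  simp
  omega

/-- Empty the stack `1` onto the stacks `0` and `2`. -/
def fork : Prog :=
  .seq (.pop 1) (.loop Option.isSome
    (.seq (.push 0 fun v => v.getD none) (.seq (.push 2 fun v => v.getD none) (.pop 1))))

theorem run_fork (l m : List Sym) :
    Run fork ![m, l, [], []] (4 * l.length + 2) ![l.reverse ++ m, [], l.reverse, []] := by
  have key : ∀ (l m y : List Sym),
      Exec (.loop Option.isSome
        (.seq (.push 0 fun v => v.getD none) (.seq (.push 2 fun v => v.getD none) (.pop 1))))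
        l.head? ![m, l.tail, y, []] (4 * l.length + 1) none
        ![l.reverse ++ m, [], l.reverse ++ y, []] := by
    intro l
    induction l with
    | nil => intro m y; exact .loop_false rfl
    | cons s l ih =>
      intro m y
      have e1 : Exec (.push 0 fun v => v.getD none) (some s) ![m, l, y, []] 1 (some s)
        ![s :: m, l, y, []] := .push_eq (upd0 ..)
      have e2 : Exec (.push 2 fun v => v.getD none) (some s) ![s :: m, l, y, []] 1 (some s)
        ![s :: m, l, s :: y, []] := .push_eq (upd2 ..)
      have e3 : Exec (.pop 1) (some s) ![s :: m, l, s :: y, []] 1 l.head?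
        ![s :: m, l.tail, s :: y, []] := .pop_eq rfl (upd1 ..)
      exact (Exec.loop_true (c := Option.isSome) rfl (e1.seq (e2.seq e3)) (ih _ _)).cast rfl rfl
        (by simp only [List.length_cons]; omega) rfl (by simp)
  intro v
  have e : Exec (.pop 1) v ![m, l, [], []] 1 l.head? ![m, l.tail, [], []] := .pop_eq rfl (upd1 ..)
  exact ⟨none, _, le_rfl, (e.seq (key l m [])).cast rfl rfl (by omega) rfl (by simp)⟩

/-- Duplicate the top tree. -/
def dup : Prog := .seq take (.seq fork (.seq (pour 2 3) (pour 3 0)))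

theorem run_dup (t : BTree) (m : List Sym) :
    Run dup (stk (t.word ++ m)) (20 * t.word.length + 20) (stk (t.word ++ (t.word ++ m))) := by
  have h4 := (runTo_pour (i := 2) (j := 3) (by decide) ![t.word ++ m, [], t.word, []]).run
  rw [upd2, upd3] at h4
  have h5 := (runTo_pour (i := 3) (j := 0) (by decide) ![t.word ++ m, [], [], t.word.reverse]).run
  rw [upd3, upd0] at h5
  refine (((run_take t m [] []).cast rfl le_rfl (by simp)).seq
    (((run_fork t.word.reverse m).cast rfl le_rfl (by simp)).seq
    ((h4.cast rfl le_rfl (by simp)).seq h5))).cast rfl ?_ (by simp)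
  simp
  omega

/-- Push a word on the stack `0`. -/
def pushAll : List Sym → Prog
  | [] => skip
  | s :: w => .seq (pushAll w) (.push 0 fun _ => s)

theorem run_pushAll (w m : List Sym) : Run (pushAll w) (stk m) (w.length + 1) (stk (w ++ m)) := by
  induction w with
  | nil => exact run_skip _
  | cons s w ih =>
    have h := run_push 0 s (stk (w ++ m))
    rw [upd0] at h
    exact (ih.seq h).cast rfl (by simp) rfl

theorem run_pushNode (m : List Sym) : Run (.push 0 fun _ => none) (stk m) 1 (stk (none :: m)) := by
  have h := run_push 0 none (stk m)
  rwa [upd0] at h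

theorem runTo_popHead (s : Sym) (m : List Sym) : RunTo (.pop 0) (stk (s :: m)) 1 (some s) (stk m) := by
  intro v
  exact ⟨1, le_rfl, .pop_eq rfl (upd0 ..)⟩

end Prog
end HiWRAC

namespace HiWRAC

/-! ### Polynomial time functions on encoded data -/

/-- Types whose elements are encoded as trees. -/
class Enc (α : Type) where
  tree : α → BTree

/-- The word of an element. -/
def word {α : Type} [Enc α] (a : α) : List Sym := (Enc.tree a).word

/-- The length of the word of an element. -/
def size {α : Type} [Enc α] (a : α) : ℕ := (word a).length

instance : Enc Bool := ⟨.leaf⟩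

instance {α β : Type} [Enc α] [Enc β] : Enc (α × β) := ⟨fun x => .node (Enc.tree x.1) (Enc.tree x.2)⟩

/-- The tree of a list. -/
def listTree {α : Type} [Enc α] : List α → BTree
  | [] => .leaf false
  | a :: l => .node (Enc.tree a) (listTree l)

instance {α : Type} [Enc α] : Enc (List α) := ⟨listTree⟩

instance : Enc ℕ := ⟨fun n => Enc.tree n.bits⟩

variable {α β γ δ σ : Type} [Enc α] [Enc β] [Enc γ] [Enc δ] [Enc σ]

@[simp] theorem size_bool (b : Bool) : size b = 1 := rfl

@[simp] theorem size_pair (x : α × β) : size x = size x.1 + size x.2 + 1 := by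
  simp [size, word, Enc.tree, BTree.word]

@[simp] theorem size_nil : size ([] : List α) = 1 := rfl

@[simp] theorem size_cons (a : α) (l : List α) : size (a :: l) = size a + size l + 1 := by
  simp [size, word, Enc.tree, BTree.word, listTree]

theorem size_nat (n : ℕ) : size n = size n.bits := rfl

theorem size_pos (a : α) : 0 < size a := by
  unfold size word
  cases Enc.tree a <;> simp [BTree.word]

theorem size_mem_lt {a : α} {l : List α} (h : a ∈ l) : size a < size l := by
  induction l with
  | nil => simp at h
  | cons b l ih =>
    rcases List.mem_cons.1 h with rfl | h
    · simp
    · have := ih h; simp; omega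

theorem length_lt_size (l : List α) : l.length < size l := by
  induction l with
  | nil => simp
  | cons a l ih => simp; omega

theorem eval_mono (q : Polynomial ℕ) {m n : ℕ} (h : m ≤ n) : q.eval m ≤ q.eval n := by
  rw [Polynomial.eval_eq_sum_range, Polynomial.eval_eq_sum_range]
  exact Finset.sum_le_sum fun i _ => Nat.mul_le_mul_left _ (Nat.pow_le_pow_left h i)

/-- Bounded by a polynomial in the size of the argument. -/
@[fun_prop] def PolyBounded (g : α → ℕ) : Prop := ∃ q : Polynomial ℕ, ∀ a, g a ≤ q.eval (size a)

namespace PolyBounded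

theorem mono {f g : α → ℕ} (hg : PolyBounded g) (h : ∀ a, f a ≤ g a) : PolyBounded f :=
  let ⟨q, hq⟩ := hg
  ⟨q, fun a => (h a).trans (hq a)⟩

@[fun_prop] theorem const (n : ℕ) : PolyBounded fun _ : α => n := ⟨Polynomial.C n, by simp⟩

@[fun_prop] theorem size_self : PolyBounded fun a : α => size a := ⟨Polynomial.X, by simp⟩

@[fun_prop] theorem add {f g : α → ℕ} (hf : PolyBounded f) (hg : PolyBounded g) :
    PolyBounded fun a => f a + g a :=
  let ⟨q, hq⟩ := hf
  let ⟨r, hr⟩ := hg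
  ⟨q + r, fun a => by rw [Polynomial.eval_add]; exact add_le_add (hq a) (hr a)⟩

@[fun_prop] theorem mul {f g : α → ℕ} (hf : PolyBounded f) (hg : PolyBounded g) :
    PolyBounded fun a => f a * g a :=
  let ⟨q, hq⟩ := hf
  let ⟨r, hr⟩ := hg
  ⟨q * r, fun a => by rw [Polynomial.eval_mul]; exact Nat.mul_le_mul (hq a) (hr a)⟩

/-- The composition with a polynomial. -/
@[fun_prop] theorem eval (q : Polynomial ℕ) {f : α → ℕ} (hf : PolyBounded f) :
    PolyBounded fun a => q.eval (f a) :=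
  let ⟨r, hr⟩ := hf
  ⟨q.comp r, fun a => by rw [Polynomial.eval_comp]; exact eval_mono q (hr a)⟩

end PolyBounded

open Prog

/-- Functions computed by a program in polynomial time. -/
@[fun_prop] def PolyTime (f : α → β) : Prop :=
  ∃ (p : Prog) (T : α → ℕ), PolyBounded T ∧
    ∀ a r, Run p (stk (word a ++ r)) (T a) (stk (word (f a) ++ r))

namespace PolyTime

/-- A step adds at most one letter to the stacks, so the running time also bounds the growth of the
data. This is what makes composition stay polynomial. -/
theorem polyBounded_size {f : α → β} (hf : PolyTime f) : PolyBounded fun a => size (f a) := by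
  obtain ⟨p, T, hT, h⟩ := hf
  refine (PolyBounded.size_self.add hT).mono fun a => ?_
  obtain ⟨v, m, hm, e⟩ := h a [] none
  have := e.length_le
  simp [Fin.sum_univ_four] at this
  simp only [size]
  omega

/-- Composition of a bound with a polynomial time function. -/
theorem polyBounded_comp {f : α → β} {g : β → ℕ} (hg : PolyBounded g) (hf : PolyTime f) :
    PolyBounded fun a => g (f a) :=
  let ⟨q, hq⟩ := hg
  (hf.polyBounded_size.eval q).mono fun a => hq (f a)

@[fun_prop] protected theorem id : PolyTime fun a : α => a :=
  ⟨skip, fun _ => 1, by fun_prop, fun _ _ => run_skip _⟩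

/-- A function that does not change the encoding. -/
theorem of_word_eq {f : α → β} (h : ∀ a, word (f a) = word a) : PolyTime f :=
  ⟨skip, fun _ => 1, by fun_prop, fun a r => by rw [h]; exact run_skip _⟩

@[fun_prop] theorem const (b : β) : PolyTime fun _ : α => b :=
  ⟨.seq drop (pushAll (word b)), fun a => 10 * size a + 10 + (size b + 1), by fun_prop,
    fun a r => (run_drop _ r).seq (run_pushAll _ r)⟩

@[fun_prop] theorem comp {g : β → γ} {f : α → β} (hg : PolyTime g) (hf : PolyTime f) :
    PolyTime fun a => g (f a) := by
  have hf' := hf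
  obtain ⟨p, T, hT, h⟩ := hf
  obtain ⟨q, U, hU, k⟩ := hg
  exact ⟨.seq p q, fun a => T a + U (f a), hT.add (polyBounded_comp hU hf'),
    fun a r => (h a r).seq (k (f a) r)⟩

-- A program consumes its argument, so it is copied first. The second component is computed first,
-- because the first one has to end up on top.
@[fun_prop] theorem prodMk {f : α → β} {g : α → γ} (hf : PolyTime f) (hg : PolyTime g) :
    PolyTime fun a => (f a, g a) := by
  have hg' := hg.polyBounded_size
  obtain ⟨p, T, hT, h⟩ := hf
  obtain ⟨q, U, hU, k⟩ := hg
  refine ⟨.seq dup (.seq q (.seq swap (.seq p (.push 0 fun _ => none)))),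
    fun a => (20 * size a + 20) + (U a + (30 * (size (g a) + size a + 1) + (T a + 1))), by fun_prop,
    fun a r => ?_⟩
  refine ((run_dup _ r).seq ((k a _).seq ((run_swap _ _ r).seq
    ((h a _).seq (run_pushNode _))))).cast rfl le_rfl ?_
  simp [word, Enc.tree, BTree.word]

theorem fst' : PolyTime fun x : α × β => x.1 := by
  refine ⟨.seq (.pop 0) (.seq swap drop), fun a => 1 + (30 * (size a.1 + size a.2 + 1) +
    (10 * size a.2 + 10)), ?_, fun a r => ?_⟩
  · refine PolyBounded.mono (g := fun a => 50 * size a + 50) (by fun_prop) fun a => ?_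
    simp; omega
  · exact ((runTo_popHead none _).run.seq ((run_swap _ _ r).seq (run_drop _ _))).cast
      (by simp [word, Enc.tree, BTree.word]) le_rfl rfl

theorem snd' : PolyTime fun x : α × β => x.2 := by
  refine ⟨.seq (.pop 0) drop, fun a => 1 + (10 * size a.1 + 10), ?_, fun a r => ?_⟩
  · refine PolyBounded.mono (g := fun a => 50 * size a + 50) (by fun_prop) fun a => ?_
    simp; omega
  · exact ((runTo_popHead none _).run.seq (run_drop _ _)).cast
      (by simp [word, Enc.tree, BTree.word]) le_rfl rfl

@[fun_prop] theorem fst {f : α → β × γ} (hf : PolyTime f) : PolyTime fun a => (f a).1 :=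
  fst'.comp hf

@[fun_prop] theorem snd {f : α → β × γ} (hf : PolyTime f) : PolyTime fun a => (f a).2 :=
  snd'.comp hf

@[fun_prop] protected theorem cons {f : α → β} {l : α → List β} (hf : PolyTime f)
    (hl : PolyTime l) : PolyTime fun a => f a :: l a :=
  (of_word_eq (f := fun x : β × List β => x.1 :: x.2) fun _ => rfl).comp (hf.prodMk hl)

@[fun_prop] protected theorem cond {c : α → Bool} {f g : α → β} (hc : PolyTime c) (hf : PolyTime f)
    (hg : PolyTime g) : PolyTime fun a => cond (c a) (f a) (g a) := by
  obtain ⟨p, T, hT, h⟩ := hf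
  obtain ⟨q, U, hU, k⟩ := hg
  obtain ⟨t, V, hV, l⟩ := hc
  refine ⟨.seq dup (.seq t (.seq (.pop 0) (.ite (fun v => v == some (some true)) p q))),
    fun a => (20 * size a + 20) + (V a + (1 + (T a + U a + 1))), by fun_prop, fun a r => ?_⟩
  refine (run_dup _ r).seq ((l a _).seq ?_)
  cases hca : c a
  · exact (RunTo.seq_ite_false (v := some (some false)) (runTo_popHead _ _) rfl
      ((k a r).cast rfl (by omega) (by simp [hca])))
  · exact (RunTo.seq_ite_true (v := some (some true)) (runTo_popHead _ _) rfl
      ((h a r).cast rfl (by omega) (by simp [hca])))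

/-- Case distinction on a list. -/
@[fun_prop] theorem listCases {l : α → List β} {f : α → γ} {g : α → β → List β → γ} (hl : PolyTime l)
    (hf : PolyTime f) (hg : PolyTime fun x : α × β × List β => g x.1 x.2.1 x.2.2) :
    PolyTime fun a => (List.casesOn (l a) (f a) (fun b t => g a b t) : γ) := by
  have hl' := hl.polyBounded_size
  obtain ⟨p, T, hT, h⟩ := hf
  obtain ⟨q, U, ⟨u, hu⟩, k⟩ := hg
  obtain ⟨t, V, hV, e⟩ := hl
  -- The first letter of the word of a list tells whether the list is empty. If it is not, that
  -- letter is put back, the list is exchanged with the copy of `a`, and a new node on top turns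
  -- `a`, `b`, `s` into the encoding of the triple.
  refine ⟨.seq dup (.seq t (.seq (.pop 0) (.ite isNode
    (.seq (.push 0 fun _ => none) (.seq swap (.seq (.push 0 fun _ => none) q))) p))),
    fun a => (20 * size a + 20) + (V a + (1 + ((1 + (30 * (size (l a) + size a + 1) +
      (1 + u.eval (size a + size (l a) + 1)))) + T a + 1))), by fun_prop, fun a r => ?_⟩
  refine (run_dup _ r).seq ((e a _).seq ?_)
  cases hca : l a with
  | nil =>
    exact (RunTo.seq_ite_false (v := some (some false)) (runTo_popHead _ _) rfl
      ((h a r).cast rfl (by omega) (by simp [hca])))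
  | cons b s =>
    refine ((RunTo.seq_ite_true (v := some none) (runTo_popHead _ (word b ++ (word s ++ (word a ++ r))))
      rfl (m := (1 + (30 * (size (b :: s) + size a + 1) +
      (1 + U (a, b, s))))) ?_).cast ?_ ?_ rfl)
    · refine (run_pushNode _).seq (((run_swap (Enc.tree (b, s)) (Enc.tree a) r).cast ?_ le_rfl
        rfl).seq ((run_pushNode _).seq ((k (a, b, s) r).cast ?_ le_rfl (by simp [hca]))))
      · simp [word, Enc.tree, BTree.word]
      · simp [word, Enc.tree, BTree.word]
    · simp [word, Enc.tree, BTree.word, listTree]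
    · have := (hu (a, b, s)).trans (eval_mono u (n := size a + size (b :: s) + 1) (by simp))
      omega

/-- Iterate a function while a test holds. -/
theorem iterateWhile {start : α → σ} {step : σ → σ} {test : σ → Bool} {N : α → ℕ} {B : α → ℕ}
    (hstart : PolyTime start) (hstep : PolyTime step) (htest : PolyTime test) (hN : PolyBounded N)
    (hB : PolyBounded B) (hsize : ∀ a, ∀ k ≤ N a, size (step^[k] (start a)) ≤ B a)
    (htrue : ∀ a, ∀ k < N a, test (step^[k] (start a)) = true)
    (hfalse : ∀ a, test (step^[N a] (start a)) = false) :
    PolyTime fun a => step^[N a] (start a) := by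
  obtain ⟨p, T, hT, h⟩ := hstart
  obtain ⟨q, U, ⟨u, hu⟩, k⟩ := hstep
  obtain ⟨t, V, ⟨w, hw⟩, e⟩ := htest
  let chk : Prog := .seq dup (.seq t (.pop 0))
  have hchk : ∀ s r, RunTo chk (stk (word s ++ r)) (20 * size s + 20 + (V s + 1))
      (some (some (test s))) (stk (word s ++ r)) := fun s r =>
    (run_dup _ r).seqTo ((e s _).seqTo (runTo_popHead _ _))
  let body : Prog := .seq q chk
  let C : α → ℕ := fun a => u.eval (B a) + (20 * B a + 20 + (w.eval (B a) + 1)) + 1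
  -- Induction on the number `j` of rounds still to come; `C a` bounds the time of one round, using
  -- that all states have size at most `B a`.
  have hloop : ∀ a r j i, i + j = N a →
      ∃ v, ∃ m ≤ j * C a + 1, Exec (.loop (fun v => v == some (some true)) body)
        (some (some (test (step^[i] (start a))))) (stk (word (step^[i] (start a)) ++ r)) m v
        (stk (word (step^[N a] (start a)) ++ r)) := by
    intro a r j
    induction j with
    | zero =>
      intro i hi
      obtain rfl : i = N a := by omega
      exact ⟨_, 1, by omega, .loop_false (by rw [hfalse]; rfl)⟩
    | succ j ih =>
      intro i hi
      obtain ⟨v, m, hm, e⟩ := ih (i + 1) (by omega)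
      obtain ⟨n, hn, e'⟩ := (k (step^[i] (start a)) r).seqTo (hchk _ r)
        (some (some (test (step^[i] (start a)))))
      rw [Function.iterate_succ_apply'] at e
      refine ⟨v, n + m + 1, ?_, .loop_true (by rw [htrue a i (by omega)]; rfl) e' e⟩
      have h1 := hsize a i (by omega)
      have h2 := hsize a (i + 1) (by omega)
      rw [Function.iterate_succ_apply'] at h2
      have h3 := (hu (step^[i] (start a))).trans (eval_mono u h1)
      have h4 := (hw (step (step^[i] (start a)))).trans (eval_mono w h2)
      have : n ≤ C a - 1 := by simp only [C]; omega
      have h5 : 1 ≤ C a := by simp only [C]; omega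
      rw [add_mul]
      omega
  refine ⟨.seq p (.seq chk (.loop (fun v => v == some (some true)) body)),
    fun a => T a + ((20 * B a + 20 + (w.eval (B a) + 1)) + (N a * C a + 1)), by fun_prop,
    fun a r => ?_⟩
  refine (h a r).seq (RunTo.seq_exec ((hchk (start a) r).mono ?_) (hloop a r (N a) 0 (by omega)))
  have h1 := hsize a 0 (by omega)
  have h2 := (hw (start a)).trans (eval_mono w h1)
  simp only [Function.iterate_zero, id] at h1
  omega

end PolyTime

end HiWRAC

namespace HiWRAC

variable {α β γ δ σ : Type} [Enc α] [Enc β] [Enc γ] [Enc δ] [Enc σ]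

/-! ### Lists -/

theorem size_tail_le (l : List α) : size l.tail ≤ size l := by
  cases l <;> simp
  omega

theorem size_drop_le (k : ℕ) (l : List α) : size (l.drop k) ≤ size l := by
  induction k generalizing l with
  | zero => simp
  | succ k ih => rw [← List.drop_tail]; exact (ih _).trans (size_tail_le l)

namespace PolyTime

/-- The fold is a while loop on triples (argument, accumulator, remaining list). The bound on all
intermediate accumulators is indispensable: a polynomial time step that doubles the size would lead
to exponential growth. -/
theorem foldl_of_bound {l : α → List β} {i : α → γ} {s : α → γ → β → γ} (hl : PolyTime l)
    (hi : PolyTime i) (hs : PolyTime fun x : α × γ × β => s x.1 x.2.1 x.2.2) {B : α → ℕ}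
    (hB : PolyBounded B) (h : ∀ a l', l' <+: l a → size (l'.foldl (s a) (i a)) ≤ B a) :
    PolyTime fun a => (l a).foldl (s a) (i a) := by
  let start : α → α × γ × List β := fun a => (a, i a, l a)
  let step : α × γ × List β → α × γ × List β := fun x =>
    List.casesOn x.2.2 x fun b t => (x.1, s x.1 x.2.1 b, t)
  let test : α × γ × List β → Bool := fun x => List.casesOn x.2.2 false fun _ _ => true
  have hstep : PolyTime step := by
    have : PolyTime fun x : (α × γ × List β) × β × List β => s x.1.1 x.1.2.1 x.2.1 :=
      hs.comp (f := fun x : (α × γ × List β) × β × List β => (x.1.1, x.1.2.1, x.2.1)) (by fun_prop)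
    simp only [step]
    fun_prop
  have htest : PolyTime test := by
    simp only [test]
    fun_prop
  have key : ∀ a k, k ≤ (l a).length →
      step^[k] (start a) = (a, ((l a).take k).foldl (s a) (i a), (l a).drop k) := by
    intro a k
    induction k with
    | zero => simp [start]
    | succ k ih =>
      intro hk
      rw [Function.iterate_succ_apply', ih (by omega), List.drop_eq_getElem_cons (by omega)]
      simp only [step]
      rw [List.take_succ_eq_append_getElem (by omega), List.foldl_append]
      rfl
  have hl' := hl.polyBounded_size
  have := iterateWhile (start := start) (step := step) (test := test) (N := fun a => (l a).length)
    (B := fun a => size a + (B a + size (l a) + 1) + 1) (by fun_prop) hstep htest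
    (hl'.mono fun a => (length_lt_size _).le) (by fun_prop)
    (fun a k hk => by
      rw [key a k hk]
      have h1 := h a _ ⟨_, List.take_append_drop k (l a)⟩
      have h2 := size_drop_le k (l a)
      simp only [size_pair]
      omega)
    (fun a k hk => by
      rw [key a k hk.le, List.drop_eq_getElem_cons hk])
    (fun a => by rw [key a _ le_rfl, List.drop_length])
  have h2 := this.snd.fst
  refine (funext fun a => ?_ : (fun a => (l a).foldl (s a) (i a)) = _) ▸ h2
  rw [key a _ le_rfl, List.take_length]

/-- If each step enlarges the accumulator by an additive amount that does not depend on the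
accumulator, the sizes stay polynomial. -/
theorem foldl_of_add {l : α → List β} {i : α → γ} {s : α → γ → β → γ} (hl : PolyTime l)
    (hi : PolyTime i) (hs : PolyTime fun x : α × γ × β => s x.1 x.2.1 x.2.2) {e : α → ℕ}
    (he : PolyBounded e) (h : ∀ a c, ∀ b ∈ l a, size (s a c b) ≤ size c + e a) :
    PolyTime fun a => (l a).foldl (s a) (i a) := by
  have hl' := hl.polyBounded_size
  have hi' := hi.polyBounded_size
  refine foldl_of_bound hl hi hs (B := fun a => size (i a) + size (l a) * e a) (by fun_prop) ?_
  intro a l' hl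
  have : ∀ (m : List β) (c : γ), (∀ b ∈ m, b ∈ l a) →
      size (m.foldl (s a) c) ≤ size c + m.length * e a := by
    intro m
    induction m with
    | nil => simp
    | cons b m ih =>
      intro c hm
      have h1 := ih (s a c b) fun b hb => hm b (by simp [hb])
      have h2 := h a c b (hm b (by simp))
      simp only [List.foldl_cons, List.length_cons, add_mul]
      omega
  refine (this l' (i a) fun b hb => hl.subset hb).trans ?_
  have := hl.length_le.trans (length_lt_size (l a)).le
  gcongr

/-- A bound that is uniform in the elements of a list. -/
theorem exists_bound_mem {l : α → List β} (hl : PolyTime l) {g : α → β → ℕ}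
    (hg : PolyBounded fun x : α × β => g x.1 x.2) :
    ∃ e : α → ℕ, PolyBounded e ∧ ∀ a, ∀ b ∈ l a, g a b ≤ e a := by
  obtain ⟨q, hq⟩ := hg
  have hl' := hl.polyBounded_size
  refine ⟨fun a => q.eval (size a + size (l a) + 1), by fun_prop, fun a b hb => ?_⟩
  refine (hq (a, b)).trans (eval_mono q ?_)
  have := size_mem_lt hb
  simp
  omega

@[fun_prop] theorem or {f g : α → Bool} (hf : PolyTime f) (hg : PolyTime g) :
    PolyTime fun a => f a || g a := by
  have : PolyTime fun a => cond (f a) true (g a) := by fun_prop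
  refine (funext fun a => ?_ : (fun a => f a || g a) = _) ▸ this
  cases f a <;> rfl

@[fun_prop] theorem and {f g : α → Bool} (hf : PolyTime f) (hg : PolyTime g) :
    PolyTime fun a => f a && g a := by
  have : PolyTime fun a => cond (f a) (g a) false := by fun_prop
  refine (funext fun a => ?_ : (fun a => f a && g a) = _) ▸ this
  cases f a <;> rfl

@[fun_prop] theorem not {f : α → Bool} (hf : PolyTime f) : PolyTime fun a => !f a := by
  have : PolyTime fun a => cond (f a) false true := by fun_prop
  refine (funext fun a => ?_ : (fun a => !f a) = _) ▸ this
  cases f a <;> rfl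

@[fun_prop] theorem any {l : α → List β} {f : α → β → Bool} (hl : PolyTime l)
    (hf : PolyTime fun x : α × β => f x.1 x.2) : PolyTime fun a => (l a).any (f a) := by
  have hs : PolyTime fun x : α × Bool × β => x.2.1 || f x.1 x.2.2 := by
    have : PolyTime fun x : α × Bool × β => f x.1 x.2.2 :=
      hf.comp (f := fun x : α × Bool × β => (x.1, x.2.2)) (by fun_prop)
    fun_prop
  have := foldl_of_add (s := fun a c b => c || f a b) hl (const false) hs
    (e := fun _ => 0) (by fun_prop) (by simp)
  refine (funext fun a => ?_ : (fun a => (l a).any (f a)) = _) ▸ this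
  have : ∀ (m : List β) (c : Bool), m.foldl (fun c b => c || f a b) c = (c || m.any (f a)) := by
    intro m
    induction m with
    | nil => simp
    | cons b m ih => intro c; simp [ih, Bool.or_assoc]
  simp [this]

@[fun_prop] theorem all {l : α → List β} {f : α → β → Bool} (hl : PolyTime l)
    (hf : PolyTime fun x : α × β => f x.1 x.2) : PolyTime fun a => (l a).all (f a) := by
  have : PolyTime fun a => !(l a).any fun b => !f a b := by fun_prop
  refine (funext fun a => ?_ : (fun a => (l a).all (f a)) = _) ▸ this
  rw [List.not_any_eq_all_not]
  simp

@[fun_prop] theorem reverse {l : α → List β} (hl : PolyTime l) : PolyTime fun a => (l a).reverse := by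
  have hl' := hl.polyBounded_size
  have := foldl_of_add (s := fun _ c b => b :: c) hl (const []) (by fun_prop)
    (e := fun a => size (l a)) hl' (fun a c b hb => by
      have := size_mem_lt hb; simp; omega)
  refine (funext fun a => ?_ : (fun a => (l a).reverse) = _) ▸ this
  simp

@[fun_prop] theorem append {l m : α → List β} (hl : PolyTime l) (hm : PolyTime m) :
    PolyTime fun a => l a ++ m a := by
  have hl' := hl.reverse.polyBounded_size
  have := foldl_of_add (s := fun _ c b => b :: c) hl.reverse hm (by fun_prop)
    (e := fun a => size (l a).reverse) hl' (fun a c b hb => by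
      have := size_mem_lt hb; simp; omega)
  refine (funext fun a => ?_ : (fun a => l a ++ m a) = _) ▸ this
  simp

@[fun_prop] theorem map {l : α → List β} {f : α → β → γ} (hl : PolyTime l)
    (hf : PolyTime fun x : α × β => f x.1 x.2) : PolyTime fun a => (l a).map (f a) := by
  obtain ⟨e, he, h⟩ := exists_bound_mem hl (g := fun a b => size (f a b)) hf.polyBounded_size
  have hs : PolyTime fun x : α × List γ × β => f x.1 x.2.2 :: x.2.1 := by
    have : PolyTime fun x : α × List γ × β => f x.1 x.2.2 :=
      hf.comp (f := fun x : α × List γ × β => (x.1, x.2.2)) (by fun_prop)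
    fun_prop
  have := (foldl_of_add (s := fun a c b => f a b :: c) hl (const []) hs (e := fun a => e a + 1)
    (by fun_prop) (fun a c b hb => by have := h a b hb; simp; omega)).reverse
  refine (funext fun a => ?_ : (fun a => (l a).map (f a)) = _) ▸ this
  have : ∀ (m : List β) (c : List γ),
      m.foldl (fun c b => f a b :: c) c = (m.map (f a)).reverse ++ c := by
    intro m
    induction m with
    | nil => simp
    | cons b m ih => intro c; simp [ih]
  simp [this]

@[simp] theorem _root_.HiWRAC.size_append (l m : List α) : size (l ++ m) + 1 = size l + size m := by
  induction l with
  | nil => simp; omega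
  | cons a l ih => simp; omega

@[fun_prop] theorem flatMap {l : α → List β} {f : α → β → List γ} (hl : PolyTime l)
    (hf : PolyTime fun x : α × β => f x.1 x.2) : PolyTime fun a => (l a).flatMap (f a) := by
  obtain ⟨e, he, h⟩ := exists_bound_mem hl (g := fun a b => size (f a b)) hf.polyBounded_size
  have hs : PolyTime fun x : α × List γ × β => x.2.1 ++ f x.1 x.2.2 := by
    have : PolyTime fun x : α × List γ × β => f x.1 x.2.2 :=
      hf.comp (f := fun x : α × List γ × β => (x.1, x.2.2)) (by fun_prop)
    fun_prop
  have := (foldl_of_add (s := fun a c b => c ++ f a b) hl (const []) hs (e := fun a => e a)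
    (by fun_prop) (fun a c b hb => by have := h a b hb; have := size_append c (f a b); omega))
  refine (funext fun a => ?_ : (fun a => (l a).flatMap (f a)) = _) ▸ this
  have : ∀ (m : List β) (c : List γ),
      m.foldl (fun c b => c ++ f a b) c = c ++ m.flatMap (f a) := by
    intro m
    induction m with
    | nil => simp
    | cons b m ih => intro c; simp [ih]
  simp [this]

@[fun_prop] theorem filter {l : α → List β} {f : α → β → Bool} (hl : PolyTime l)
    (hf : PolyTime fun x : α × β => f x.1 x.2) : PolyTime fun a => (l a).filter (f a) := by
  have : PolyTime fun a => (l a).flatMap fun b => cond (f a b) [b] [] := by fun_prop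
  refine (funext fun a => ?_ : (fun a => (l a).filter (f a)) = _) ▸ this
  generalize l a = m
  induction m with
  | nil => rfl
  | cons b m ih => cases h : f a b <;> simp [h, ih]

@[fun_prop] theorem headD {l : α → List β} {d : α → β} (hl : PolyTime l) (hd : PolyTime d) :
    PolyTime fun a => (l a).headD (d a) := by
  have : PolyTime fun a => (List.casesOn (l a) (d a) fun b _ => b : β) := by fun_prop
  refine (funext fun a => ?_ : (fun a => (l a).headD (d a)) = _) ▸ this
  cases l a <;> rfl

@[fun_prop] theorem tail {l : α → List β} (hl : PolyTime l) : PolyTime fun a => (l a).tail := by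
  have : PolyTime fun a => (List.casesOn (l a) [] fun _ t => t : List β) := by fun_prop
  refine (funext fun a => ?_ : (fun a => (l a).tail) = _) ▸ this
  cases l a <;> rfl

@[fun_prop] theorem isEmpty {l : α → List β} (hl : PolyTime l) : PolyTime fun a => (l a).isEmpty := by
  have : PolyTime fun a => (List.casesOn (l a) true fun _ _ => false : Bool) := by fun_prop
  refine (funext fun a => ?_ : (fun a => (l a).isEmpty) = _) ▸ this
  cases l a <;> rfl

@[fun_prop] theorem dropWhile {l : α → List β} {f : α → β → Bool} (hl : PolyTime l)
    (hf : PolyTime fun x : α × β => f x.1 x.2) : PolyTime fun a => (l a).dropWhile (f a) := by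
  have hl' := hl.polyBounded_size
  have hs : PolyTime fun x : α × List β × β =>
      cond (x.2.1.isEmpty && f x.1 x.2.2) x.2.1 (x.2.2 :: x.2.1) := by
    have : PolyTime fun x : α × List β × β => f x.1 x.2.2 :=
      hf.comp (f := fun x : α × List β × β => (x.1, x.2.2)) (by fun_prop)
    fun_prop
  -- An empty accumulator means that no element has been kept yet. As soon as one is kept, all later
  -- ones are kept as well.
  have := (foldl_of_add (s := fun a c b => cond (c.isEmpty && f a b) c (b :: c)) hl (const []) hs
    (e := fun a => size (l a)) hl' (fun a c b hb => by
      have := size_mem_lt hb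
      cases c.isEmpty && f a b <;> simp
      omega)).reverse
  refine (funext fun a => ?_ : (fun a => (l a).dropWhile (f a)) = _) ▸ this
  have h1 : ∀ (m c : List β), c ≠ [] →
      m.foldl (fun c b => cond (c.isEmpty && f a b) c (b :: c)) c = m.reverse ++ c := by
    intro m
    induction m with
    | nil => simp
    | cons b m ih =>
      intro c hc
      rw [List.foldl_cons, List.isEmpty_eq_false_iff.2 hc, Bool.false_and, cond_false, ih _ (by simp)]
      simp
  generalize l a = m
  induction m with
  | nil => rfl
  | cons b m ih =>
    cases h : f a b
    · rw [List.dropWhile_cons_of_neg (by simp [h]), List.foldl_cons, h, Bool.and_false, cond_false,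
        h1 _ _ (by simp)]
      simp
    · rw [List.dropWhile_cons_of_pos h, ih]
      simp [h]

@[fun_prop] theorem takeWhile {l : α → List β} {f : α → β → Bool} (hl : PolyTime l)
    (hf : PolyTime fun x : α × β => f x.1 x.2) : PolyTime fun a => (l a).takeWhile (f a) := by
  have hl' := hl.reverse.polyBounded_size
  have hs : PolyTime fun x : α × List β × β => cond (f x.1 x.2.2) (x.2.2 :: x.2.1) [] := by
    have : PolyTime fun x : α × List β × β => f x.1 x.2.2 :=
      hf.comp (f := fun x : α × List β × β => (x.1, x.2.2)) (by fun_prop)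
    fun_prop
  -- The list is scanned from its end, and every element that fails the test discards what has been
  -- collected; what survives is the initial segment before the first failure.
  have := (foldl_of_add (s := fun a c b => cond (f a b) (b :: c) []) hl.reverse (const []) hs
    (e := fun a => size (l a).reverse) hl' (fun a c b hb => by
      have := size_mem_lt hb
      have := size_pos c
      cases f a b <;> simp <;> omega))
  refine (funext fun a => ?_ : (fun a => (l a).takeWhile (f a)) = _) ▸ this
  generalize l a = m
  rw [List.foldl_reverse]
  induction m with
  | nil => rfl
  | cons b m ih => cases h : f a b <;> simp [h, ih]

/-! ### Natural numbers -/

theorem _root_.HiWRAC.size_bools (l : List Bool) : size l = 2 * l.length + 1 := by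
  induction l with
  | nil => rfl
  | cons b l ih => simp [ih]; ring

theorem _root_.HiWRAC.size_nat_eq (n : ℕ) : size n = 2 * n.size + 1 := by
  rw [size_nat, size_bools, Nat.size_eq_bits_len]

theorem _root_.HiWRAC.size_nat_mono {m n : ℕ} (h : m ≤ n) : size m ≤ size n := by
  have := Nat.size_le_size h
  rw [size_nat_eq, size_nat_eq]
  omega

theorem _root_.HiWRAC.size_mul_le (m n : ℕ) : size (m * n) ≤ size m + size n := by
  have : (m * n).size ≤ m.size + n.size := by
    rw [Nat.size_le, pow_add]
    exact Nat.mul_lt_mul'' (Nat.lt_size_self m) (Nat.lt_size_self n)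
  simp only [size_nat_eq]
  omega

theorem _root_.HiWRAC.size_add_le (m n : ℕ) : size (m + n) ≤ size m + size n := by
  have : (m + n).size ≤ m.size + n.size + 0 := by
    rcases Nat.eq_zero_or_pos m with rfl | hm
    · simp
    rcases Nat.eq_zero_or_pos n with rfl | hn
    · simp
    rw [Nat.size_le]
    have h1 := Nat.lt_size_self m
    have h2 := Nat.lt_size_self n
    rw [add_zero, pow_add]
    have : 2 ≤ 2 ^ m.size := le_self_pow₀ (by norm_num) (Nat.size_pos.2 hm).ne'
    have : 2 ≤ 2 ^ n.size := le_self_pow₀ (by norm_num) (Nat.size_pos.2 hn).ne'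
    nlinarith
  simp only [size_nat_eq]
  omega

theorem of_bits {f : α → ℕ} (h : PolyTime fun a => (f a).bits) : PolyTime f := h

@[fun_prop] theorem bits {f : α → ℕ} (h : PolyTime f) : PolyTime fun a => (f a).bits := h

@[fun_prop] theorem natBit {b : α → Bool} {f : α → ℕ} (hb : PolyTime b) (hf : PolyTime f) :
    PolyTime fun a => Nat.bit (b a) (f a) := by
  -- The digit lists are canonical: zero has no digits, so a digit `false` must not be added to it.
  have : PolyTime fun a => (List.casesOn (f a).bits (cond (b a) [true] [])
    fun c t => b a :: c :: t : List Bool) := by fun_prop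
  refine of_bits ((funext fun a => ?_ : (fun a => (Nat.bit (b a) (f a)).bits) = _) ▸ this)
  rcases Nat.eq_zero_or_pos (f a) with h | h
  · cases hb : b a <;> simp [h]
  · rw [Nat.bits_append_bit _ _ (by omega)]
    cases h' : (f a).bits with
    | nil =>
      have := Nat.size_pos.2 h
      simp [← Nat.size_eq_bits_len, h'] at this
    | cons c t => rfl

@[fun_prop] theorem div2 {f : α → ℕ} (hf : PolyTime f) : PolyTime fun a => (f a).div2 := by
  have : PolyTime fun a => (f a).bits.tail := by fun_prop
  refine of_bits ((funext fun a => ?_ : (fun a => (Nat.div2 (f a)).bits) = _) ▸ this)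
  rw [Nat.div2_bits_eq_tail]

@[fun_prop] theorem bodd {f : α → ℕ} (hf : PolyTime f) : PolyTime fun a => (f a).bodd := by
  have : PolyTime fun a => (f a).bits.headD false := by fun_prop
  refine (funext fun a => ?_ : (fun a => Nat.bodd (f a)) = _) ▸ this
  rw [Nat.bodd_eq_bits_head]
  cases (f a).bits <;> rfl

end PolyTime

end HiWRAC

namespace HiWRAC

variable {α β γ δ σ : Type} [Enc α] [Enc β] [Enc γ] [Enc δ] [Enc σ]

/-! ### Arithmetic in binary -/

theorem size_div2_le (n : ℕ) : size n.div2 ≤ size n := by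
  rw [Nat.div2_val]
  exact size_nat_mono (Nat.div_le_self n 2)

/-- The arguments of a digit-wise operation, a carry bit, and the digits computed so far. -/
abbrev DigitState := ℕ × ℕ × Bool × List Bool

/-- One digit of a binary operation: `f` is the new carry, the new digit is the parity. -/
def digitStep (f : Bool → Bool → Bool → Bool) (s : DigitState) : DigitState :=
  (s.1.div2, s.2.1.div2, f s.1.bodd s.2.1.bodd s.2.2.1,
    (xor (xor s.1.bodd s.2.1.bodd) s.2.2.1) :: s.2.2.2)

/-- Handle all digits. -/
def digits (f : Bool → Bool → Bool → Bool) (x y : ℕ) : DigitState :=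
  (x.bits ++ y.bits).foldl (fun s _ => digitStep f s) (x, y, false, [])

/-- The number with the given digits, the most significant first, and the leading part `c`. -/
def ofDigits (l : List Bool) (c : ℕ) : ℕ := l.foldl (fun n b => Nat.bit b n) c

theorem div2_iterate_eq_zero {x k : ℕ} (h : x.size ≤ k) : Nat.div2^[k] x = 0 := by
  have : ∀ k x, Nat.div2^[k] x = x / 2 ^ k := by
    intro k
    induction k with
    | zero => simp
    | succ k ih => intro x; rw [Function.iterate_succ_apply, ih, Nat.div2_val, Nat.div_div_eq_div_mul, pow_succ']
  rw [this, Nat.div_eq_of_lt]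
  exact (Nat.lt_size_self x).trans_le (Nat.pow_le_pow_right (by norm_num) h)

theorem foldl_digitStep (f : Bool → Bool → Bool → Bool) (l : List Bool) (s : DigitState) :
    (l.foldl (fun s _ => digitStep f s) s).1 = Nat.div2^[l.length] s.1 ∧
      (l.foldl (fun s _ => digitStep f s) s).2.1 = Nat.div2^[l.length] s.2.1 := by
  induction l generalizing s with
  | nil => simp
  | cons b l ih =>
    obtain ⟨h1, h2⟩ := ih (digitStep f s)
    exact ⟨h1, h2⟩

/-- One step is made for every digit of `x` and every digit of `y`, which is more than enough to use
up both numbers. -/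
theorem digits_zero (f : Bool → Bool → Bool → Bool) (x y : ℕ) :
    (digits f x y).1 = 0 ∧ (digits f x y).2.1 = 0 := by
  obtain ⟨h1, h2⟩ := foldl_digitStep f (x.bits ++ y.bits) (x, y, false, [])
  have e : (x.bits ++ y.bits).length = x.size + y.size := by simp [Nat.size_eq_bits_len]
  rw [digits, h1, h2, e]
  exact ⟨div2_iterate_eq_zero (by simp), div2_iterate_eq_zero (by simp)⟩

/-- A property of the state that every step preserves holds at the end. -/
theorem digits_induction {f : Bool → Bool → Bool → Bool} {x y : ℕ} (P : DigitState → Prop)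
    (h : P (x, y, false, [])) (hs : ∀ s, P s → P (digitStep f s)) : P (digits f x y) := by
  unfold digits
  generalize (x, y, false, []) = s at h
  generalize x.bits ++ y.bits = l
  induction l generalizing s with
  | nil => exact h
  | cons b l ih => exact ih _ (hs _ h)

/-- The carry of an addition. -/
def carry (a b c : Bool) : Bool := cond a (b || c) (b && c)

/-- The borrow of a subtraction, and of a comparison. -/
def borrow (a b c : Bool) : Bool := cond a (b && c) (b || c)

/-- Invariant: the digits found so far, below the sum of the remaining parts and the carry,
represent `x + y`. At the end only the carry is left above the digits. -/
theorem digits_carry (x y : ℕ) :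
    ofDigits (digits carry x y).2.2.2 (digits carry x y).2.2.1.toNat = x + y := by
  have := digits_induction (f := carry) (x := x) (y := y)
    (fun s => ofDigits s.2.2.2 (s.1 + s.2.1 + s.2.2.1.toNat) = x + y) (by simp [ofDigits]) (by
    rintro ⟨u, v, c, l⟩ h
    rw [← h]
    simp only [ofDigits, digitStep, List.foldl_cons]
    congr 1
    conv_rhs => rw [← Nat.bit_bodd_div2 u, ← Nat.bit_bodd_div2 v]
    cases u.bodd <;> cases v.bodd <;> cases c <;> simp [Nat.bit_val, carry] <;> ring)
  obtain ⟨h1, h2⟩ := digits_zero carry x y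
  rw [h1, h2] at this
  simpa using this

/-- Invariant: comparing the remaining parts, with the borrow added to the second one, is equivalent
to comparing `x` and `y`. At the end both parts are zero and the borrow decides. -/
theorem digits_borrow_lt (x y : ℕ) : (digits borrow x y).2.2.1 = decide (x < y) := by
  have := digits_induction (f := borrow) (x := x) (y := y)
    (fun s => s.1 < s.2.1 + s.2.2.1.toNat ↔ x < y) (by simp) (by
    rintro ⟨u, v, c, l⟩ h
    rw [← h]
    simp only [digitStep]
    conv_rhs => rw [← Nat.bit_bodd_div2 u, ← Nat.bit_bodd_div2 v]
    cases u.bodd <;> cases v.bodd <;> cases c <;> simp [Nat.bit_val, borrow] <;> omega)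
  obtain ⟨h1, h2⟩ := digits_zero borrow x y
  rw [h1, h2] at this
  rw [Bool.eq_iff_iff, decide_eq_true_iff, ← this]
  cases (digits borrow x y).2.2.1 <;> simp

/-- As for addition, with the remaining difference as leading part. The invariant also records that
this difference does not become negative, so the truncated subtraction is exact. -/
theorem digits_borrow_sub {x y : ℕ} (h : y ≤ x) : ofDigits (digits borrow x y).2.2.2 0 = x - y := by
  have := digits_induction (f := borrow) (x := x) (y := y)
    (fun s => s.2.1 + s.2.2.1.toNat ≤ s.1 ∧
      ofDigits s.2.2.2 (s.1 - (s.2.1 + s.2.2.1.toNat)) = x - y) (by simp [ofDigits, h]) (by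
    rintro ⟨u, v, c, l⟩ ⟨h', h⟩
    rw [← h]
    simp only [ofDigits, digitStep, List.foldl_cons] at h' ⊢
    have hu := Nat.bit_bodd_div2 u
    have hv := Nat.bit_bodd_div2 v
    generalize u.div2 = u', v.div2 = v', u.bodd = p, v.bodd = q at hu hv ⊢
    subst hu hv
    constructor
    · cases p <;> cases q <;> cases c <;> simp [Nat.bit_val, borrow] at h' ⊢ <;> omega
    · congr 1
      cases p <;> cases q <;> cases c <;> simp [Nat.bit_val, borrow] at h' ⊢ <;> omega)
  obtain ⟨h1, h2⟩ := digits_zero borrow x y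
  rw [h1, h2] at this
  have h3 := this.1
  simp only [zero_add, nonpos_iff_eq_zero] at h3
  simpa [h3] using this.2

namespace PolyTime

@[fun_prop] theorem xor {f g : α → Bool} (hf : PolyTime f) (hg : PolyTime g) :
    PolyTime fun a => Bool.xor (f a) (g a) := by
  have : PolyTime fun a => cond (f a) (!g a) (g a) := by fun_prop
  refine (funext fun a => ?_ : (fun a => Bool.xor (f a) (g a)) = _) ▸ this
  cases f a <;> simp

theorem digits {c : Bool → Bool → Bool → Bool}
    (hc : PolyTime fun x : Bool × Bool × Bool => c x.1 x.2.1 x.2.2) {f g : α → ℕ} (hf : PolyTime f)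
    (hg : PolyTime g) : PolyTime fun a => digits c (f a) (g a) := by
  have hs : PolyTime fun x : α × DigitState × Bool => digitStep c x.2.1 := by
    have : PolyTime fun x : α × DigitState × Bool =>
      c x.2.1.1.bodd x.2.1.2.1.bodd x.2.1.2.2.1 :=
      hc.comp (f := fun x : α × DigitState × Bool =>
        (x.2.1.1.bodd, x.2.1.2.1.bodd, x.2.1.2.2.1)) (by fun_prop)
    unfold digitStep
    fun_prop
  refine foldl_of_add (s := fun _ s _ => digitStep c s) (by fun_prop) (by fun_prop) hs
    (e := fun _ => 2) (by fun_prop) ?_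
  rintro _ ⟨x, y, z, l⟩ _ _
  have := size_div2_le x
  have := size_div2_le y
  simp [digitStep]
  omega

theorem ofDigits {l : α → List Bool} {f : α → ℕ} (hl : PolyTime l) (hf : PolyTime f) :
    PolyTime fun a => ofDigits (l a) (f a) := by
  refine foldl_of_add (s := fun _ n b => Nat.bit b n) hl hf (by fun_prop) (e := fun _ => 4)
    (by fun_prop) ?_
  intro _ n b _
  have : Nat.bit b n ≤ n * 2 + 1 := by rw [Nat.bit_val]; cases b <;> simp <;> omega
  have h1 := size_nat_mono this
  have h2 := size_add_le (n * 2) 1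
  have h3 := size_mul_le n 2
  have h4 : size 1 = 3 := rfl
  have h5 : size 2 = 5 := rfl
  have h6 : Nat.size (Nat.bit b n) ≤ Nat.size n + 1 := by
    by_cases h : Nat.bit b n = 0
    · simp [h]
    · rw [Nat.size_bit h]
  rw [size_nat_eq, size_nat_eq]
  omega

@[fun_prop] theorem natAdd {f g : α → ℕ} (hf : PolyTime f) (hg : PolyTime g) :
    PolyTime fun a => f a + g a := by
  have h := digits (c := carry) (by unfold carry; fun_prop) hf hg
  have := ofDigits (l := fun a => (HiWRAC.digits carry (f a) (g a)).2.2.2)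
    (f := fun a => cond (HiWRAC.digits carry (f a) (g a)).2.2.1 1 0) (by fun_prop) (by fun_prop)
  refine (funext fun a => ?_ : (fun a => f a + g a) = _) ▸ this
  rw [← digits_carry]
  rfl

@[fun_prop] theorem decideLt {f g : α → ℕ} (hf : PolyTime f) (hg : PolyTime g) :
    PolyTime fun a => decide (f a < g a) := by
  have h := digits (c := borrow) (by unfold borrow; fun_prop) hf hg
  have : PolyTime fun a => (HiWRAC.digits borrow (f a) (g a)).2.2.1 := by fun_prop
  exact (funext fun a => (digits_borrow_lt _ _).symm : (fun a => decide (f a < g a)) = _) ▸ this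

@[fun_prop] theorem decideLe {f g : α → ℕ} (hf : PolyTime f) (hg : PolyTime g) :
    PolyTime fun a => decide (f a ≤ g a) := by
  have : PolyTime fun a => !decide (g a < f a) := by fun_prop
  refine (funext fun a => ?_ : (fun a => decide (f a ≤ g a)) = _) ▸ this
  rw [← decide_not]
  simp

@[fun_prop] theorem natBeq {f g : α → ℕ} (hf : PolyTime f) (hg : PolyTime g) :
    PolyTime fun a => f a == g a := by
  have : PolyTime fun a => decide (f a ≤ g a) && decide (g a ≤ f a) := by fun_prop
  refine (funext fun a => ?_ : (fun a => f a == g a) = _) ▸ this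
  rw [Bool.eq_iff_iff]
  simp
  omega

@[fun_prop] theorem natBne {f g : α → ℕ} (hf : PolyTime f) (hg : PolyTime g) :
    PolyTime fun a => f a != g a := by
  have : PolyTime fun a => !(f a == g a) := by fun_prop
  exact this

@[fun_prop] theorem natSub {f g : α → ℕ} (hf : PolyTime f) (hg : PolyTime g) :
    PolyTime fun a => f a - g a := by
  have h := digits (c := borrow) (by unfold borrow; fun_prop) hf hg
  have h' := ofDigits (l := fun a => (HiWRAC.digits borrow (f a) (g a)).2.2.2)
    (f := fun _ => 0) (by fun_prop) (by fun_prop)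
  have : PolyTime fun a => cond (decide (f a < g a)) 0
    (HiWRAC.ofDigits (HiWRAC.digits borrow (f a) (g a)).2.2.2 0) := by fun_prop
  refine (funext fun a => ?_ : (fun a => f a - g a) = _) ▸ this
  by_cases h : f a < g a
  · simp [h]; omega
  · simp [h, digits_borrow_sub (not_lt.1 h)]

@[fun_prop] theorem natMax {f g : α → ℕ} (hf : PolyTime f) (hg : PolyTime g) :
    PolyTime fun a => max (f a) (g a) := by
  have : PolyTime fun a => f a + (g a - f a) := by fun_prop
  refine (funext fun a => ?_ : (fun a => max (f a) (g a)) = _) ▸ this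
  omega

-- Horner's scheme over the digits of the second factor, the most significant first: double, then
-- add the first factor or zero. Doubling costs one more binary digit, so the growth is additive in
-- size.
@[fun_prop] theorem natMul {f g : α → ℕ} (hf : PolyTime f) (hg : PolyTime g) :
    PolyTime fun a => f a * g a := by
  have hf' := hf.polyBounded_size
  have hs : PolyTime fun x : α × ℕ × Bool => x.2.1 + x.2.1 + cond x.2.2 (f x.1) 0 := by fun_prop
  have := foldl_of_add (s := fun a c b => c + c + cond b (f a) 0) hg.bits.reverse (const 0) hs
    (e := fun a => size (f a) + 2) (by fun_prop) (fun a c b _ => by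
      have h1 := size_add_le (c * 2) (cond b (f a) 0)
      have h2 : size (cond b (f a) 0) ≤ size (f a) := size_nat_mono (by cases b <;> simp)
      have h3 : size (c * 2) ≤ size c + 2 := by
        have : (c * 2).size ≤ c.size + 1 := by
          rw [Nat.size_le, pow_succ]
          have := Nat.lt_size_self c
          omega
        rw [size_nat_eq, size_nat_eq]
        omega
      rw [← mul_two]
      omega)
  refine (funext fun a => ?_ : (fun a => f a * g a) = _) ▸ this
  rw [List.foldl_reverse]
  induction g a using Nat.binaryRec' with
  | zero => simp
  | bit b n h ih =>
    rw [Nat.bits_append_bit _ _ h, List.foldr_cons, ← ih, Nat.bit_val]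
    cases b <;> simp <;> ring

/-! ### Indexing -/

/-- The list serves as fuel: a number in binary may be far too large to count down, but no more than
the length of the list can be removed. -/
theorem foldl_drop {β γ : Type} (l : List β) (m : List γ) (n : ℕ) :
    (l.foldl (fun s _ => cond (s.1 == 0) s (s.1 - 1, s.2.tail)) (n, m)).2 =
      m.drop (min n l.length) := by
  induction l generalizing n m with
  | nil => simp
  | cons b l ih =>
    rw [List.foldl_cons]
    cases n with
    | zero => exact (ih m 0).trans (by simp)
    | succ n =>
      simp only [Nat.add_one_sub_one, List.length_cons, Nat.add_min_add_right]
      exact (ih _ _).trans (by rw [List.drop_tail])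

@[fun_prop] theorem drop {f : α → ℕ} {l : α → List β} (hf : PolyTime f) (hl : PolyTime l) :
    PolyTime fun a => (l a).drop (f a) := by
  have := (foldl_of_add (l := l) (i := fun a => (f a, l a))
    (s := fun _ s _ => cond (s.1 == 0) s (s.1 - 1, s.2.tail)) hl (by fun_prop) (by fun_prop)
    (e := fun _ => 0) (by fun_prop) (by
      rintro _ ⟨n, m⟩ _ _
      have h1 := size_nat_mono (Nat.sub_le n 1)
      have h2 := size_tail_le m
      cases n == 0 <;> simp
      omega)).snd
  refine (funext fun a => ?_ : (fun a => (l a).drop (f a)) = _) ▸ this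
  rw [foldl_drop]
  rcases le_total (f a) (l a).length with h | h
  · rw [min_eq_left h]
  · rw [min_eq_right h, List.drop_eq_nil_of_le h, List.drop_length]

@[fun_prop] theorem getD {f : α → ℕ} {l : α → List β} {d : α → β} (hl : PolyTime l)
    (hf : PolyTime f) (hd : PolyTime d) : PolyTime fun a => (l a).getD (f a) (d a) := by
  have : PolyTime fun a => ((l a).drop (f a)).headD (d a) := by fun_prop
  refine (funext fun a => ?_ : (fun a => (l a).getD (f a) (d a)) = _) ▸ this
  rw [List.headD_eq_head?_getD, List.head?_drop, List.getD_eq_getElem?_getD]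

@[fun_prop] theorem length {l : α → List β} (hl : PolyTime l) : PolyTime fun a => (l a).length := by
  have := foldl_of_add (s := fun _ c _ => c + 1) hl (const 0) (by fun_prop)
    (e := fun _ => 3) (by fun_prop) (fun a c b _ => size_add_le c 1)
  refine (funext fun a => ?_ : (fun a => (l a).length) = _) ▸ this
  have : ∀ (m : List β) (c : ℕ), m.foldl (fun c _ => c + 1) c = c + m.length := by
    intro m
    induction m with
    | nil => simp
    | cons b m ih => intro c; simp [ih]; omega
  simp [this]

@[fun_prop] theorem take {f : α → ℕ} {l : α → List β} (hf : PolyTime f) (hl : PolyTime l) :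
    PolyTime fun a => (l a).take (f a) := by
  have hlen := length hl
  have : PolyTime fun a => ((l a).reverse.drop ((l a).length - f a)).reverse := by fun_prop
  refine (funext fun a => ?_ : (fun a => (l a).take (f a)) = _) ▸ this
  rw [List.drop_reverse, List.reverse_reverse]
  rcases le_total (f a) (l a).length with h | h
  · congr 1; omega
  · rw [List.take_of_length_le h, List.take_of_length_le (by omega)]

/-- The numbers below the length of a list. -/
@[fun_prop] theorem rangeLength {l : α → List β} (hl : PolyTime l) :
    PolyTime fun a => List.range (l a).length := by
  have key : ∀ m : List β, m.foldl (fun c _ => c ++ [c.length]) [] = List.range m.length := by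
    intro m
    induction m using List.reverseRecOn with
    | nil => rfl
    | append_singleton m b ih => simp [ih, List.range_succ]
  have hsz : ∀ m : ℕ, size (List.range m) ≤ m * (2 * m + 2) + 1 := by
    intro m
    induction m with
    | zero => simp
    | succ m ih =>
      have h1 := size_append (List.range m) [m]
      have h2 : m.size ≤ m := by rw [Nat.size_le]; exact Nat.lt_two_pow_self
      rw [List.range_succ]
      simp only [size_cons, size_nil, size_nat_eq] at h1
      nlinarith
  have hl' := hl.polyBounded_size
  -- Here the additive criterion does not apply, since the new element depends on the accumulator;
  -- the accumulators are instead identified as initial ranges of quadratically bounded size.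
  have := foldl_of_bound (s := fun _ c _ => c ++ [c.length]) hl (const ([] : List ℕ)) (by fun_prop)
    (B := fun a => size (l a) * (2 * size (l a) + 2) + 1) (by fun_prop) (fun a l' h => by
      have h1 : l'.length ≤ size (l a) := h.length_le.trans (length_lt_size (l a)).le
      simp only [key]
      refine (hsz _).trans ?_
      gcongr)
  exact (funext fun a => (key _).symm : (fun a => List.range (l a).length) = _) ▸ this

@[fun_prop] theorem listSum {l : α → List ℕ} (hl : PolyTime l) : PolyTime fun a => (l a).sum := by
  have hl' := hl.polyBounded_size
  have := foldl_of_add (s := fun _ c b => c + b) hl (const 0) (by fun_prop)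
    (e := fun a => size (l a)) (by fun_prop) (fun a c b h => by
      have := size_mem_lt h
      exact (size_add_le c b).trans (by omega))
  refine (funext fun a => ?_ : (fun a => (l a).sum) = _) ▸ this
  rw [List.sum_eq_foldl]

@[fun_prop] theorem listProd {l : α → List ℕ} (hl : PolyTime l) : PolyTime fun a => (l a).prod := by
  have hl' := hl.polyBounded_size
  have := foldl_of_add (s := fun _ c b => c * b) hl (const 1) (by fun_prop)
    (e := fun a => size (l a)) (by fun_prop) (fun a c b h => by
      have := size_mem_lt h
      exact (size_mul_le c b).trans (by omega))
  refine (funext fun a => ?_ : (fun a => (l a).prod) = _) ▸ this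
  rw [List.prod_eq_foldl]

end PolyTime

end HiWRAC

namespace HiWRAC

/-! ### Input and output -/

instance {α : Type} [Enc α] : Enc (Option α) := ⟨fun o => Enc.tree o.toList⟩

namespace Prog

/-- Encode the word on stack `2`. -/
def read : Prog :=
  .seq (pour 2 1) (.seq (.push 0 fun _ => some false) (.seq (.pop 1) (.loop Option.isSome
    (.seq (.push 0 fun _ => some false) (.seq (.ite isNode (.push 0 fun _ => none)
      (.seq (.push 0 fun v => v.getD none) (.seq (.push 0 fun _ => none) (.push 0 fun _ => none))))
      (.pop 1))))))

/-- A list is encoded from its end, so the input is first reversed onto stack `1`. The letter `none`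
is the empty list and becomes one leaf; a letter `some b` is a one-element list and becomes a node
over two leaves. -/
theorem run_read (w : List Sym) : Run read ![[], [], w, []] (10 * w.length + 10) (stk (word w)) := by
  have key : ∀ l w : List Sym, ∃ m ≤ 7 * l.length + 1, Exec (.loop Option.isSome
    (.seq (.push 0 fun _ => some false) (.seq (.ite isNode (.push 0 fun _ => none)
      (.seq (.push 0 fun v => v.getD none) (.seq (.push 0 fun _ => none) (.push 0 fun _ => none))))
      (.pop 1)))) l.head? ![word w, l.tail, [], []] m none (stk (word (l.reverse ++ w))) := by
    intro l
    induction l with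
    | nil => intro w; exact ⟨1, le_rfl, .loop_false rfl⟩
    | cons s l ih =>
      intro w
      obtain ⟨m, hm, e⟩ := ih (s :: w)
      have e1 : Exec (.push 0 fun _ => some false) (some s) ![word w, l, [], []] 1 (some s)
        ![some false :: word w, l, [], []] := .push_eq (upd0 ..)
      have e3 : Exec (.pop 1) (some s) ![word (s :: w), l, [], []] 1 l.head?
        ![word (s :: w), l.tail, [], []] := .pop_eq rfl (upd1 ..)
      have hw : (s :: l).reverse ++ w = l.reverse ++ s :: w := by simp
      rw [hw]
      cases s with
      | none =>
        have e2 : Exec (.push 0 fun _ => none) (some none) ![some false :: word w, l, [], []] 1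
          (some none) ![none :: some false :: word w, l, [], []] := .push_eq (upd0 ..)
        refine ⟨_, ?_, .loop_true (c := Option.isSome) rfl (e1.seq ((e2.ite_true (c := isNode) rfl).seq e3)) e⟩
        simp only [List.length_cons]; omega
      | some b =>
        have e2 : Exec (.push 0 fun v => v.getD none) (some (some b))
          ![some false :: word w, l, [], []] 1 (some (some b))
          ![some b :: some false :: word w, l, [], []] := .push_eq (upd0 ..)
        have e4 : Exec (.push 0 fun _ => none) (some (some b))
          ![some b :: some false :: word w, l, [], []] 1 (some (some b))
          ![none :: some b :: some false :: word w, l, [], []] := .push_eq (upd0 ..)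
        have e5 : Exec (.push 0 fun _ => none) (some (some b))
          ![none :: some b :: some false :: word w, l, [], []] 1 (some (some b))
          ![none :: none :: some b :: some false :: word w, l, [], []] := .push_eq (upd0 ..)
        refine ⟨_, ?_, .loop_true (c := Option.isSome) rfl
          (e1.seq (((e2.seq (e4.seq e5)).ite_false (c := isNode) rfl).seq e3)) e⟩
        simp only [List.length_cons]; omega
  have h1 := (runTo_pour (i := 2) (j := 1) (by decide) ![[], [], w, []]).run
  rw [upd2, upd1] at h1
  have h2 := run_push 0 (some false) ![[], w.reverse, [], []]
  rw [upd0] at h2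
  have h3 : RunTo (.pop 1) ![[some false], w.reverse, [], []] 1 w.reverse.head?
    ![word ([] : List Sym), w.reverse.tail, [], []] := fun v => ⟨1, le_rfl, .pop_eq rfl (upd1 ..)⟩
  obtain ⟨m, hm, e⟩ := key w.reverse []
  refine ((h1.cast rfl le_rfl (by simp)).seq (h2.seq (h3.seq_exec ⟨none, m, hm, e⟩))).cast rfl ?_
    (by simp)
  simp
  omega

/-- Decode a word, on stack `0`. -/
def write : Prog :=
  .seq (.seq (.pop 0) (.loop isNode (.seq (.seq (.pop 0) (.ite isNode
    (.seq (.pop 0) (.seq (.push 1 fun v => v.getD none) (.pop 0)))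
    (.push 1 fun _ => none))) (.pop 0)))) (pour 1 0)

/-- The loop reads one list cell per round and stops at the leaf that ends the list, which leaves
stack `0` empty. The letters arrive on stack `1` in reverse order, and the final `pour` corrects
this and leaves `none` in the register. -/
theorem runTo_write (w : List Sym) : RunTo write (stk (word w)) (10 * w.length + 10) none (stk w) := by
  have key : ∀ (w x : List Sym) (h : Sym) (r : List Sym), word w = h :: r →
    ∃ v, ∃ m ≤ 7 * w.length + 1, Exec (.loop isNode (.seq (.seq (.pop 0) (.ite isNode
    (.seq (.pop 0) (.seq (.push 1 fun v => v.getD none) (.pop 0)))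
    (.push 1 fun _ => none))) (.pop 0))) (some h) ![r, x, [], []] m v
      ![[], w.reverse ++ x, [], []] := by
    intro w
    induction w with
    | nil =>
      intro x h r hw
      obtain ⟨rfl, rfl⟩ := List.cons_eq_cons.1 (hw : [some false] = h :: r)
      exact ⟨_, 1, le_rfl, .loop_false rfl⟩
    | cons s w ih =>
      intro x h r hw
      obtain ⟨rfl, rfl⟩ := List.cons_eq_cons.1 (hw : none :: (word s ++ word w) = h :: r)
      have hc : ∃ h' r', word w = h' :: r' :=
        List.exists_cons_of_length_pos (size_pos w)
      obtain ⟨h', r', hw'⟩ := hc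
      obtain ⟨v, m, hm, e⟩ := ih (s :: x) h' r' hw'
      have e0 : ∀ v, Exec (.pop 0) v ![word w, s :: x, [], []] 1 (some h') ![r', s :: x, [], []] :=
        fun v => .pop_eq (by simp [hw']) (by rw [upd0]; simp [hw'])
      have hr : (s :: w).reverse ++ x = w.reverse ++ s :: x := by simp
      rw [hr]
      cases s with
      | none =>
        have e1 : Exec (.pop 0) (some none) ![some false :: word w, x, [], []] 1 (some (some false))
          ![word w, x, [], []] := .pop_eq rfl (upd0 ..)
        have e2 : Exec (.push 1 fun _ => none) (some (some false)) ![word w, x, [], []] 1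
          (some (some false)) ![word w, none :: x, [], []] := .push_eq (upd1 ..)
        refine ⟨v, _, ?_, .loop_true (c := isNode) rfl
          ((e1.seq (e2.ite_false (c := isNode) rfl)).seq (e0 _)) e⟩
        simp only [List.length_cons]; omega
      | some b =>
        have e1 : Exec (.pop 0) (some none) ![none :: some b :: some false :: word w, x, [], []] 1
          (some none) ![some b :: some false :: word w, x, [], []] := .pop_eq rfl (upd0 ..)
        have e2 : Exec (.pop 0) (some none) ![some b :: some false :: word w, x, [], []] 1
          (some (some b)) ![some false :: word w, x, [], []] := .pop_eq rfl (upd0 ..)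
        have e3 : Exec (.push 1 fun v => v.getD none) (some (some b))
          ![some false :: word w, x, [], []] 1
          (some (some b)) ![some false :: word w, some b :: x, [], []] := .push_eq (upd1 ..)
        have e4 : Exec (.pop 0) (some (some b)) ![some false :: word w, some b :: x, [], []] 1
          (some (some false)) ![word w, some b :: x, [], []] := .pop_eq rfl (upd0 ..)
        refine ⟨v, _, ?_, .loop_true (c := isNode) rfl
          ((e1.seq ((e2.seq (e3.seq e4)).ite_true (c := isNode) rfl)).seq (e0 _)) e⟩
        simp only [List.length_cons]; omega
  obtain ⟨h, r, hw⟩ : ∃ h r, word w = h :: r := List.exists_cons_of_length_pos (size_pos w)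
  have h1 : RunTo (.pop 0) (stk (word w)) 1 (some h) ![r, [], [], []] := by
    rw [hw]; exact runTo_popHead h r
  have h2 := runTo_pour (i := 1) (j := 0) (by decide) ![[], w.reverse, [], []]
  rw [upd1, upd0] at h2
  have h3 := (h1.seq_exec (key w [] h r hw)).seqTo (S'' := stk w) (v := none)
    (m := 3 * w.length + 2) (by simpa using h2)
  exact h3.mono (by omega)

end Prog

/-- The encoding of a type by words. -/
@[reducible] def encOfWords {ι : Type} (e : ι → List Sym) : Enc ι := ⟨fun i => Enc.tree (e i)⟩

open Prog in
/-- A polynomial time function on encoded words is computed by a Turing machine. -/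
theorem computable_of_polyTime {ι ο : Type} (ei : ι → List Sym) (eo : ο → List Sym) (f : ι → ο)
    (h : @PolyTime ι (List Sym) (encOfWords ei) _ fun i => eo (f i)) :
    Nonempty (TM2ComputableInPolyTime ei eo f) := by
  let _ := encOfWords ei
  have hb := h.polyBounded_size
  obtain ⟨p, T, ⟨q, hq⟩, hp⟩ := h
  obtain ⟨b, hb⟩ := hb
  -- Each letter contributes a list node and a tree of at most three letters; the empty list at the
  -- end is one more.
  have hsz : ∀ i, size i ≤ 4 * (ei i).length + 1 := by
    intro i
    change size (ei i) ≤ _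
    induction ei i with
    | nil => simp
    | cons s l ih =>
      have : size s ≤ 3 := by
        cases s with
        | none => exact (by decide : 1 ≤ 3)
        | some b => exact le_rfl
      simp only [size_cons, List.length_cons]
      omega
  let t : Polynomial ℕ := (10 * .X + 10) + ((q.comp (4 * .X + 1)) +
    (10 * (b.comp (4 * .X + 1)) + 10)) + 1
  have ht : ∀ i, ∃ n, n + 1 ≤ t.eval (ei i).length ∧ Exec (.seq read (.seq p write)) none
      ![[], [], (ei i).map id, []] n none ![(eo (f i)).map id, [], [], []] := by
    intro i
    have hp' := hp i []
    simp only [List.append_nil] at hp'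
    obtain ⟨n, hn, e⟩ := ((run_read (ei i)).seqTo (hp'.seqTo (runTo_write _))) none
    refine ⟨n, ?_, by simpa using e⟩
    have h1 := (hq i).trans (eval_mono q (hsz i))
    have h2 := ((length_lt_size (eo (f i))).le.trans (hb i)).trans (eval_mono b (hsz i))
    simp [t]
    omega
  choose n hn e using ht
  exact ⟨{
    tm := (Prog.seq read (.seq p write)).machine
    inputAlphabet := Equiv.refl _
    outputAlphabet := Equiv.refl _
    time := t
    outputsFun := fun i => by
      have := (machine_outputs (e i)).some
      exact ⟨⟨this.steps, this.evals_in_steps⟩, this.steps_le_m.trans (hn i)⟩ }⟩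

end HiWRAC

namespace HiWRAC

variable {α β γ δ σ : Type} [Enc α] [Enc β] [Enc γ] [Enc δ] [Enc σ]

/-! ### The algorithm -/

/-- The data of a vertex: width and height as pairs of numerator and denominator, and the clockwise
list of neighbours, marked if the edge is outgoing. -/
abbrev Vertex := ((ℕ × ℕ) × ℕ × ℕ) × List (ℕ × Bool)

/-- The data of all vertices. -/
abbrev Net := List Vertex

/-- The list of iterates of `f` from `i`, in reverse order, as many as `l` has elements and one. -/
def iterates {β γ : Type} (f : β → β) (i : β) (l : List γ) : List β :=
  l.foldl (fun p _ => f (p.headD i) :: p) [i]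

/-- The data of a vertex. -/
def vertex (V : Net) (v : ℕ) : Vertex := V.getD v (((0, 0), 0, 0), [])

/-- The neighbours of a vertex. -/
def ids (V : Net) (v : ℕ) : List ℕ := (vertex V v).2.map fun q => q.1

/-- Is there an arc? -/
def hasArc (V : Net) (u v : ℕ) : Bool := (vertex V u).2.any fun q => q.1 == v && q.2

/-- The first out-neighbour of a vertex, or itself if there is none. -/
def up (V : Net) (v : ℕ) : ℕ := (((vertex V v).2.filter fun q => q.2).map fun q => q.1).headD v

/-- The product of the two denominators at a vertex. -/
def dens (V : Net) (v : ℕ) : ℕ := (vertex V v).1.1.2 * (vertex V v).1.2.2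

/-- The common denominator. -/
def den (V : Net) : ℕ := ((List.range V.length).map fun v => dens V v).prod

/-- The product of the denominators at the other vertices. -/
def coden (V : Net) (v : ℕ) : ℕ :=
  ((List.range V.length).map fun j => bif j == v then 1 else dens V j).prod

/-- The width of a box in units of `1 / (n * den V)`, for `n` vertices. -/
def wid (V : Net) (v : ℕ) : ℕ := V.length * ((vertex V v).1.1.1 * (vertex V v).1.2.2 * coden V v)

/-- The height of a box in units of `1 / den V`. -/
def hgt (V : Net) (v : ℕ) : ℕ := (vertex V v).1.2.1 * (vertex V v).1.1.2 * coden V v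

/-- The path of first out-neighbours. -/
def path (V : Net) (v : ℕ) : List ℕ := iterates (up V) v V

/-- How far the bottom side of a box is below that of the sink. -/
def depth (V : Net) (v : ℕ) : ℕ :=
  ((path V v).map fun c => bif up V c == c then 0 else hgt V c).sum

/-- Rotate a list so that it starts with `s`. -/
def rotTo (s : ℕ) (l : List ℕ) : List ℕ := l.dropWhile (fun x => x != s) ++ l.takeWhile (fun x => x != s)

/-- Does `x` precede `y` in the list? -/
def prec (l : List ℕ) (x y : ℕ) : Bool := (l.dropWhile fun z => z != x).tail.any fun z => z == y

/-- The clockwise list of neighbours, starting at an out-neighbour, or with `g` at the sink. -/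
def order (V : Net) (g c : ℕ) : List ℕ := rotTo (bif up V c == c then g else up V c) (ids V c)

/-- Is `a` to the left of `b`? -/
def leftOf (V : Net) (g a b : ℕ) : Bool :=
  (path V a).any fun a' => (path V b).any fun b' =>
    up V a' == up V b' && prec (order V g (up V a')) b' a'

/-- Do the closed vertical extents of two boxes intersect? -/
def closedMeet (V : Net) (u v : ℕ) : Bool :=
  decide (depth V v ≤ depth V u + hgt V v) && decide (depth V u ≤ depth V v + hgt V u)

/-- Do the open vertical extents of two boxes intersect? -/
def openMeet (V : Net) (u v : ℕ) : Bool :=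
  decide (depth V v < depth V u + hgt V v) && decide (depth V u < depth V v + hgt V u)

/-- Are two vertices adjacent? -/
def adjacent (V : Net) (u v : ℕ) : Bool := hasArc V u v || hasArc V v u

/-- The constraint on the abscissae of `u` and `v`, if any: `(p, q)` means
`x u + p ≤ x v + q`. -/
def bound (V : Net) (g u v : ℕ) : List (ℕ × ℕ) :=
  bif u == v then [] else
  bif adjacent V u v then [(1, wid V v)] else
  bif leftOf V g u v && closedMeet V u v then
    [(wid V u + bif openMeet V u v then 1 else 0, 0)] else []

/-- One round of relaxations. -/
def relax (V : Net) (g : ℕ) (d : List ℕ) : List ℕ :=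
  (List.range V.length).map fun v =>
    ((List.range V.length).flatMap fun u =>
      (bound V g u v).map fun c => d.getD u 0 + c.1 - c.2).foldl max (d.getD v 0)

/-- The least nonnegative solution of the constraints, if there is one. -/
def dist (V : Net) (g : ℕ) : List ℕ := V.foldl (fun d _ => relax V g d) (V.map fun _ => 0)

/-- The pair of boxes `u`, `v` is placed correctly. -/
def checkPair (V : Net) (x : List ℕ) (u v : ℕ) : Bool :=
  bif hasArc V u v then depth V u == depth V v + hgt V u &&
    decide (x.getD u 0 < x.getD v 0 + wid V v) && decide (x.getD v 0 < x.getD u 0 + wid V u)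
  else hasArc V v u || u == v ||
    (!(closedMeet V u v && decide (x.getD u 0 < x.getD v 0 + wid V v) &&
      decide (x.getD v 0 < x.getD u 0 + wid V u)) &&
    !(openMeet V u v && decide (x.getD u 0 ≤ x.getD v 0 + wid V v) &&
      decide (x.getD v 0 ≤ x.getD u 0 + wid V u)))

/-- In the clockwise list of contacts of `v`, `a` may precede `b`. -/
def mayPrecede (V : Net) (x : List ℕ) (v a b : ℕ) : Bool :=
  bif hasArc V v a then !hasArc V v b || decide (x.getD a 0 < x.getD b 0)
  else !hasArc V v b && decide (x.getD b 0 < x.getD a 0)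

/-- The contacts of `v` are met in the right order. -/
def checkRot (V : Net) (x : List ℕ) (v : ℕ) : Bool :=
  (v :: ids V v).any fun s => (rotTo s (ids V v)).all fun a => (rotTo s (ids V v)).all fun b =>
    !prec (rotTo s (ids V v)) a b || mayPrecede V x v a b

/-- The next dart on the boundary of the face. -/
def nextDart (V : Net) (d : ℕ × ℕ) : ℕ × ℕ :=
  (d.2, (((ids V d.2).dropWhile fun x => x != d.1).tail ++ ids V d.2).headD d.1)

/-- The darts on the boundary of a face. -/
def face (V : Net) (d : ℕ × ℕ) : List (ℕ × ℕ) := iterates (nextDart V) d (V.flatMap fun _ => V)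

/-- The outer face, given by at most one dart, is the unbounded one. -/
def checkOuter (V : Net) (D x : List ℕ) : Bool :=
  D.isEmpty || (face V (D.getD 0 0, D.getD 1 0)).any fun e => up V e.1 == e.1 && hasArc V e.2 e.1 &&
    (List.range V.length).all fun u => !hasArc V u e.1 || decide (x.getD u 0 ≤ x.getD e.2 0)

/-- The placement with the abscissae `x` is correct. -/
def check (V : Net) (D x : List ℕ) : Bool :=
  ((List.range V.length).all fun u => (List.range V.length).all fun v => checkPair V x u v) &&
  ((List.range V.length).all fun v => checkRot V x v) && checkOuter V D x

/-- The correct placements found. -/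
def solutions (V : Net) (D : List ℕ) : List (List ℕ) :=
  ((List.range V.length).map fun g => dist V g).filter fun x => check V D x

/-- The output as a list of numbers. -/
def result (V : Net) (D : List ℕ) : List ℕ :=
  List.casesOn (solutions V D) [0] fun x _ => 1 :: (List.range V.length).flatMap fun v =>
    [0, x.getD v 0, V.length * den V, bif depth V v == 0 then 0 else 1, depth V v, den V]

theorem iterates_eq {β γ : Type} (f : β → β) (i : β) (l : List γ) :
    iterates f i l = ((List.range (l.length + 1)).map fun k => f^[k] i).reverse := by
  unfold iterates
  induction l using List.reverseRecOn with
  | nil => rfl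
  | append_singleton l b ih =>
    have key : ∀ n, ((List.range (n + 1)).map fun k => f^[k] i).reverse =
        f^[n] i :: ((List.range n).map fun k => f^[k] i).reverse := by
      intro n
      rw [List.range_succ, List.map_append, List.reverse_append]
      rfl
    rw [List.foldl_append, ih, List.length_append, List.length_singleton, key (l.length + 1), key]
    simp only [List.foldl_cons, List.foldl_nil, List.headD_cons, Function.iterate_succ_apply']

theorem mem_iterates {β γ : Type} {f : β → β} {i x : β} {l : List γ} :
    x ∈ iterates f i l ↔ ∃ k ≤ l.length, f^[k] i = x := by
  rw [iterates_eq]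
  simp only [List.mem_reverse, List.mem_map, List.mem_range, Nat.lt_succ_iff]

/-! ### Polynomial running time of the algorithm -/

namespace PolyTime

/-- Iterating a polynomial time function is harmless if its values stay small. The invariant `P`
expresses this; in the applications it says that the vertices met either occur in the input or were
given at the start. -/
theorem iterates {l : α → List β} {f : α → γ → γ} {i : α → γ} (hl : PolyTime l)
    (hf : PolyTime fun x : α × γ => f x.1 x.2) (hi : PolyTime i) {E : α → ℕ} (hE : PolyBounded E)
    {P : α → γ → Prop} (hP : ∀ a x, P a x → size x ≤ E a) (hPi : ∀ a, P a (i a))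
    (hPf : ∀ a x, P a x → P a (f a x)) :
    PolyTime fun a => iterates (f a) (i a) (l a) := by
  have hl' := hl.polyBounded_size
  have hs : PolyTime fun x : α × List γ × β => f x.1 (x.2.1.headD (i x.1)) :: x.2.1 := by
    have : PolyTime fun x : α × List γ × β => f x.1 (x.2.1.headD (i x.1)) :=
      hf.comp (f := fun x : α × List γ × β => (x.1, x.2.1.headD (i x.1))) (by fun_prop)
    fun_prop
  refine foldl_of_bound (s := fun a p _ => f a (p.headD (i a)) :: p) hl (by fun_prop) hs
    (B := fun a => (size (l a) + 1) * (E a + 1) + 1) (by fun_prop) fun a l' h => ?_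
  change size (HiWRAC.iterates (f a) (i a) l') ≤ _
  have h1 : ∀ k, P a ((f a)^[k] (i a)) := by
    intro k
    induction k with
    | zero => exact hPi a
    | succ k ih => rw [Function.iterate_succ_apply']; exact hPf a _ ih
  have h2 : ∀ m : List γ, (∀ x ∈ m, size x ≤ E a) → size m ≤ m.length * (E a + 1) + 1 := by
    intro m
    induction m with
    | nil => simp
    | cons x m ih =>
      intro hm
      have := ih fun y hy => hm y (by simp [hy])
      have := hm x (by simp)
      simp only [size_cons, List.length_cons, add_mul]
      omega
  refine (h2 _ fun x hx => ?_).trans ?_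
  · obtain ⟨k, -, rfl⟩ := mem_iterates.1 hx
    exact hP _ _ (h1 k)
  · have := h.length_le.trans (length_lt_size (l a)).le
    rw [iterates_eq]
    simp only [List.length_reverse, List.length_map, List.length_range]
    gcongr

variable {V : α → Net} {u v g : α → ℕ} {x D : α → List ℕ}

@[fun_prop] theorem vertex (hV : PolyTime V) (hv : PolyTime v) :
    PolyTime fun a => vertex (V a) (v a) := by
  unfold HiWRAC.vertex; fun_prop

@[fun_prop] theorem ids (hV : PolyTime V) (hv : PolyTime v) : PolyTime fun a => ids (V a) (v a) := by
  unfold HiWRAC.ids; fun_prop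

@[fun_prop] theorem hasArc (hV : PolyTime V) (hu : PolyTime u) (hv : PolyTime v) :
    PolyTime fun a => hasArc (V a) (u a) (v a) := by
  unfold HiWRAC.hasArc; fun_prop

@[fun_prop] theorem up (hV : PolyTime V) (hv : PolyTime v) : PolyTime fun a => up (V a) (v a) := by
  unfold HiWRAC.up; fun_prop

@[fun_prop] theorem dens (hV : PolyTime V) (hv : PolyTime v) :
    PolyTime fun a => dens (V a) (v a) := by
  unfold HiWRAC.dens; fun_prop

@[fun_prop] theorem den (hV : PolyTime V) : PolyTime fun a => den (V a) := by
  unfold HiWRAC.den; fun_prop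

@[fun_prop] theorem coden (hV : PolyTime V) (hv : PolyTime v) :
    PolyTime fun a => coden (V a) (v a) := by
  unfold HiWRAC.coden; fun_prop

@[fun_prop] theorem wid (hV : PolyTime V) (hv : PolyTime v) : PolyTime fun a => wid (V a) (v a) := by
  unfold HiWRAC.wid; fun_prop

@[fun_prop] theorem hgt (hV : PolyTime V) (hv : PolyTime v) : PolyTime fun a => hgt (V a) (v a) := by
  unfold HiWRAC.hgt; fun_prop

theorem _root_.HiWRAC.size_vertex_le (V : Net) (v : ℕ) : size (HiWRAC.vertex V v) ≤ size V + 9 := by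
  unfold HiWRAC.vertex
  rw [List.getD_eq_getElem?_getD]
  by_cases h : v < V.length
  · rw [List.getElem?_eq_getElem h]
    exact (size_mem_lt (List.getElem_mem h)).le.trans (by omega)
  · rw [List.getElem?_eq_none (by omega)]
    have : size ((((0, 0), 0, 0), []) : Vertex) = 9 := rfl
    simp [this]

theorem _root_.HiWRAC.size_of_mem_vertex {V : Net} {v : ℕ} {q : ℕ × Bool}
    (h : q ∈ (HiWRAC.vertex V v).2) : size q.1 ≤ size V + 9 := by
  have h1 := size_vertex_le V v
  have h2 := size_mem_lt h
  simp only [size_pair] at h1 h2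
  omega

theorem _root_.HiWRAC.size_up_le (V : Net) (v E : ℕ) (hE : size V + 9 ≤ E) (h : size v ≤ E) :
    size (HiWRAC.up V v) ≤ E := by
  unfold HiWRAC.up
  cases h' : ((HiWRAC.vertex V v).2.filter fun q => q.2).map fun q => q.1 with
  | nil => exact h
  | cons y l =>
    have : y ∈ ((HiWRAC.vertex V v).2.filter fun q => q.2).map fun q => q.1 := by simp [h']
    simp only [List.mem_map, List.mem_filter] at this
    obtain ⟨q, ⟨hq, -⟩, rfl⟩ := this
    exact (size_of_mem_vertex hq).trans hE

@[fun_prop] theorem path (hV : PolyTime V) (hv : PolyTime v) : PolyTime fun a => path (V a) (v a) := by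
  have h1 := hV.polyBounded_size
  have h2 := hv.polyBounded_size
  exact iterates (f := fun a => HiWRAC.up (V a)) hV (by fun_prop) hv
    (E := fun a => size (V a) + 9 + size (v a)) (by fun_prop)
    (P := fun a x => size x ≤ size (V a) + 9 + size (v a)) (fun _ _ h => h) (fun a => by omega)
    fun a x hx => size_up_le _ _ _ (by omega) hx

@[fun_prop] theorem depth (hV : PolyTime V) (hv : PolyTime v) :
    PolyTime fun a => depth (V a) (v a) := by
  unfold HiWRAC.depth; fun_prop

@[fun_prop] theorem rotTo (hv : PolyTime v) (hx : PolyTime x) :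
    PolyTime fun a => rotTo (v a) (x a) := by
  unfold HiWRAC.rotTo; fun_prop

@[fun_prop] theorem prec (hx : PolyTime x) (hu : PolyTime u) (hv : PolyTime v) :
    PolyTime fun a => prec (x a) (u a) (v a) := by
  unfold HiWRAC.prec; fun_prop

@[fun_prop] theorem order (hV : PolyTime V) (hg : PolyTime g) (hv : PolyTime v) :
    PolyTime fun a => order (V a) (g a) (v a) := by
  unfold HiWRAC.order; fun_prop

@[fun_prop] theorem leftOf (hV : PolyTime V) (hg : PolyTime g) (hu : PolyTime u) (hv : PolyTime v) :
    PolyTime fun a => leftOf (V a) (g a) (u a) (v a) := by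
  unfold HiWRAC.leftOf; fun_prop

@[fun_prop] theorem closedMeet (hV : PolyTime V) (hu : PolyTime u) (hv : PolyTime v) :
    PolyTime fun a => closedMeet (V a) (u a) (v a) := by
  unfold HiWRAC.closedMeet; fun_prop

@[fun_prop] theorem openMeet (hV : PolyTime V) (hu : PolyTime u) (hv : PolyTime v) :
    PolyTime fun a => openMeet (V a) (u a) (v a) := by
  unfold HiWRAC.openMeet; fun_prop

@[fun_prop] theorem adjacent (hV : PolyTime V) (hu : PolyTime u) (hv : PolyTime v) :
    PolyTime fun a => adjacent (V a) (u a) (v a) := by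
  unfold HiWRAC.adjacent; fun_prop

@[fun_prop] theorem bound (hV : PolyTime V) (hg : PolyTime g) (hu : PolyTime u) (hv : PolyTime v) :
    PolyTime fun a => bound (V a) (g a) (u a) (v a) := by
  unfold HiWRAC.bound; fun_prop

@[fun_prop] theorem foldlMax (hx : PolyTime x) (hv : PolyTime v) :
    PolyTime fun a => (x a).foldl max (v a) := by
  have h := hx.polyBounded_size
  exact foldl_of_add (s := fun _ => max) hx hv (by fun_prop) (e := fun a => size (x a)) (by fun_prop)
    fun a c b hb => by
      have := size_mem_lt hb
      rcases max_choice c b with h | h <;> rw [h] <;> omega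

@[fun_prop] theorem relax (hV : PolyTime V) (hg : PolyTime g) (hx : PolyTime x) :
    PolyTime fun a => relax (V a) (g a) (x a) := by
  unfold HiWRAC.relax; fun_prop

end PolyTime

/-- All constraints shift by less than this. -/
def maxShift (V : Net) : ℕ := ((List.range V.length).map fun v => wid V v).sum + 1

theorem le_maxShift {V : Net} {g u v : ℕ} {c : ℕ × ℕ} (hu : u < V.length) (h : c ∈ bound V g u v) :
    c.1 ≤ maxShift V := by
  have : wid V u ≤ ((List.range V.length).map fun v => wid V v).sum :=
    List.single_le_sum (by simp) _ (List.mem_map_of_mem (List.mem_range.2 hu))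
  unfold bound at h
  unfold maxShift
  cases h1 : u == v <;> cases h2 : adjacent V u v <;>
    cases h3 : leftOf V g u v && closedMeet V u v <;> cases h4 : openMeet V u v <;>
    simp [h1, h2, h3, h4] at h <;> subst h <;> simp <;> omega

theorem foldl_max_le {l : List ℕ} {i b : ℕ} (hi : i ≤ b) (hl : ∀ x ∈ l, x ≤ b) : l.foldl max i ≤ b := by
  induction l generalizing i with
  | nil => exact hi
  | cons x l ih => exact ih (max_le hi (hl x (by simp))) fun y hy => hl y (by simp [hy])

/-- A round increases the values by at most `maxShift`, so they grow linearly with the number of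
rounds. Their binary lengths are therefore polynomial. -/
theorem dist_le {V : Net} {g : ℕ} (l : List Vertex) :
    (l.foldl (fun d _ => relax V g d) (V.map fun _ => 0)).length = V.length ∧
      ∀ x ∈ l.foldl (fun d _ => relax V g d) (V.map fun _ => 0), x ≤ l.length * maxShift V := by
  induction l using List.reverseRecOn with
  | nil => simp
  | append_singleton l r ih =>
    rw [List.foldl_append, List.foldl_cons, List.foldl_nil]
    generalize l.foldl (fun d _ => relax V g d) (V.map fun _ => 0) = d at ih
    have hd : ∀ u, d.getD u 0 ≤ l.length * maxShift V := by
      intro u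
      rw [List.getD_eq_getElem?_getD]
      by_cases h : u < d.length
      · rw [List.getElem?_eq_getElem h]
        exact ih.2 _ (List.getElem_mem h)
      · rw [List.getElem?_eq_none (by omega)]
        simp
    refine ⟨by simp [relax], fun x hx => ?_⟩
    simp only [relax, List.mem_map, List.mem_range] at hx
    obtain ⟨v, -, rfl⟩ := hx
    rw [List.length_append, List.length_singleton, add_mul]
    refine foldl_max_le ((hd v).trans (by omega)) fun y hy => ?_
    simp only [List.mem_flatMap, List.mem_range, List.mem_map] at hy
    obtain ⟨u, hu, c, hc, rfl⟩ := hy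
    have h1 := hd u
    have h2 := le_maxShift hu hc
    omega

namespace PolyTime

variable {V : α → Net} {u v g : α → ℕ} {x D : α → List ℕ}

@[fun_prop] theorem dist (hV : PolyTime V) (hg : PolyTime g) :
    PolyTime fun a => dist (V a) (g a) := by
  have h1 := hV.polyBounded_size
  have hP : PolyTime fun a => maxShift (V a) := by unfold maxShift; fun_prop
  have h2 := hP.polyBounded_size
  refine foldl_of_bound (l := V) (s := fun a d _ => HiWRAC.relax (V a) (g a) d) hV (by fun_prop)
    (by fun_prop)
    (B := fun a => size (V a) * (2 * size (V a) + 1 + size (maxShift (V a)) + 1) + 1)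
    (by fun_prop) fun a l' hl => ?_
  obtain ⟨h3, h4⟩ := dist_le (V := V a) (g := g a) l'
  have h5 := (length_lt_size (V a)).le
  have h6 := hl.length_le
  generalize l'.foldl (fun d _ => HiWRAC.relax (V a) (g a) d) ((V a).map fun _ => 0) = d at h3 h4
  have h7 : ∀ m : List ℕ, (∀ x ∈ m, x ≤ l'.length * maxShift (V a)) →
      size m ≤ m.length * (2 * size (V a) + 1 + size (maxShift (V a)) + 1) + 1 := by
    intro m
    induction m with
    | nil => simp
    | cons x m ih =>
      intro hm
      have e1 := ih fun y hy => hm y (by simp [hy])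
      have e2 := size_nat_mono (hm x (by simp))
      have e3 := size_mul_le l'.length (maxShift (V a))
      have e4 : size l'.length ≤ 2 * l'.length + 1 := by
        have : l'.length.size ≤ l'.length := by rw [Nat.size_le]; exact Nat.lt_two_pow_self
        rw [size_nat_eq]
        omega
      rw [size_cons, List.length_cons, add_mul]
      omega
  refine (h7 d h4).trans ?_
  rw [h3]
  gcongr

@[fun_prop] theorem checkPair (hV : PolyTime V) (hx : PolyTime x) (hu : PolyTime u)
    (hv : PolyTime v) : PolyTime fun a => checkPair (V a) (x a) (u a) (v a) := by
  unfold HiWRAC.checkPair; fun_prop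

@[fun_prop] theorem mayPrecede (hV : PolyTime V) (hx : PolyTime x) (hu : PolyTime u)
    (hv : PolyTime v) (hg : PolyTime g) :
    PolyTime fun a => mayPrecede (V a) (x a) (u a) (v a) (g a) := by
  unfold HiWRAC.mayPrecede; fun_prop

@[fun_prop] theorem checkRot (hV : PolyTime V) (hx : PolyTime x) (hv : PolyTime v) :
    PolyTime fun a => checkRot (V a) (x a) (v a) := by
  unfold HiWRAC.checkRot; fun_prop

@[fun_prop] theorem nextDart {d : α → ℕ × ℕ} (hV : PolyTime V) (hd : PolyTime d) :
    PolyTime fun a => nextDart (V a) (d a) := by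
  unfold HiWRAC.nextDart; fun_prop

@[fun_prop] theorem face {d : α → ℕ × ℕ} (hV : PolyTime V) (hd : PolyTime d) :
    PolyTime fun a => face (V a) (d a) := by
  have h1 := hV.polyBounded_size
  have h2 := hd.polyBounded_size
  refine iterates (f := fun a => HiWRAC.nextDart (V a)) (by fun_prop) (by fun_prop) hd
    (E := fun a => 2 * (size (V a) + 9 + size (d a)) + 1) (by fun_prop)
    (P := fun a x => size x.1 ≤ size (V a) + 9 + size (d a) ∧ size x.2 ≤ size (V a) + 9 + size (d a))
    (fun a x h => by rw [size_pair]; omega) (fun a => by rw [size_pair]; omega) fun a x hx => ?_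
  refine ⟨hx.2, ?_⟩
  unfold HiWRAC.nextDart
  cases h : ((HiWRAC.ids (V a) x.2).dropWhile fun y => y != x.1).tail ++ HiWRAC.ids (V a) x.2 with
  | nil => exact hx.1
  | cons y l =>
    have hy : y ∈ HiWRAC.ids (V a) x.2 := by
      have : y ∈ ((HiWRAC.ids (V a) x.2).dropWhile fun y => y != x.1).tail ++ HiWRAC.ids (V a) x.2 := by
        simp [h]
      rcases List.mem_append.1 this with h | h
      · exact (List.dropWhile_suffix _).subset (List.mem_of_mem_tail h)
      · exact h
    simp only [HiWRAC.ids, List.mem_map] at hy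
    obtain ⟨q, hq, rfl⟩ := hy
    exact (size_of_mem_vertex hq).trans (by omega)

@[fun_prop] theorem checkOuter (hV : PolyTime V) (hD : PolyTime D) (hx : PolyTime x) :
    PolyTime fun a => checkOuter (V a) (D a) (x a) := by
  unfold HiWRAC.checkOuter; fun_prop

@[fun_prop] theorem check (hV : PolyTime V) (hD : PolyTime D) (hx : PolyTime x) :
    PolyTime fun a => check (V a) (D a) (x a) := by
  unfold HiWRAC.check; fun_prop

@[fun_prop] theorem solutions (hV : PolyTime V) (hD : PolyTime D) :
    PolyTime fun a => solutions (V a) (D a) := by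
  unfold HiWRAC.solutions; fun_prop

@[fun_prop] theorem result (hV : PolyTime V) (hD : PolyTime D) :
    PolyTime fun a => result (V a) (D a) := by
  unfold HiWRAC.result; fun_prop

end PolyTime

end HiWRAC

namespace HiWRAC

variable {α β γ δ σ : Type} [Enc α] [Enc β] [Enc γ] [Enc δ] [Enc σ]

/-! ### Parsing -/

/-- Read a letter: the digits of the current number and the numbers read so far. -/
def tokenStep (s : List Bool × List ℕ) (o : Sym) : List Bool × List ℕ :=
  List.casesOn o.toList ([], ofDigits s.1 0 :: s.2) fun b _ => (b :: s.1, s.2)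

/-- The numbers encoded by a word. -/
def tokens (w : List Sym) : List ℕ := (w.foldl tokenStep ([], [])).2.reverse

/-- Read the data of a vertex. -/
def readVertex (t : List ℕ) : Vertex :=
  (((t.getD 1 0, t.getD 2 0), t.getD 4 0, t.getD 5 0),
    ((List.range t.length).take (t.getD 6 0)).map fun i =>
      (t.getD (7 + (i + i)) 0, t.getD (7 + (i + i + 1)) 0 == 1))

/-- Read one more vertex. -/
def parseStep (s : List ℕ × Net) : List ℕ × Net :=
  bif decide (s.1.length < 7) then s else
    (s.1.drop (7 + (s.1.getD 6 0 + s.1.getD 6 0)), s.2 ++ [readVertex s.1])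

/-- The rest of the input after the vertices, and the vertices. -/
def parse (t : List ℕ) : List ℕ × Net := t.foldl (fun s _ => parseStep s) (t.tail, [])

theorem ofDigits_lt (l : List Bool) : ofDigits l 0 < 2 ^ l.length := by
  have : ∀ (l : List Bool) (c : ℕ), ofDigits l c + 1 ≤ (c + 1) * 2 ^ l.length := by
    intro l
    induction l with
    | nil => simp [ofDigits]
    | cons b l ih =>
      intro c
      refine (ih (Nat.bit b c)).trans ?_
      rw [List.length_cons, pow_succ', ← mul_assoc]
      refine Nat.mul_le_mul_right _ ?_
      rw [Nat.bit_val]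
      cases b <;> simp <;> omega
  have := this l 0
  omega

theorem ofDigits_bits_reverse (n : ℕ) : ofDigits n.bits.reverse 0 = n := by
  unfold ofDigits
  rw [List.foldl_reverse]
  induction n using Nat.binaryRec' with
  | zero => simp
  | bit b n h ih => rw [Nat.bits_append_bit _ _ h, List.foldr_cons, ih]

/-- Digits are written with the least significant one first; collecting them in a stack reverses
them, which is the order that `ofDigits` expects. -/
theorem tokens_encodeNats (l : List ℕ) : tokens (encodeNats l) = l := by
  have h1 : ∀ (b c : List Bool) (o : List ℕ),
      (b.map some).foldl tokenStep (c, o) = (b.reverse ++ c, o) := by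
    intro b
    induction b with
    | nil => simp
    | cons x b ih =>
      intro c o
      rw [List.map_cons, List.foldl_cons]
      exact (ih (x :: c) o).trans (by simp)
  have h2 : ∀ (l o : List ℕ), (encodeNats l).foldl tokenStep ([], o) = ([], l.reverse ++ o) := by
    intro l
    induction l with
    | nil => simp [encodeNats]
    | cons n l ih =>
      intro o
      have : encodeNats (n :: l) = n.bits.map some ++ [none] ++ encodeNats l := by
        simp [encodeNats]
      rw [this, List.foldl_append, List.foldl_append, h1, List.append_nil]
      simp only [List.foldl_cons, List.foldl_nil]
      refine (ih (ofDigits n.bits.reverse 0 :: o)).trans ?_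
      rw [ofDigits_bits_reverse]
      simp
  rw [tokens, h2]
  simp

namespace PolyTime

@[fun_prop] theorem toList {f : α → Option β} (hf : PolyTime f) : PolyTime fun a => (f a).toList :=
  (of_word_eq (f := fun o : Option β => o.toList) fun _ => rfl).comp hf

@[fun_prop] protected theorem some {f : α → β} (hf : PolyTime f) : PolyTime fun a => some (f a) :=
  (of_word_eq (α := List β) (β := List β) (f := fun l => l) fun _ => rfl).comp
    (hf.cons (const ([] : List β)))

@[fun_prop] theorem tokens {w : α → List Sym} (hw : PolyTime w) : PolyTime fun a => tokens (w a) := by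
  have hd : PolyTime fun x : α × (List Bool × List ℕ) × Sym => HiWRAC.ofDigits x.2.1.1 0 :=
    ofDigits (by fun_prop) (by fun_prop)
  refine (foldl_of_add (s := fun _ s o => tokenStep s o) hw (const ([], []))
    (by unfold tokenStep; fun_prop) (e := fun _ => 2) (by fun_prop) ?_).snd.reverse
  rintro _ ⟨c, o⟩ s _
  cases s with
  | none =>
    have h1 : (HiWRAC.ofDigits c 0).size ≤ c.length := Nat.size_le.2 (ofDigits_lt c)
    simp [tokenStep, size_bools, size_nat_eq]
    omega
  | some b => simp [tokenStep]; omega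

@[fun_prop] theorem readVertex {t : α → List ℕ} (ht : PolyTime t) :
    PolyTime fun a => readVertex (t a) := by
  unfold HiWRAC.readVertex; fun_prop

@[fun_prop] theorem parse {t : α → List ℕ} (ht : PolyTime t) : PolyTime fun a => parse (t a) := by
  have h1 := ht.polyBounded_size
  obtain ⟨q, hq⟩ := (readVertex (PolyTime.id (α := List ℕ))).polyBounded_size
  refine foldl_of_bound (s := fun _ s _ => parseStep s) ht (by fun_prop)
    (by unfold parseStep; fun_prop)
    (B := fun a => size (t a) + (size (t a) * (q.eval (size (t a)) + 1) + 1) + 1) (by fun_prop)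
    fun a l' hl => ?_
  have key : ∀ l : List ℕ, size (l.foldl (fun s _ => parseStep s) ((t a).tail, [])).1 ≤ size (t a) ∧
      size (l.foldl (fun s _ => parseStep s) ((t a).tail, [])).2 ≤
        l.length * (q.eval (size (t a)) + 1) + 1 := by
    intro l
    induction l using List.reverseRecOn with
    | nil => exact ⟨size_tail_le _, by simp⟩
    | append_singleton l b ih =>
      rw [List.foldl_append, List.foldl_cons, List.foldl_nil, List.length_append,
        List.length_singleton, add_mul]
      generalize l.foldl (fun s _ => parseStep s) ((t a).tail, []) = s at ih
      unfold parseStep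
      cases decide (s.1.length < 7)
      · refine ⟨(size_drop_le _ _).trans ih.1, ?_⟩
        have h2 := size_append s.2 [HiWRAC.readVertex s.1]
        have h3 : size (HiWRAC.readVertex s.1) ≤ _ := (hq s.1).trans (eval_mono q ih.1)
        simp only [size_cons, size_nil, cond_false] at h2 ⊢
        omega
      · exact ⟨ih.1, ih.2.trans (by omega)⟩
  have h2 := hl.length_le.trans (length_lt_size (t a)).le
  obtain ⟨h3, h4⟩ := key l'
  have h5 : l'.length * (q.eval (size (t a)) + 1) ≤ size (t a) * (q.eval (size (t a)) + 1) := by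
    gcongr
  rw [size_pair]
  omega

end PolyTime

/-- The data of an input. -/
def netOf (I : Instance) : Net := (List.finRange I.n).map fun v =>
  ((((I.width v).num.natAbs, (I.width v).den), (I.height v).num.natAbs, (I.height v).den),
    (I.graph.rot v).map fun w => (w.val, I.graph.arc v w))

/-- The outer dart of an input. -/
def outerOf (I : Instance) : List ℕ :=
  match I.outer with
  | none => []
  | some d => [d.1.val, d.2.val]

theorem getD_flatMap_pair {β : Type} (l : List β) (f g : β → ℕ) (r : List ℕ) (i : ℕ) (h : i < l.length) :
    ((l.flatMap fun w => [f w, g w]) ++ r).getD (i + i) 0 = f l[i] ∧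
      ((l.flatMap fun w => [f w, g w]) ++ r).getD (i + i + 1) 0 = g l[i] := by
  induction l generalizing i with
  | nil => simp at h
  | cons w l ih =>
    cases i with
    | zero => simp
    | succ i =>
      have := ih i (by simpa using h)
      simp only [List.flatMap_cons, List.cons_append, List.nil_append, List.getElem_cons_succ]
      rw [show i + 1 + (i + 1) = i + i + 1 + 1 by omega]
      simpa using this

theorem readVertex_vertexToNats (I : Instance) (v : Fin I.n) (r : List ℕ) :
    readVertex (I.vertexToNats v ++ r) =
      ((((I.width v).num.natAbs, (I.width v).den), (I.height v).num.natAbs, (I.height v).den),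
        (I.graph.rot v).map fun w => (w.val, I.graph.arc v w)) := by
  unfold readVertex Instance.vertexToNats Fraction.toNats
  simp only [List.cons_append, List.nil_append]
  refine Prod.ext rfl ?_
  refine List.ext_getElem ?_ ?_
  · simp
    have : ∀ l : List (Fin I.n), l.length ≤ (l.map fun _ => 2).sum := by
      intro l; induction l <;> simp; omega
    have := this (I.graph.rot v)
    simp at this
    omega
  · intro i h1 h2
    have hi : i < (I.graph.rot v).length := by simpa using h2
    obtain ⟨e1, e2⟩ := getD_flatMap_pair (I.graph.rot v) (fun w => w.val)
      (fun w => (I.graph.arc v w).toNat) r i hi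
    simp only [List.getElem_map, List.getElem_take, List.getElem_range]
    rw [add_comm 7, add_comm 7]
    refine Prod.ext e1 ?_
    simp only [List.getD_cons_succ]
    rw [e2]
    cases I.graph.arc v (I.graph.rot v)[i] <;> rfl

theorem parse_input (I : Instance) :
    parse ([I.n] ++ (List.finRange I.n).flatMap I.vertexToNats ++ outerOf I) =
      (outerOf I, netOf I) := by
  -- A vertex takes at least seven numbers and the outer dart at most two, so `parseStep` recognizes
  -- the end of the vertex data by length.
  have hr : (outerOf I).length < 7 := by
    unfold outerOf; split <;> simp
  have key : ∀ (F : List ℕ) (vs : List (Fin I.n)) (o : Net), vs.length ≤ F.length →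
      F.foldl (fun s _ => parseStep s) (vs.flatMap I.vertexToNats ++ outerOf I, o) =
        (outerOf I, o ++ vs.map fun v =>
          ((((I.width v).num.natAbs, (I.width v).den), (I.height v).num.natAbs,
            (I.height v).den), (I.graph.rot v).map fun w => (w.val, I.graph.arc v w))) := by
    intro F
    induction F with
    | nil => intro vs o h; simp at h; simp [h]
    | cons x F ih =>
      intro vs o h
      rw [List.foldl_cons]
      cases vs with
      | nil =>
        have : parseStep (outerOf I, o) = (outerOf I, o) := by simp [parseStep, hr]
        simp only [List.flatMap_nil, List.nil_append]
        rw [this]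
        exact ih [] o (by simp)
      | cons v vs =>
        have hl : (I.vertexToNats v).length = 7 + 2 * (I.graph.rot v).length := by
          simp [Instance.vertexToNats, Fraction.toNats]
          omega
        have : parseStep ((v :: vs).flatMap I.vertexToNats ++ outerOf I, o) =
            (vs.flatMap I.vertexToNats ++ outerOf I, o ++ [((((I.width v).num.natAbs,
            (I.width v).den), (I.height v).num.natAbs, (I.height v).den),
            (I.graph.rot v).map fun w => (w.val, I.graph.arc v w))]) := by
          rw [List.flatMap_cons, List.append_assoc, parseStep, readVertex_vertexToNats]
          have h6 : (I.vertexToNats v ++ (vs.flatMap I.vertexToNats ++ outerOf I)).getD 6 0 =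
            (I.graph.rot v).length := rfl
          simp only [h6]
          rw [decide_eq_false (by rw [List.length_append, hl]; omega), cond_false,
            ← two_mul, ← hl, List.drop_left]
        rw [this, ih vs _ (by simpa using h)]
        simp
  unfold parse
  refine (key _ (List.finRange I.n) [] ?_).trans rfl
  -- The numbers of the input are the fuel of the fold; there are at least as many of them as
  -- vertices, and surplus rounds change nothing.
  have : ∀ l : List (Fin I.n), l.length ≤ (l.flatMap I.vertexToNats).length := by
    intro l
    induction l with
    | nil => simp
    | cons v l ih =>
      have : 1 ≤ (I.vertexToNats v).length := by simp [Instance.vertexToNats]; omega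
      simp only [List.flatMap_cons, List.length_append, List.length_cons]
      omega
  have := this (List.finRange I.n)
  simp only [List.length_append]
  omega

theorem parse_encodeInstance (I : Instance) :
    parse (tokens (encodeInstance I)) = (outerOf I, netOf I) := by
  rw [encodeInstance, tokens_encodeNats]
  exact parse_input I

/-- The output word is computed in polynomial time. -/
theorem polyTime_result : @PolyTime Instance (List Sym) (encOfWords encodeInstance) _
    fun I => encodeNats (result (netOf I) (outerOf I)) := by
  let _ := encOfWords encodeInstance
  have h0 : PolyTime fun I : Instance => encodeInstance I := PolyTime.of_word_eq fun _ => rfl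
  have h : PolyTime fun I : Instance => encodeNats
      (result (parse (tokens (encodeInstance I))).2 (parse (tokens (encodeInstance I))).1) := by
    unfold encodeNats
    fun_prop
  refine (funext fun I => ?_ : (fun I => encodeNats (result (netOf I) (outerOf I))) = _) ▸ h
  rw [parse_encodeInstance]

end HiWRAC

namespace HiWRAC

/-! ### Difference constraints -/

/-- A chain of relaxations that ends in an increase. -/
theorem exists_relaxation_chain {n : ℕ} {E : Fin n → Fin n → ℕ → ℕ → Prop} {d : ℕ → Fin n → ℕ}
    {z : Fin n → ℤ} (h2 : ∀ k u v p q, E u v p q → d k u + p - q ≤ d (k + 1) v)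
    (h3 : ∀ k v, d (k + 1) v = d k v ∨ ∃ u p q, E u v p q ∧ d (k + 1) v = d k u + p - q)
    (hz : ∀ u v p q, E u v p q → z u + p ≤ z v + q) (k : ℕ) :
    ∀ v, d k v < d (k + 1) v → ∃ c : ℕ → Fin n, c k = v ∧ (∀ j ≤ k, d j (c j) < d (j + 1) (c j)) ∧
      ∀ j < k, (d (j + 2) (c (j + 1)) : ℤ) - z (c (j + 1)) ≤ d (j + 1) (c j) - z (c j) := by
  induction k with
  | zero =>
    intro v hv
    exact ⟨fun _ => v, rfl, fun j hj => by obtain rfl : j = 0 := by omega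
                                           exact hv, by simp⟩
  | succ k ih =>
    intro v hv
    obtain ⟨u, p, q, hE, he⟩ := (h3 (k + 1) v).resolve_left (by omega)
    -- If the value at `u` had not grown in the round before, the constraint would already have
    -- raised the value at `v` in that round.
    have hu : d k u < d (k + 1) u := by
      have h4 := h2 k u v p q hE
      omega
    obtain ⟨c, hc, hc1, hc2⟩ := ih u hu
    refine ⟨fun j => if j ≤ k then c j else v, by simp, fun j hj => ?_, fun j hj => ?_⟩
    · dsimp only
      split_ifs with h
      · exact hc1 j h
      · obtain rfl : j = k + 1 := by omega
        exact hv
    · dsimp only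
      rw [if_pos (by omega : j ≤ k)]
      split_ifs with h
      · exact hc2 j (by omega)
      · obtain rfl : j = k := by omega
        have := hz u v p q hE
        have he : d (j + 2) v = _ := he
        -- The strict increase shows that the new value is positive, so the truncated subtraction in
        -- `he` is a true one.
        have hv : d (j + 1) v < d (j + 2) v := hv
        rw [hc]
        omega

/-- If the constraints `x u + p ≤ x v + q` are solvable, `n` rounds of relaxations solve them. -/
theorem relaxation_solves {n : ℕ} {E : Fin n → Fin n → ℕ → ℕ → Prop} {d : ℕ → Fin n → ℕ}
    {z : Fin n → ℤ} (h1 : ∀ k v, d k v ≤ d (k + 1) v)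
    (h2 : ∀ k u v p q, E u v p q → d k u + p - q ≤ d (k + 1) v)
    (h3 : ∀ k v, d (k + 1) v = d k v ∨ ∃ u p q, E u v p q ∧ d (k + 1) v = d k u + p - q)
    (hz : ∀ u v p q, E u v p q → z u + p ≤ z v + q) {u v : Fin n} {p q : ℕ} (h : E u v p q) :
    d n u + p ≤ d n v + q := by
  by_contra hlt
  have hv : d n v < d (n + 1) v := by
    have := h2 n u v p q h
    omega
  -- A violated constraint yields a chain of `n + 1` vertices with an increase in every round, so a
  -- vertex occurs twice. Along the chain the difference between the value and the solution `z` does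
  -- not grow, so its value at the later occurrence is at most that at the earlier one, although it
  -- has strictly increased meanwhile.
  obtain ⟨c, -, hc1, hc2⟩ := exists_relaxation_chain h2 h3 hz n v hv
  have hinj : ¬ Function.Injective fun j : Fin (n + 1) => c j := by
    intro hi
    have := Fintype.card_le_of_injective _ hi
    simp at this
  have hanti : ∀ i m, i + m ≤ n →
      (d (i + m + 1) (c (i + m)) : ℤ) - z (c (i + m)) ≤ d (i + 1) (c i) - z (c i) := by
    intro i m
    induction m with
    | zero => simp
    | succ m ih =>
      intro hm
      have e1 := ih (by omega)
      have e2 := hc2 (i + m) (by omega)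
      exact e2.trans e1
  have hmono : ∀ v, Monotone fun k => d k v := fun v => monotone_nat_of_le_succ fun k => h1 k v
  have key : ∀ i j, i < j → j ≤ n → c i ≠ c j := by
    intro i j hij hj he
    obtain ⟨m, rfl⟩ := Nat.exists_eq_add_of_lt hij
    have e1 := hanti i (m + 1) (by omega)
    have e2 := hc1 (i + (m + 1)) (by omega)
    rw [show c (i + (m + 1)) = c i from he.symm] at e1 e2
    have e3 : d (i + 1) (c i) ≤ d (i + (m + 1)) (c i) := hmono (c i) (by omega : i + 1 ≤ i + (m + 1))
    omega
  apply hinj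
  intro i j hij
  rcases lt_trichotomy i j with h | h | h
  · exact absurd hij (key i j h (by omega))
  · exact h
  · exact absurd hij.symm (key j i h (by omega))

/-- Round a real solution of difference constraints to an integer one, scaled by `n`; the fractional
parts are replaced by their ranks. -/
theorem exists_int_potential {n : ℕ} (y : Fin n → ℝ) : ∃ z : Fin n → ℤ, ∀ u v (c : ℤ),
    (y u + c ≤ y v → z u + n * c ≤ z v) ∧ (y u + c < y v → z u + n * c + 1 ≤ z v) := by
  classical
  let R : Fin n → Finset (Fin n) := fun v => Finset.univ.filter fun u => Int.fract (y u) < Int.fract (y v)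
  have hR : ∀ v, (R v).card + 1 ≤ n := by
    intro v
    have : R v ⊂ Finset.univ := Finset.ssubset_univ_iff.2 fun h => by
      have : v ∈ R v := by rw [h]; simp
      simp [R] at this
    have := Finset.card_lt_card this
    simpa using this
  -- The rank of a fractional part is less than `n`, so it acts as a last digit in base `n`. Integer
  -- shifts affect only the floor, and equal or strictly ordered fractional parts have equal or
  -- strictly ordered ranks.
  refine ⟨fun v => n * ⌊y v⌋ + (R v).card, fun u v c => ?_⟩
  have hu := Int.floor_add_fract (y u)
  have hv := Int.floor_add_fract (y v)
  have hu0 := Int.fract_nonneg (y u)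
  have hv1 := Int.fract_lt_one (y v)
  have hlt : y u + c ≤ y v → ⌊y u⌋ + c ≤ ⌊y v⌋ := by
    intro h
    have : ((⌊y u⌋ + c : ℤ) : ℝ) < (⌊y v⌋ + 1 : ℤ) := by push_cast; linarith
    have := Int.cast_lt.1 this
    omega
  have hlt' : ⌊y u⌋ + c < ⌊y v⌋ →
      (n : ℤ) * ⌊y u⌋ + (R u).card + n * c + 1 ≤ n * ⌊y v⌋ + (R v).card := by
    intro h
    have h1 : (n : ℤ) * (⌊y u⌋ + c + 1) ≤ n * ⌊y v⌋ := by
      apply mul_le_mul_of_nonneg_left <;> omega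
    have h2 := hR u
    have : ((R u).card : ℤ) + 1 ≤ n := by exact_mod_cast h2
    have : (0 : ℤ) ≤ (R v).card := by positivity
    linarith
  constructor
  · intro h
    rcases (hlt h).lt_or_eq with h' | h'
    · have := hlt' h'
      linarith
    · have hf : Int.fract (y u) ≤ Int.fract (y v) := by
        have : ((⌊y u⌋ + c : ℤ) : ℝ) = ⌊y v⌋ := by rw [h']
        push_cast at this
        linarith
      have : R u ⊆ R v := fun w hw => by
        simp only [R, Finset.mem_filter, Finset.mem_univ, true_and] at hw ⊢
        exact hw.trans_le hf
      have : ((R u).card : ℤ) ≤ (R v).card := by exact_mod_cast Finset.card_le_card this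
      dsimp only
      rw [← h']
      linarith
  · intro h
    rcases (hlt h.le).lt_or_eq with h' | h'
    · exact hlt' h'
    · have hf : Int.fract (y u) < Int.fract (y v) := by
        have : ((⌊y u⌋ + c : ℤ) : ℝ) = ⌊y v⌋ := by rw [h']
        push_cast at this
        linarith
      have : R u ⊂ R v := by
        refine Finset.ssubset_iff_of_subset (fun w hw => ?_) |>.2 ⟨u, ?_, ?_⟩
        · simp only [R, Finset.mem_filter, Finset.mem_univ, true_and] at hw ⊢
          exact hw.trans hf
        · simpa [R] using hf
        · simp [R]
      have : ((R u).card : ℤ) + 1 ≤ (R v).card := by exact_mod_cast Finset.card_lt_card this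
      dsimp only
      rw [← h']
      linarith

/-! ### Lists -/

theorem prec_iff {l : List ℕ} {x y : ℕ} : prec l x y = true ↔ [x, y].Sublist l := by
  induction l with
  | nil => simp [prec]
  | cons z l ih =>
    by_cases h : z = x
    · subst h
      simp [prec]
    · have : prec (z :: l) x y = prec l x y := by simp [prec, h]
      rw [this, ih]
      constructor
      · exact fun h => h.cons z
      · intro h'
        cases h' with
        | cons _ h' => exact h'
        | cons_cons _ h' => exact absurd rfl h

theorem pair_sublist_or {β : Type} {l : List β} {x y : β} (hxy : x ≠ y) (hx : x ∈ l) (hy : y ∈ l) :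
    [x, y].Sublist l ∨ [y, x].Sublist l := by
  induction l with
  | nil => simp at hx
  | cons z l ih =>
    rcases List.mem_cons.1 hx with rfl | hx' <;> rcases List.mem_cons.1 hy with rfl | hy'
    · exact absurd rfl hxy
    · exact .inl (List.Sublist.cons_cons _ (List.singleton_sublist.2 hy'))
    · exact .inr (List.Sublist.cons_cons _ (List.singleton_sublist.2 hx'))
    · exact (ih hx' hy').imp (fun h => h.cons z) fun h => h.cons z

theorem rotTo_of_split {s : ℕ} {l₁ l₂ : List ℕ} (h : s ∉ l₁) :
    rotTo s (l₁ ++ s :: l₂) = s :: l₂ ++ l₁ := by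
  have h1 : (l₁ ++ s :: l₂).dropWhile (fun x => x != s) = s :: l₂ := by
    rw [List.dropWhile_append_of_pos]
    · simp
    · intro x hx
      simp only [bne_iff_ne]
      rintro rfl
      exact h hx
  have h2 : (l₁ ++ s :: l₂).takeWhile (fun x => x != s) = l₁ := by
    rw [List.takeWhile_append_of_pos]
    · simp
    · intro x hx
      simp only [bne_iff_ne]
      rintro rfl
      exact h hx
  rw [rotTo, h1, h2]

theorem rotTo_of_notMem {s : ℕ} {l : List ℕ} (h : s ∉ l) : rotTo s l = l := by
  have h1 : ∀ x ∈ l, (x != s) = true := by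
    intro x hx
    simp only [bne_iff_ne]
    rintro rfl
    exact h hx
  rw [rotTo, List.dropWhile_eq_nil_iff.2 h1, List.takeWhile_eq_self_iff.2 h1, List.nil_append]

theorem rotTo_isRotated (s : ℕ) (l : List ℕ) : l.IsRotated (rotTo s l) := by
  by_cases h : s ∈ l
  · obtain ⟨l₁, l₂, rfl, hn⟩ := List.eq_append_cons_of_mem h
    rw [rotTo_of_split hn]
    exact List.isRotated_append
  · rw [rotTo_of_notMem h]

/-- Without repetitions, the position of the first element determines the rotation, so a rotation
that fixes it is trivial. -/
theorem eq_of_isRotated_cons {s : ℕ} {l m : List ℕ} (hl : (s :: l).Nodup)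
    (h : (s :: l).IsRotated (s :: m)) : l = m := by
  obtain ⟨k, hk⟩ := h
  rw [← List.rotate_mod] at hk
  have hlt : k % (s :: l).length < (s :: l).length := Nat.mod_lt _ (by simp)
  have h0 : (s :: l)[k % (s :: l).length]? = some s := by
    rw [← List.head?_rotate hlt, hk]
    rfl
  have h1 : k % (s :: l).length = 0 := by
    rw [List.getElem?_eq_getElem hlt] at h0
    have h0 : (s :: l)[k % (s :: l).length] = (s :: l)[0] := by simpa using h0
    exact (hl.getElem_inj_iff).1 h0
  rw [h1] at hk
  simpa using hk

theorem rotTo_eq {s : ℕ} {l m : List ℕ} (hl : l.Nodup) (h : l.IsRotated (s :: m)) :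
    rotTo s l = s :: m := by
  have hs : s ∈ l := h.mem_iff.2 (by simp)
  have h1 := rotTo_isRotated s l
  obtain ⟨l₁, l₂, rfl, hn⟩ := List.eq_append_cons_of_mem hs
  rw [rotTo_of_split hn] at h1 ⊢
  rw [List.cons_append] at h1 ⊢
  rw [eq_of_isRotated_cons (h1.nodup_iff.1 hl) (h1.symm.trans h)]

/-- A list in which the elements with a property come first. -/
theorem filter_append_filter_not {β : Type} (P : β → Bool) {l : List β}
    (h : l.Pairwise fun a b => P b = true → P a = true) :
    l.filter P ++ l.filter (fun a => !P a) = l := by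
  induction l with
  | nil => rfl
  | cons a l ih =>
    obtain ⟨h1, h2⟩ := List.pairwise_cons.1 h
    cases ha : P a
    · have : ∀ b ∈ l, P b = false := by
        intro b hb
        by_contra hb'
        have := h1 b hb (by simpa using hb')
        simp [ha] at this
      have e1 : l.filter P = [] := by
        rw [List.filter_eq_nil_iff]
        intro b hb
        simp [this b hb]
      have e2 : l.filter (fun a => !P a) = l := by
        rw [List.filter_eq_self]
        intro b hb
        simp [this b hb]
      simp [ha, e1, e2]
    · simp [ha, ih h2]

end HiWRAC

namespace HiWRAC

/-! ### The data of an input -/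

variable {I : Instance}

/-- A vertex without outgoing edges. -/
def IsSink (v : Fin I.n) : Prop := ∀ w, I.graph.arc v w = false

theorem arc_irrefl (v : Fin I.n) : I.graph.arc v v = false := by
  by_contra h
  exact I.acyclic v (.single (by simpa using h))

theorem ne_of_arc {u v : Fin I.n} (h : I.graph.arc u v = true) : u ≠ v := by
  rintro rfl
  simp [arc_irrefl] at h

theorem IsSink.eq {u v : Fin I.n} (hu : IsSink u) (hv : IsSink v) : u = v :=
  I.unique_sink.unique hu hv

theorem n_pos (I : Instance) : 0 < I.n :=
  let ⟨v, _⟩ := I.unique_sink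
  v.pos

@[simp] theorem length_netOf (I : Instance) : (netOf I).length = I.n := by simp [netOf]

theorem vertex_netOf (v : Fin I.n) : vertex (netOf I) v =
    ((((I.width v).num.natAbs, (I.width v).den), (I.height v).num.natAbs, (I.height v).den),
      (I.graph.rot v).map fun w => (w.val, I.graph.arc v w)) := by
  unfold vertex
  rw [List.getD_eq_getElem?_getD, List.getElem?_eq_getElem (by simp)]
  simp [netOf]

theorem ids_netOf (v : Fin I.n) : ids (netOf I) v = (I.graph.rot v).map Fin.val := by
  rw [ids, vertex_netOf, List.map_map]
  rfl

theorem hasArc_netOf (u v : Fin I.n) : hasArc (netOf I) u v = I.graph.arc u v := by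
  rw [hasArc, vertex_netOf, Bool.eq_iff_iff]
  simp only [List.any_map, List.any_eq_true, Function.comp, Bool.and_eq_true, beq_iff_eq,
    Fin.val_inj]
  constructor
  · rintro ⟨w, -, rfl, h⟩
    exact h
  · exact fun h => ⟨v, (I.graph.mem_rot u v).2 (.inl h), rfl, h⟩

theorem exists_up (v : Fin I.n) : ∃ w : Fin I.n, up (netOf I) v = w ∧
    (I.graph.arc v w = true ∨ w = v ∧ IsSink v) := by
  unfold up
  rw [vertex_netOf]
  cases h : ((((I.graph.rot v).map fun w => (w.val, I.graph.arc v w)).filter fun q => q.2).map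
      fun q => q.1) with
  | nil =>
    refine ⟨v, rfl, .inr ⟨rfl, fun w => ?_⟩⟩
    by_contra hw
    have hw : I.graph.arc v w = true := by simpa using hw
    rw [List.map_eq_nil_iff, List.filter_eq_nil_iff] at h
    exact h (w.val, I.graph.arc v w)
      (List.mem_map_of_mem ((I.graph.mem_rot v w).2 (.inl hw))) hw
  | cons x l =>
    have : x ∈ ((((I.graph.rot v).map fun w => (w.val, I.graph.arc v w)).filter fun q => q.2).map
      fun q => q.1) := by simp [h]
    simp only [List.mem_map, List.mem_filter] at this
    obtain ⟨q, ⟨⟨w, hw, rfl⟩, hq⟩, rfl⟩ := this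
    exact ⟨w, rfl, .inl hq⟩

/-- The first out-neighbour of a vertex, or itself for the sink. -/
noncomputable def parent (v : Fin I.n) : Fin I.n := (exists_up v).choose

theorem up_netOf (v : Fin I.n) : up (netOf I) v = parent v := (exists_up v).choose_spec.1

theorem parent_spec (v : Fin I.n) : I.graph.arc v (parent v) = true ∨ parent v = v ∧ IsSink v :=
  (exists_up v).choose_spec.2

theorem arc_parent {v : Fin I.n} (h : ¬ IsSink v) : I.graph.arc v (parent v) = true :=
  (parent_spec v).resolve_right fun h' => h h'.2

theorem IsSink.parent_eq {v : Fin I.n} (h : IsSink v) : parent v = v :=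
  ((parent_spec v).resolve_left (by simp [h _])).1

theorem isSink_iff {v : Fin I.n} : IsSink v ↔ parent v = v := by
  refine ⟨IsSink.parent_eq, fun h => ?_⟩
  by_contra hs
  exact ne_of_arc (arc_parent hs) h.symm

theorem IsSink.iterate_eq {v : Fin I.n} (h : IsSink v) (k : ℕ) : parent^[k] v = v :=
  Function.iterate_fixed h.parent_eq k

theorem not_isSink_of_iterate {v : Fin I.n} {k : ℕ} (h : ¬ IsSink (parent^[k] v)) : ¬ IsSink v :=
  fun hv => h (by rwa [hv.iterate_eq])

theorem transGen_iterate {v : Fin I.n} (k : ℕ) (h : ¬ IsSink (parent^[k] v)) :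
    Relation.TransGen (fun a b => I.graph.arc a b = true) v (parent^[k + 1] v) := by
  induction k with
  | zero => exact .single (arc_parent h)
  | succ k ih =>
    rw [Function.iterate_succ_apply']
    refine .tail (ih fun h' => h ?_) (arc_parent h)
    rw [Function.iterate_succ_apply', h'.parent_eq]
    exact h'

/-- If the sink had not been reached after `n` steps, two of the `n + 1` vertices on the path would
coincide and give a directed cycle. -/
theorem isSink_iterate (v : Fin I.n) : IsSink (parent^[I.n] v) := by
  by_contra h
  have hinj : ¬ Function.Injective fun j : Fin (I.n + 1) => parent^[j.val] v := by
    intro hi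
    have := Fintype.card_le_of_injective _ hi
    simp at this
  have key : ∀ i j, i < j → j ≤ I.n → parent^[i] v ≠ parent^[j] v := by
    intro i j hij hj he
    obtain ⟨m, rfl⟩ := Nat.exists_eq_add_of_lt hij
    obtain ⟨r, hr⟩ := Nat.exists_eq_add_of_le (by omega : i + m ≤ I.n)
    have h1 : ¬ IsSink (parent^[m] (parent^[i] v)) := by
      rw [← Function.iterate_add_apply, add_comm]
      refine not_isSink_of_iterate (k := r) ?_
      rwa [← Function.iterate_add_apply, add_comm, ← hr]
    have h2 := transGen_iterate m h1
    rw [← Function.iterate_add_apply, show m + 1 + i = i + m + 1 by omega, ← he] at h2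
    exact I.acyclic _ h2
  apply hinj
  intro i j hij
  rcases lt_trichotomy i j with h | h | h
  · exact absurd hij (key i j h (by omega))
  · exact h
  · exact absurd hij.symm (key j i h (by omega))

theorem up_iterate (v : Fin I.n) (k : ℕ) : (up (netOf I))^[k] v = (parent^[k] v).val := by
  induction k with
  | zero => rfl
  | succ k ih => rw [Function.iterate_succ_apply', Function.iterate_succ_apply', ih, up_netOf]

theorem mem_path {v : Fin I.n} {x : ℕ} :
    x ∈ path (netOf I) v ↔ ∃ k ≤ I.n, (parent^[k] v).val = x := by
  simp only [path, mem_iterates, length_netOf, up_iterate]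

theorem dens_pos (v : Fin I.n) : 0 < dens (netOf I) v := by
  rw [dens, vertex_netOf]
  exact Nat.mul_pos (I.width v).den_pos (I.height v).den_pos

theorem prod_range_eq (n : ℕ) (f : ℕ → ℕ) : ((List.range n).map f).prod = ∏ i ∈ Finset.range n, f i :=
  rfl

theorem coden_pos (v : Fin I.n) : 0 < coden (netOf I) v := by
  rw [coden, prod_range_eq, length_netOf]
  refine Finset.prod_pos fun j hj => ?_
  cases h : j == v.val
  · exact dens_pos ⟨j, Finset.mem_range.1 hj⟩
  · simp

theorem den_eq (v : Fin I.n) : den (netOf I) = dens (netOf I) v * coden (netOf I) v := by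
  rw [den, coden, prod_range_eq, prod_range_eq, length_netOf]
  have hv : v.val ∈ Finset.range I.n := Finset.mem_range.2 v.isLt
  rw [← Finset.mul_prod_erase _ _ hv,
    ← Finset.mul_prod_erase _ (fun j => bif j == v.val then 1 else dens (netOf I) j) hv]
  rw [beq_self_eq_true, cond_true, one_mul]
  congr 1
  refine Finset.prod_congr rfl fun j hj => ?_
  have : j ≠ v.val := Finset.ne_of_mem_erase hj
  rw [beq_eq_false_iff_ne.2 this, cond_false]

theorem den_pos (I : Instance) : 0 < den (netOf I) := by
  rw [den_eq ⟨0, n_pos I⟩]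
  exact Nat.mul_pos (dens_pos _) (coden_pos _)

theorem width_val (v : Fin I.n) :
    (I.width v).val = wid (netOf I) v / ((I.n * den (netOf I) : ℕ) : ℝ) := by
  have h1 := coden_pos v
  have h2 := (I.width v).den_pos
  have h3 := (I.height v).den_pos
  have h4 := n_pos I
  have h5 : (((I.width v).num.natAbs : ℕ) : ℝ) = (I.width v).num := by
    have := I.width_pos v
    rw [← Int.cast_natCast, Int.natCast_natAbs, abs_of_pos this]
  rw [den_eq v, wid, dens, vertex_netOf, length_netOf, Fraction.val, ← h5]
  push_cast
  field_simp

theorem height_val (v : Fin I.n) : (I.height v).val = hgt (netOf I) v / (den (netOf I) : ℝ) := by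
  have h1 := coden_pos v
  have h2 := (I.width v).den_pos
  have h3 := (I.height v).den_pos
  have h5 : (((I.height v).num.natAbs : ℕ) : ℝ) = (I.height v).num := by
    have := I.height_pos v
    rw [← Int.cast_natCast, Int.natCast_natAbs, abs_of_pos this]
  rw [den_eq v, hgt, dens, vertex_netOf, Fraction.val, ← h5]
  push_cast
  field_simp

theorem wid_pos (v : Fin I.n) : 0 < wid (netOf I) v := by
  have := I.width_pos v
  rw [wid, vertex_netOf, length_netOf]
  exact Nat.mul_pos (n_pos I) (Nat.mul_pos (Nat.mul_pos (by simp; omega) (I.height v).den_pos) (coden_pos v))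

theorem hgt_pos (v : Fin I.n) : 0 < hgt (netOf I) v := by
  have := I.height_pos v
  rw [hgt, vertex_netOf]
  exact Nat.mul_pos (Nat.mul_pos (by simp; omega) (I.width v).den_pos) (coden_pos v)

/-- The contribution of a vertex to the depth. -/
theorem depth_eq (v : Fin I.n) : depth (netOf I) v = ∑ k ∈ Finset.range (I.n + 1),
    if parent (parent^[k] v) = parent^[k] v then 0 else hgt (netOf I) (parent^[k] v) := by
  rw [depth, path, iterates_eq, List.map_reverse, List.sum_reverse, length_netOf, List.map_map]
  change ∑ k ∈ Finset.range (I.n + 1), _ = _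
  refine Finset.sum_congr rfl fun k _ => ?_
  simp only [Function.comp, up_iterate, up_netOf]
  by_cases h : parent (parent^[k] v) = parent^[k] v
  · simp [h]
  · have : (parent (parent^[k] v)).val ≠ (parent^[k] v).val := fun h' => h (Fin.ext h')
    rw [beq_eq_false_iff_ne.2 this, cond_false, if_neg h]

theorem depth_sink {v : Fin I.n} (h : IsSink v) : depth (netOf I) v = 0 := by
  rw [depth_eq]
  exact Finset.sum_eq_zero fun k _ => by simp [h.iterate_eq, h.parent_eq]

/-- Both sums have the same length, so the path of the parent reaches one vertex further. That last
term is zero because the sink has been reached by then. -/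
theorem depth_parent {v : Fin I.n} (h : ¬ IsSink v) :
    depth (netOf I) v = depth (netOf I) (parent v) + hgt (netOf I) v := by
  rw [depth_eq, depth_eq, Finset.sum_range_succ', Finset.sum_range_succ]
  have h1 : parent (parent^[I.n] (parent v)) = parent^[I.n] (parent v) :=
    (isSink_iterate _).parent_eq
  have h2 : parent v ≠ v := fun h' => h (isSink_iff.2 h')
  simp only [Function.iterate_succ_apply, h1, if_true, Function.iterate_zero, id, h2, if_false,
    add_zero]
  rfl

theorem adjacent_netOf (u v : Fin I.n) : adjacent (netOf I) u v = true ↔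
    I.graph.arc u v = true ∨ I.graph.arc v u = true := by
  simp [adjacent, hasArc_netOf]

end HiWRAC

namespace HiWRAC

/-! ### Correctness of the check -/

variable {I : Instance}

/-- The coordinates of a box with the abscissae `x`. -/
def coord (I : Instance) (x : List ℕ) (v : Fin I.n) : Fraction × Fraction :=
  (⟨(x.getD v 0 : ℕ), I.n * den (netOf I), Nat.mul_pos (n_pos I) (den_pos I)⟩,
    ⟨-(depth (netOf I) v : ℕ), den (netOf I), den_pos I⟩)

/-- The placement with the abscissae `x`. -/
noncomputable def place (I : Instance) (x : List ℕ) (v : Fin I.n) : ℝ × ℝ :=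
  ((coord I x v).1.val, (coord I x v).2.val)

theorem unit_pos (I : Instance) : (0 : ℝ) < ((I.n * den (netOf I) : ℕ) : ℝ) :=
  Nat.cast_pos.2 (Nat.mul_pos (n_pos I) (den_pos I))

theorem denR_pos (I : Instance) : (0 : ℝ) < (den (netOf I) : ℝ) := Nat.cast_pos.2 (den_pos I)

section place

variable {x : List ℕ} {u v : Fin I.n}

theorem left_place : I.left (place I x) v = (x.getD v 0 : ℕ) / ((I.n * den (netOf I) : ℕ) : ℝ) := by
  simp [Instance.left, place, coord, Fraction.val]

theorem right_place : I.right (place I x) v =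
    ((x.getD v 0 + wid (netOf I) v : ℕ) : ℝ) / ((I.n * den (netOf I) : ℕ) : ℝ) := by
  rw [Instance.right, width_val, Nat.cast_add, add_div]
  congr 1

theorem left_lt_right_place :
    I.left (place I x) u < I.right (place I x) v ↔ x.getD u 0 < x.getD v 0 + wid (netOf I) v := by
  rw [left_place, right_place, div_lt_div_iff_of_pos_right (unit_pos I), Nat.cast_lt]

theorem left_lt_left_place :
    I.left (place I x) u < I.left (place I x) v ↔ x.getD u 0 < x.getD v 0 := by
  rw [left_place, left_place, div_lt_div_iff_of_pos_right (unit_pos I), Nat.cast_lt]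

theorem right_eq_left_place :
    I.right (place I x) u = I.left (place I x) v ↔ x.getD u 0 + wid (netOf I) u = x.getD v 0 := by
  rw [left_place, right_place, div_left_inj' (unit_pos I).ne', Nat.cast_inj]

theorem low_place : I.low (place I x) v = -(depth (netOf I) v : ℝ) / (den (netOf I) : ℝ) := by
  simp [Instance.low, place, coord, Fraction.val]

theorem high_place : I.high (place I x) v =
    (hgt (netOf I) v - depth (netOf I) v : ℝ) / (den (netOf I) : ℝ) := by
  have h := low_place (x := x) (v := v)
  rw [Instance.low] at h
  rw [Instance.high, height_val, h]
  ring

theorem low_lt_high_place : I.low (place I x) u < I.high (place I x) v ↔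
    depth (netOf I) v < depth (netOf I) u + hgt (netOf I) v := by
  rw [low_place, high_place, div_lt_div_iff_of_pos_right (denR_pos I), ← Nat.cast_lt (α := ℝ)]
  push_cast
  constructor <;> intro h <;> linarith

theorem high_eq_low_place : I.high (place I x) u = I.low (place I x) v ↔
    depth (netOf I) u = depth (netOf I) v + hgt (netOf I) u := by
  rw [low_place, high_place, div_left_inj' (denR_pos I).ne', ← Nat.cast_inj (R := ℝ)]
  push_cast
  constructor <;> intro h <;> linarith

theorem topContact_place : I.TopContact (place I x) u v ↔
    depth (netOf I) u = depth (netOf I) v + hgt (netOf I) u ∧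
      x.getD u 0 < x.getD v 0 + wid (netOf I) v ∧ x.getD v 0 < x.getD u 0 + wid (netOf I) u := by
  have h1 := wid_pos u
  have h2 := wid_pos v
  simp only [Instance.TopContact, high_eq_low_place, max_lt_iff, lt_min_iff, left_lt_right_place]
  omega

theorem sideContact_place (h : I.SideContact (place I x) u v) :
    x.getD u 0 + wid (netOf I) u = x.getD v 0 ∧
      depth (netOf I) v < depth (netOf I) u + hgt (netOf I) v ∧
      depth (netOf I) u < depth (netOf I) v + hgt (netOf I) u := by
  simp only [Instance.SideContact, right_eq_left_place, max_lt_iff, lt_min_iff,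
    low_lt_high_place] at h
  omega

theorem disjoint_place (h : ¬ (x.getD u 0 < x.getD v 0 + wid (netOf I) v ∧
    x.getD v 0 < x.getD u 0 + wid (netOf I) u ∧
    depth (netOf I) v < depth (netOf I) u + hgt (netOf I) v ∧
    depth (netOf I) u < depth (netOf I) v + hgt (netOf I) u)) :
    Disjoint (I.openBox (place I x) u) (I.openBox (place I x) v) := by
  rw [Set.disjoint_left]
  rintro ⟨a, b⟩ ⟨⟨h1, h2⟩, h3, h4⟩ ⟨⟨h5, h6⟩, h7, h8⟩
  dsimp only at h1 h2 h3 h4 h5 h6 h7 h8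
  exact h ⟨left_lt_right_place.1 (h1.trans h6), left_lt_right_place.1 (h5.trans h2),
    low_lt_high_place.1 (h3.trans h8), low_lt_high_place.1 (h7.trans h4)⟩

end place

/-- The cyclic successor of `x` is the element after it, or the first element of the list if `x` is
the last. Appending the whole list after the tail covers both cases. -/
theorem formPerm_eq_headD {n : ℕ} {l : List (Fin n)} (hl : l.Nodup) {x : Fin n} (hx : x ∈ l) :
    (((l.map Fin.val).dropWhile fun y => y != x.val).tail ++ l.map Fin.val).headD x.val =
      (l.formPerm x).val := by
  obtain ⟨l₁, l₂, rfl, hn⟩ := List.eq_append_cons_of_mem hx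
  have hd : (((l₁ ++ x :: l₂).map Fin.val).dropWhile fun y => y != x.val) =
      x.val :: l₂.map Fin.val := by
    rw [List.map_append, List.dropWhile_append_of_pos]
    · simp
    · intro y hy
      obtain ⟨z, hz, rfl⟩ := List.mem_map.1 hy
      simp only [bne_iff_ne]
      intro h
      exact hn (Fin.ext h ▸ hz)
  have hr : (l₁ ++ x :: l₂).IsRotated (x :: l₂ ++ l₁) := List.isRotated_append
  rw [hd, List.formPerm_eq_of_isRotated hl hr, List.tail_cons]
  cases l₂ with
  | nil =>
    cases l₁ with
    | nil => simp
    | cons y l₁ =>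
      simp only [List.map_nil, List.nil_append, List.cons_append, List.map_cons, List.headD_cons]
      rw [List.formPerm_apply_head]
      exact hr.nodup_iff.1 hl
  | cons y l₂ =>
    simp only [List.cons_append, List.map_cons, List.headD_cons]
    rw [List.formPerm_apply_head]
    exact hr.nodup_iff.1 hl

theorem isDart_symm {d : Fin I.n × Fin I.n} : I.graph.IsDart d ↔ d.1 ∈ I.graph.rot d.2 := by
  rw [RotationSystem.IsDart, I.graph.mem_rot, I.graph.mem_rot, or_comm]

theorem isDart_faceNext {d : Fin I.n × Fin I.n} (h : I.graph.IsDart d) :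
    I.graph.IsDart (I.graph.faceNext d) := by
  change (I.graph.rot d.2).formPerm d.1 ∈ I.graph.rot d.2
  exact List.formPerm_mem_iff_mem.2 (isDart_symm.1 h)

theorem isDart_iterate {d : Fin I.n × Fin I.n} (h : I.graph.IsDart d) (k : ℕ) :
    I.graph.IsDart (I.graph.faceNext^[k] d) := by
  induction k with
  | zero => exact h
  | succ k ih => rw [Function.iterate_succ_apply']; exact isDart_faceNext ih

theorem nextDart_netOf {d : Fin I.n × Fin I.n} (h : I.graph.IsDart d) :
    nextDart (netOf I) (d.1.val, d.2.val) =
      ((I.graph.faceNext d).1.val, (I.graph.faceNext d).2.val) := by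
  rw [nextDart]
  refine Prod.ext rfl ?_
  simp only [ids_netOf]
  exact formPerm_eq_headD (I.graph.rot_nodup d.2) (isDart_symm.1 h)

theorem nextDart_iterate {d : Fin I.n × Fin I.n} (h : I.graph.IsDart d) (k : ℕ) :
    (nextDart (netOf I))^[k] (d.1.val, d.2.val) =
      ((I.graph.faceNext^[k] d).1.val, (I.graph.faceNext^[k] d).2.val) := by
  induction k with
  | zero => rfl
  | succ k ih =>
    rw [Function.iterate_succ_apply', Function.iterate_succ_apply', ih,
      nextDart_netOf (isDart_iterate h k)]

theorem hgt_le_depth {v : Fin I.n} (h : ¬ IsSink v) : hgt (netOf I) v ≤ depth (netOf I) v := by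
  rw [depth_parent h]
  omega

variable {x : List ℕ}

/-- `mayPrecede` forbids an in-neighbour before an out-neighbour, so in the rotation found by the
check the out-neighbours form an initial segment. This segment and the rest are the contacts above
and below. -/
theorem checkRot_sound {v : Fin I.n} (h : checkRot (netOf I) x v = true)
    (hup : ∀ u w : Fin I.n, I.graph.arc u w = true → I.TopContact (place I x) u w) :
    I.ClockwiseContacts (place I x) v (I.graph.rot v) := by
  rw [checkRot, List.any_eq_true] at h
  obtain ⟨s, -, hs⟩ := h
  obtain ⟨k, hk⟩ := rotTo_isRotated s (ids (netOf I) v)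
  rw [← hk, ids_netOf, ← List.map_rotate] at hs
  set l := (I.graph.rot v).rotate k with hl
  have hrot : (I.graph.rot v).IsRotated l := ⟨k, rfl⟩
  have hp : l.Pairwise fun (a b : Fin I.n) => mayPrecede (netOf I) x v a b = true := by
    rw [List.pairwise_iff_forall_sublist]
    intro a b hab
    have ha : a ∈ l := hab.subset (by simp)
    have hb : b ∈ l := hab.subset (by simp)
    have := List.all_eq_true.1 (List.all_eq_true.1 hs _ (List.mem_map_of_mem ha)) _
      (List.mem_map_of_mem hb)
    rw [prec_iff.2 (hab.map Fin.val)] at this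
    simpa using this
  simp only [mayPrecede, hasArc_netOf] at hp
  have hsplit := filter_append_filter_not (fun a => I.graph.arc v a) (l := l) (hp.imp (by
    intro a b hab hb
    cases ha : I.graph.arc v a
    · simp [ha, hb] at hab
    · rfl))
  refine ⟨l.filter fun a => I.graph.arc v a, l.filter fun a => !I.graph.arc v a,
    by rw [hsplit]; exact hrot, ?_, ?_, ?_, ?_⟩
  · intro w hw
    exact hup v w (List.of_mem_filter hw)
  · rw [List.pairwise_filter]
    refine hp.imp ?_
    intro a b hab ha hb
    rw [left_lt_left_place]
    simpa [ha, hb] using hab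
  · intro w hw
    have hw1 : w ∈ I.graph.rot v := hrot.mem_iff.2 (List.mem_of_mem_filter hw)
    have hw2 := List.of_mem_filter hw
    rw [I.graph.mem_rot] at hw1
    exact hup w v (hw1.resolve_left (by simpa using hw2))
  · rw [List.pairwise_filter]
    refine hp.imp ?_
    intro a b hab ha hb
    rw [left_lt_left_place]
    simp only [Bool.not_eq_true'] at ha hb
    simpa [ha, hb] using hab

/-- A placement that passes the check is correct. -/
theorem check_sound (h : check (netOf I) (outerOf I) x = true) :
    I.HierarchicallyRealizes (place I x) := by
  simp only [check, Bool.and_eq_true, List.all_eq_true, List.mem_range, length_netOf] at h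
  obtain ⟨⟨hpair, hrot⟩, houter⟩ := h
  have harc : ∀ u v : Fin I.n, I.graph.arc u v = true → I.TopContact (place I x) u v := by
    intro u v huv
    have := hpair u u.isLt v v.isLt
    rw [checkPair, hasArc_netOf, huv] at this
    rw [topContact_place]
    simp only [cond_true, Bool.and_eq_true, beq_iff_eq, decide_eq_true_eq] at this
    tauto
  have hnon : ∀ u v : Fin I.n, u ≠ v → ¬ (I.graph.arc u v = true ∨ I.graph.arc v u = true) →
      ¬ (x.getD u 0 < x.getD v 0 + wid (netOf I) v ∧ x.getD v 0 < x.getD u 0 + wid (netOf I) u ∧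
        depth (netOf I) v ≤ depth (netOf I) u + hgt (netOf I) v ∧
        depth (netOf I) u ≤ depth (netOf I) v + hgt (netOf I) u) ∧
      ¬ (x.getD u 0 ≤ x.getD v 0 + wid (netOf I) v ∧ x.getD v 0 ≤ x.getD u 0 + wid (netOf I) u ∧
        depth (netOf I) v < depth (netOf I) u + hgt (netOf I) v ∧
        depth (netOf I) u < depth (netOf I) v + hgt (netOf I) u) := by
    intro u v huv hadj
    have := hpair u u.isLt v v.isLt
    have h1 : I.graph.arc u v = false := by simpa using fun h => hadj (.inl h)
    have h2 : I.graph.arc v u = false := by simpa using fun h => hadj (.inr h)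
    have h3 : (u.val == v.val) = false := beq_eq_false_iff_ne.2 fun h => huv (Fin.ext h)
    rw [checkPair, hasArc_netOf, hasArc_netOf, h1, h2, h3] at this
    simp only [cond_false, Bool.false_or, Bool.and_eq_true, Bool.not_eq_true', closedMeet, openMeet,
      Bool.and_eq_false_iff, decide_eq_false_iff_not] at this
    tauto
  have hcontact : ∀ u v, u ≠ v →
      (I.Touch (place I x) u v ↔ (I.graph.arc u v = true ∨ I.graph.arc v u = true)) := by
    intro u v huv
    constructor
    · intro ht
      by_contra hadj
      obtain ⟨h1, h2⟩ := hnon u v huv hadj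
      have hw1 := wid_pos u
      have hw2 := wid_pos v
      have hh1 := hgt_pos u
      have hh2 := hgt_pos v
      rcases ht with ht | ht | ht | ht
      · rw [topContact_place] at ht; omega
      · rw [topContact_place] at ht; omega
      · have := sideContact_place ht; omega
      · have := sideContact_place ht; omega
    · rintro (h | h)
      · exact .inl (harc u v h)
      · exact .inr (.inl (harc v u h))
  refine ⟨fun u v huv => disjoint_place ?_, hcontact, harc,
    fun v => checkRot_sound (hrot v v.isLt) harc, fun d hd => ?_⟩
  · by_cases hadj : I.graph.arc u v = true ∨ I.graph.arc v u = true
    · rcases hadj with h | h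
      · have := topContact_place.1 (harc u v h); omega
      · have := topContact_place.1 (harc v u h); omega
    · have := (hnon u v huv hadj).1
      omega
  · have hD : outerOf I = [d.1.val, d.2.val] := by rw [outerOf, hd]
    rw [checkOuter, hD] at houter
    simp only [List.isEmpty_cons, Bool.false_or, List.getD_cons_zero, List.getD_cons_succ,
      List.any_eq_true, face, mem_iterates, Bool.and_eq_true] at houter
    obtain ⟨e, ⟨k, -, rfl⟩, ⟨hsink, hin⟩, hright⟩ := houter
    rw [nextDart_iterate (I.outer_some d hd)] at hsink hin hright
    refine ⟨I.graph.faceNext^[k] d, ?_, k, rfl⟩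
    set e := I.graph.faceNext^[k] d
    rw [up_netOf, beq_iff_eq] at hsink
    have hsink : IsSink e.1 := isSink_iff.2 (Fin.ext hsink)
    rw [hasArc_netOf] at hin
    refine ⟨fun u => ?_, harc _ _ hin, fun u hu => ?_⟩
    -- The bottom of the sink is at height zero, and every other box has its top at or below this
    -- height.
    · by_cases hu : IsSink u
      · rw [hu.eq hsink]
      · rw [high_place, high_place, div_le_div_iff_of_pos_right (denR_pos I), depth_sink hsink]
        have h1 : (hgt (netOf I) u : ℝ) ≤ depth (netOf I) u := Nat.cast_le.2 (hgt_le_depth hu)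
        have h2 : (0 : ℝ) ≤ hgt (netOf I) e.1 := Nat.cast_nonneg _
        simp only [Nat.cast_zero]
        linarith
    · have hne : u ≠ e.1 := by
        rintro rfl
        have := (topContact_place.1 hu).1
        have := hgt_pos e.1
        omega
      have harc' := ((hcontact u e.1 hne).1 (.inl hu)).resolve_right (by simp [hsink u])
      simp only [List.all_eq_true, List.mem_range, length_netOf] at hright
      have := hright u u.isLt
      rw [hasArc_netOf, harc'] at this
      rw [← not_lt, left_lt_left_place]
      simpa using this

end HiWRAC

namespace HiWRAC

/-! ### Geometry of a realization -/

variable {I : Instance} {p : Fin I.n → ℝ × ℝ} {u v w : Fin I.n}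

theorem left_lt_right (p : Fin I.n → ℝ × ℝ) (v : Fin I.n) : I.left p v < I.right p v := by
  rw [Instance.left, Instance.right, width_val]
  have := div_pos (Nat.cast_pos (α := ℝ).2 (wid_pos v)) (unit_pos I)
  linarith

theorem low_lt_high (p : Fin I.n → ℝ × ℝ) (v : Fin I.n) : I.low p v < I.high p v := by
  rw [Instance.low, Instance.high, height_val]
  have := div_pos (Nat.cast_pos (α := ℝ).2 (hgt_pos v)) (denR_pos I)
  linarith

theorem topContact_iff : I.TopContact p u v ↔
    I.high p u = I.low p v ∧ I.left p u < I.right p v ∧ I.left p v < I.right p u := by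
  have h1 := left_lt_right p u
  have h2 := left_lt_right p v
  simp only [Instance.TopContact, max_lt_iff, lt_min_iff]
  tauto

theorem not_topContact_symm (h : I.TopContact p u v) : ¬ I.TopContact p v u := by
  intro h'
  have h1 := h.1
  have h2 := h'.1
  have h3 := low_lt_high p u
  have h4 := low_lt_high p v
  linarith

/-- If the horizontal extents overlapped too, a point in both open boxes would contradict
disjointness. -/
theorem Instance.IsRepresentation.separated (hr : I.IsRepresentation p) (huv : u ≠ v)
    (h1 : I.low p u < I.high p v) (h2 : I.low p v < I.high p u) :
    I.right p u ≤ I.left p v ∨ I.right p v ≤ I.left p u := by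
  by_contra! h
  have hx : max (I.left p u) (I.left p v) < min (I.right p u) (I.right p v) := by
    simp [left_lt_right, h.1, h.2]
  have hy : max (I.low p u) (I.low p v) < min (I.high p u) (I.high p v) := by
    simp [low_lt_high, h1, h2]
  obtain ⟨x, hx1, hx2⟩ := exists_between hx
  obtain ⟨y, hy1, hy2⟩ := exists_between hy
  rw [max_lt_iff] at hx1 hy1
  rw [lt_min_iff] at hx2 hy2
  exact Set.disjoint_left.1 (hr u v huv) (show (x, y) ∈ I.openBox p u from
    ⟨⟨hx1.1, hx2.1⟩, hy1.1, hy2.1⟩) ⟨⟨hx1.2, hx2.2⟩, hy1.2, hy2.2⟩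

namespace Instance.HierarchicallyRealizes

/-- Equality would produce a side contact, hence an edge; but an edge forces the top of one box to
the height of the bottom of the other, and then the open extents do not meet. -/
theorem separated_strict (hp : I.HierarchicallyRealizes p) (huv : u ≠ v)
    (h1 : I.low p u < I.high p v) (h2 : I.low p v < I.high p u) :
    I.right p u < I.left p v ∨ I.right p v < I.left p u := by
  have hadj : ¬ I.Touch p u v := by
    intro h
    rcases (hp.contact_graph u v huv).1 h with h | h
    · exact h2.ne' (hp.upward _ _ h).1
    · exact h1.ne' (hp.upward _ _ h).1
  have hy : max (I.low p u) (I.low p v) < min (I.high p u) (I.high p v) := by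
    simp [low_lt_high, h1, h2]
  rcases hp.representation.separated huv h1 h2 with h | h
  · refine .inl (h.lt_of_ne fun he => hadj ?_)
    exact .inr (.inr (.inl ⟨he, hy⟩))
  · refine .inr (h.lt_of_ne fun he => hadj ?_)
    exact .inr (.inr (.inr ⟨he, by rwa [max_comm, min_comm]⟩))

/-- If the extents meet in a single height only, a horizontal overlap would be a horizontal contact
and hence an edge. Touching at a corner remains possible. -/
theorem separated_of_not_adjacent (hp : I.HierarchicallyRealizes p) (huv : u ≠ v)
    (hadj : ¬ (I.graph.arc u v = true ∨ I.graph.arc v u = true))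
    (h1 : I.low p u ≤ I.high p v) (h2 : I.low p v ≤ I.high p u) :
    I.right p u ≤ I.left p v ∨ I.right p v ≤ I.left p u := by
  rw [← hp.contact_graph u v huv] at hadj
  rcases h1.lt_or_eq with h1 | h1
  · rcases h2.lt_or_eq with h2 | h2
    · exact hp.representation.separated huv h1 h2
    · by_contra! h
      exact hadj (.inl (topContact_iff.2 ⟨h2.symm, h.2, h.1⟩))
  · by_contra! h
    exact hadj (.inr (.inl (topContact_iff.2 ⟨h1.symm, h.1, h.2⟩)))

theorem arc_iff (hp : I.HierarchicallyRealizes p) :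
    I.graph.arc u v = true ↔ I.TopContact p u v := by
  refine ⟨hp.upward u v, fun h => ?_⟩
  have huv : u ≠ v := by
    rintro rfl
    exact not_topContact_symm h h
  refine ((hp.contact_graph u v huv).1 (.inl h)).resolve_right fun h' => ?_
  exact not_topContact_symm h (hp.upward _ _ h')

theorem topContact_parent (hp : I.HierarchicallyRealizes p) (h : ¬ IsSink v) :
    I.TopContact p v (parent v) :=
  hp.upward _ _ (arc_parent h)

theorem high_lt_high_parent (hp : I.HierarchicallyRealizes p) (h : ¬ IsSink v) :
    I.high p v < I.high p (parent v) := by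
  rw [(hp.topContact_parent h).1]
  exact low_lt_high p _

theorem high_le_high_iterate (hp : I.HierarchicallyRealizes p) (v : Fin I.n) (k : ℕ) :
    I.high p v ≤ I.high p (parent^[k] v) := by
  induction k with
  | zero => exact le_rfl
  | succ k ih =>
    rw [Function.iterate_succ_apply']
    by_cases h : IsSink (parent^[k] v)
    · rwa [h.parent_eq]
    · exact ih.trans (hp.high_lt_high_parent h).le

/-- Tops rise strictly along the path of parents until the sink is reached. -/
theorem iterate_ne_of_lt (hp : I.HierarchicallyRealizes p) {i j : ℕ} (hij : i < j)
    (hj : ¬ IsSink (parent^[j] v)) : parent (parent^[i] v) ≠ parent (parent^[j] v) := by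
  intro h
  have h1 := hp.high_lt_high_parent hj
  have h2 := hp.high_le_high_iterate (parent^[i + 1] v) (j - (i + 1))
  rw [← Function.iterate_add_apply, Nat.sub_add_cancel hij, Function.iterate_succ_apply', h] at h2
  linarith

/-- The order of two children of a box is inherited by the boxes below them. -/
theorem right_le_left_of_iterate (hp : I.HierarchicallyRealizes p) (i j : ℕ) :
    ∀ a b : Fin I.n, ¬ IsSink (parent^[i] a) → ¬ IsSink (parent^[j] b) →
      parent (parent^[i] a) = parent (parent^[j] b) →
      I.right p (parent^[i] a) ≤ I.left p (parent^[j] b) →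
      I.low p a < I.high p b → I.low p b < I.high p a → I.right p a ≤ I.left p b := by
  induction hN : i + j using Nat.strong_induction_on generalizing i j with
  | _ N ih =>
  subst hN
  intro a b hsa hsb hpar hlr h1 h2
  have hsa0 := not_isSink_of_iterate hsa
  have hsb0 := not_isSink_of_iterate hsb
  have ha := topContact_iff.1 (hp.topContact_parent hsa0)
  have hb := topContact_iff.1 (hp.topContact_parent hsb0)
  have hwa := left_lt_right p a
  have hwb := left_lt_right p b
  have hlpa := low_lt_high p (parent a)
  have hlpb := low_lt_high p (parent b)
  have hla := low_lt_high p a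
  have hlb := low_lt_high p b
  -- A single box cannot be below both siblings: two positions on one path with the same parent
  -- would have to coincide, and a box is not to the left of itself.
  have hab : a ≠ b := by
    rintro rfl
    rcases lt_trichotomy i j with h | rfl | h
    · exact hp.iterate_ne_of_lt h hsb hpar
    · exact absurd (left_lt_right p (parent^[i] a)) (not_lt.2 hlr)
    · exact hp.iterate_ne_of_lt h hsa hpar.symm
  have hhigh : I.high p (parent^[i] a) = I.high p (parent^[j] b) := by
    rw [(hp.topContact_parent hsa).1, (hp.topContact_parent hsb).1, hpar]
  refine (hp.representation.separated hab h1 h2).resolve_right fun hcon => ?_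
  -- Replace the box with the lower top by its parent, or both boxes if the tops are level. The new
  -- pair still meets vertically, so the induction hypothesis orders it. Since a box overlaps its
  -- parent horizontally, this contradicts the reverse order `hcon`. A box whose top is not above
  -- that of the other while being itself one of the siblings leads to a contradiction, because the
  -- siblings have level tops and lie at or above their descendants.
  rcases lt_trichotomy (I.high p a) (I.high p b) with h | h | h
  · cases i with
    | zero =>
      have := hp.high_le_high_iterate b j
      rw [← hhigh] at this
      exact absurd h (not_lt.2 this)
    | succ i =>
      have := ih (i + j) (by omega) i j rfl (parent a) b hsa hsb hpar hlr (by linarith)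
        (by linarith)
      linarith
  · cases i with
    | zero =>
      cases j with
      | zero => exact absurd (hlr.trans_lt hwb) (not_lt.2 (hcon.trans hwa.le))
      | succ j =>
        have := hp.high_le_high_iterate (parent b) j
        rw [← Function.iterate_succ_apply, ← hhigh] at this
        change _ ≤ I.high p a at this
        linarith
    | succ i =>
      cases j with
      | zero =>
        have := hp.high_le_high_iterate (parent a) i
        rw [← Function.iterate_succ_apply, hhigh] at this
        change _ ≤ I.high p b at this
        linarith
      | succ j =>
        have := ih (i + j) (by omega) i j rfl (parent a) (parent b) hsa hsb hpar hlr (by linarith)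
          (by linarith)
        linarith
  · cases j with
    | zero =>
      have := hp.high_le_high_iterate a i
      rw [hhigh] at this
      exact absurd h (not_lt.2 this)
    | succ j =>
      have := ih (i + j) (by omega) i j rfl a (parent b) hsa hsb hpar hlr (by linarith)
        (by linarith)
      linarith

/-- If only the boundaries meet, say the top of `a` at the bottom of `b`, then the parent of `a` has
its bottom at this height and meets `b` properly. It lies to the left of `b` and overlaps `a`
horizontally, which excludes that `a` is on the right. -/
theorem right_le_left_of_closed (hp : I.HierarchicallyRealizes p) {i j : ℕ} {a b : Fin I.n}
    (hsa : ¬ IsSink (parent^[i] a)) (hsb : ¬ IsSink (parent^[j] b))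
    (hpar : parent (parent^[i] a) = parent (parent^[j] b))
    (hlr : I.right p (parent^[i] a) ≤ I.left p (parent^[j] b)) (hab : a ≠ b)
    (hadj : ¬ (I.graph.arc a b = true ∨ I.graph.arc b a = true))
    (h1 : I.low p a ≤ I.high p b) (h2 : I.low p b ≤ I.high p a) : I.right p a ≤ I.left p b := by
  have hwa := left_lt_right p a
  have hwb := left_lt_right p b
  have ha := topContact_iff.1 (hp.topContact_parent (not_isSink_of_iterate hsa))
  have hb := topContact_iff.1 (hp.topContact_parent (not_isSink_of_iterate hsb))
  have hlpa := low_lt_high p (parent a)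
  have hlpb := low_lt_high p (parent b)
  have hla := low_lt_high p a
  have hlb := low_lt_high p b
  have hhigh : I.high p (parent^[i] a) = I.high p (parent^[j] b) := by
    rw [(hp.topContact_parent hsa).1, (hp.topContact_parent hsb).1, hpar]
  refine (hp.separated_of_not_adjacent hab hadj h1 h2).resolve_right fun hcon => ?_
  rcases h1.lt_or_eq with h1 | h1
  · rcases h2.lt_or_eq with h2 | h2
    · have := hp.right_le_left_of_iterate i j a b hsa hsb hpar hlr h1 h2
      linarith
    · cases i with
      | zero =>
        have := hp.high_le_high_iterate b j
        rw [← hhigh] at this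
        change _ ≤ I.high p a at this
        linarith
      | succ i =>
        have := hp.right_le_left_of_iterate i j (parent a) b hsa hsb hpar hlr (by linarith)
          (by linarith)
        linarith
  · cases j with
    | zero =>
      have := hp.high_le_high_iterate a i
      rw [hhigh] at this
      change _ ≤ I.high p b at this
      linarith
    | succ j =>
      have := hp.right_le_left_of_iterate i j a (parent b) hsa hsb hpar hlr (by linarith)
        (by linarith)
      linarith

/-- Passing to the parent raises the bottom by the height of the box and lowers the depth by the
same amount. As all paths end in the sink, the sum is the same for all boxes. -/
theorem low_add_depth (hp : I.HierarchicallyRealizes p) (v : Fin I.n) (k : ℕ) :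
    I.low p v + depth (netOf I) v / den (netOf I) =
      I.low p (parent^[k] v) + depth (netOf I) (parent^[k] v) / den (netOf I) := by
  induction k with
  | zero => rfl
  | succ k ih =>
    rw [ih, Function.iterate_succ_apply']
    by_cases h : IsSink (parent^[k] v)
    · rw [h.parent_eq]
    · have h1 := (hp.topContact_parent h).1
      rw [Instance.high, height_val] at h1
      rw [depth_parent h, ← h1, Instance.low]
      push_cast
      ring

theorem low_sub_low (hp : I.HierarchicallyRealizes p) (u v : Fin I.n) :
    I.low p u + depth (netOf I) u / den (netOf I) =
      I.low p v + depth (netOf I) v / den (netOf I) := by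
  rw [hp.low_add_depth u I.n, hp.low_add_depth v I.n, (isSink_iterate u).eq (isSink_iterate v)]

theorem low_lt_high_iff (hp : I.HierarchicallyRealizes p) : I.low p u < I.high p v ↔
    depth (netOf I) v < depth (netOf I) u + hgt (netOf I) v := by
  have h := hp.low_sub_low u v
  have hv : I.high p v = I.low p v + hgt (netOf I) v / den (netOf I) := by
    rw [Instance.high, height_val, Instance.low]
  rw [← Nat.cast_lt (α := ℝ), ← div_lt_div_iff_of_pos_right (a := (depth (netOf I) v : ℝ)) (denR_pos I),
    Nat.cast_add, add_div]
  constructor <;> intro h' <;> linarith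

theorem low_le_high_iff (hp : I.HierarchicallyRealizes p) : I.low p u ≤ I.high p v ↔
    depth (netOf I) v ≤ depth (netOf I) u + hgt (netOf I) v := by
  have h := hp.low_sub_low u v
  have hv : I.high p v = I.low p v + hgt (netOf I) v / den (netOf I) := by
    rw [Instance.high, height_val, Instance.low]
  rw [← Nat.cast_le (α := ℝ), ← div_le_div_iff_of_pos_right (a := (depth (netOf I) v : ℝ)) (denR_pos I),
    Nat.cast_add, add_div]
  constructor <;> intro h' <;> linarith

theorem closedMeet_iff (hp : I.HierarchicallyRealizes p) : closedMeet (netOf I) u v = true ↔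
    I.low p u ≤ I.high p v ∧ I.low p v ≤ I.high p u := by
  simp only [closedMeet, Bool.and_eq_true, decide_eq_true_eq, hp.low_le_high_iff]

theorem openMeet_iff (hp : I.HierarchicallyRealizes p) : openMeet (netOf I) u v = true ↔
    I.low p u < I.high p v ∧ I.low p v < I.high p u := by
  simp only [openMeet, Bool.and_eq_true, decide_eq_true_eq, hp.low_lt_high_iff]

end Instance.HierarchicallyRealizes

/-- If there is an edge, the rightmost contact of the sink has the index `g`. -/
def IsRightmost (p : Fin I.n → ℝ × ℝ) (g : ℕ) : Prop :=
  ∀ c, IsSink c → ∀ u, I.TopContact p u c →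
    ∃ r : Fin I.n, r.val = g ∧ I.TopContact p r c ∧ I.left p u ≤ I.left p r

namespace Instance.HierarchicallyRealizes

/-- Every box other than the sink has a parent with a higher top, so the unbounded dart starts at
the sink. Its head is the rightmost contact. Without edges any index will do. -/
theorem exists_isRightmost (hp : I.HierarchicallyRealizes p) :
    ∃ g < I.n, IsRightmost p g := by
  cases ho : I.outer with
  | none =>
    refine ⟨0, n_pos I, fun c _ u hu => ?_⟩
    exact absurd ((I.graph.mem_rot u c).2 (.inl (hp.arc_iff.2 hu))) (I.outer_none ho (u, c))
  | some d =>
    obtain ⟨e, ⟨he1, he2, he3⟩, -⟩ := hp.outer_face d ho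
    refine ⟨e.2, e.2.isLt, fun c hc u hu => ?_⟩
    have hs : IsSink e.1 := by
      by_contra hs
      exact absurd (hp.high_lt_high_parent hs) (not_lt.2 (he1 _))
    rw [hc.eq hs] at hu ⊢
    exact ⟨e.2, rfl, he2, he3 u hu⟩

/-- Clockwise from an out-neighbour come contacts on the top side, then those on the bottom side
from right to left, then the remaining ones on the top. So the in-neighbours are not cut apart and
appear from right to left, whichever out-neighbour was chosen. The sink has bottom contacts only,
and there the start must be the rightmost one. -/
theorem exists_order_eq (hp : I.HierarchicallyRealizes p) {g : ℕ} (hg : IsRightmost p g)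
    (c : Fin I.n) : ∃ l : List (Fin I.n), order (netOf I) g c = l.map Fin.val ∧ l.Nodup ∧
      (∀ w, w ∈ l ↔ w ∈ I.graph.rot c) ∧
      (l.filter fun w => I.graph.arc w c).Pairwise fun a b => I.left p b < I.left p a := by
  obtain ⟨above, below, hrot, habove, -, hbelow, hpair⟩ := hp.rotation c
  have hnd : (ids (netOf I) c).Nodup := by
    rw [ids_netOf]
    exact (I.graph.rot_nodup c).map Fin.val_injective
  rw [order, up_netOf]
  by_cases hc : IsSink c
  · have hnil : above = [] := by
      rw [List.eq_nil_iff_forall_not_mem]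
      intro w hw
      have := hp.arc_iff.2 (habove w hw)
      rw [hc w] at this
      simp at this
    subst hnil
    rw [hc.parent_eq, beq_self_eq_true, cond_true]
    refine ⟨below, ?_, hrot.nodup_iff.1 (I.graph.rot_nodup c), fun w => hrot.mem_iff.symm,
      hpair.sublist List.filter_sublist⟩
    cases below with
    | nil =>
      have : I.graph.rot c = [] := by simpa using hrot
      rw [ids_netOf, this]
      rfl
    | cons h B =>
      obtain ⟨r, rfl, hr, hle⟩ := hg c hc h (hbelow h (by simp))
      have hmem : r ∈ h :: B := by
        have := (I.graph.mem_rot c r).2 (.inr (hp.arc_iff.2 hr))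
        exact hrot.mem_iff.1 this
      rcases List.mem_cons.1 hmem with rfl | hB
      · rw [List.map_cons]
        refine rotTo_eq hnd ?_
        rw [ids_netOf]
        exact hrot.map Fin.val
      · exact absurd ((List.pairwise_cons.1 hpair).1 r hB) (not_lt.2 hle)
  · have hne : (parent c).val ≠ c.val := fun h => hc (isSink_iff.2 (Fin.ext h))
    rw [beq_eq_false_iff_ne.2 hne, cond_false]
    have hpc := hp.topContact_parent hc
    have hmem : parent c ∈ above := by
      have h1 := (I.graph.mem_rot c (parent c)).2 (.inl (arc_parent hc))
      rw [hrot.mem_iff, List.mem_append] at h1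
      exact h1.resolve_right fun h2 => not_topContact_symm hpc (hbelow _ h2)
    obtain ⟨A, B, rfl⟩ := List.append_of_mem hmem
    have hrot' : (I.graph.rot c).IsRotated (parent c :: (B ++ below ++ A)) := by
      refine hrot.trans ?_
      rw [List.append_assoc, List.cons_append]
      exact List.isRotated_append
    refine ⟨parent c :: (B ++ below ++ A), ?_, hrot'.nodup_iff.1 (I.graph.rot_nodup c),
      fun w => hrot'.mem_iff.symm, ?_⟩
    · rw [List.map_cons]
      refine rotTo_eq hnd ?_
      rw [ids_netOf]
      exact hrot'.map Fin.val
    · have hnone : ∀ w ∈ A ++ parent c :: B, ¬ I.graph.arc w c = true := fun w hw h =>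
        not_topContact_symm (habove w hw) (hp.upward _ _ h)
      have h1 : (A.filter fun w => I.graph.arc w c) = [] :=
        List.filter_eq_nil_iff.2 fun w hw => hnone w (by simp [hw])
      have h2 : (B.filter fun w => I.graph.arc w c) = [] :=
        List.filter_eq_nil_iff.2 fun w hw => hnone w (by simp [hw])
      rw [List.filter_cons_of_neg (p := fun w => I.graph.arc w c) (hnone _ hmem), List.filter_append, List.filter_append, h1, h2]
      simpa using hpair.sublist List.filter_sublist

end Instance.HierarchicallyRealizes

end HiWRAC

namespace HiWRAC

/-! ### Completeness of the search -/

variable {I : Instance} {p : Fin I.n → ℝ × ℝ} {u v w : Fin I.n} {g : ℕ}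

theorem iterate_mem_path (v : Fin I.n) (k : ℕ) : (parent^[k] v).val ∈ path (netOf I) v := by
  rw [mem_path]
  rcases le_total k I.n with h | h
  · exact ⟨k, h, rfl⟩
  · refine ⟨I.n, le_rfl, ?_⟩
    rw [← Nat.sub_add_cancel h, Function.iterate_add_apply, (isSink_iterate v).iterate_eq]

theorem leftOf_iff : leftOf (netOf I) g u v = true ↔ ∃ i j,
    parent (parent^[i] u) = parent (parent^[j] v) ∧
      prec (order (netOf I) g (parent (parent^[i] u))) (parent^[j] v) (parent^[i] u) = true := by
  simp only [leftOf, List.any_eq_true, Bool.and_eq_true, beq_iff_eq]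
  constructor
  · rintro ⟨a, ha, b, hb, h1, h2⟩
    obtain ⟨i, -, rfl⟩ := mem_path.1 ha
    obtain ⟨j, -, rfl⟩ := mem_path.1 hb
    rw [up_netOf] at h1 h2
    rw [up_netOf, Fin.val_inj] at h1
    exact ⟨i, j, h1, h2⟩
  · rintro ⟨i, j, h1, h2⟩
    refine ⟨_, iterate_mem_path u i, _, iterate_mem_path v j, ?_, ?_⟩
    · rw [up_netOf, up_netOf, h1]
    · rwa [up_netOf]

theorem mem_rot_parent (h : ¬ IsSink v) : v ∈ I.graph.rot (parent v) :=
  (I.graph.mem_rot _ _).2 (.inr (arc_parent h))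

theorem not_isSink_of_mem_rot (h : v ∈ I.graph.rot (parent v)) : ¬ IsSink v := by
  intro hs
  rw [I.graph.mem_rot, hs.parent_eq, arc_irrefl] at h
  simp at h

theorem mem_order (v : Fin I.n) (h : ¬ IsSink v) :
    v.val ∈ order (netOf I) g (parent v) := by
  rw [order, ← (rotTo_isRotated _ _).mem_iff, ids_netOf]
  exact List.mem_map_of_mem (mem_rot_parent h)

namespace Instance.HierarchicallyRealizes

/-- The order lists children from right to left, so the later one is further left. The sink, which
is its own `parent`, is not among its own neighbours, so occurrence in the list rules it out. -/
theorem left_lt_left_of_prec (hp : I.HierarchicallyRealizes p) (hg : IsRightmost p g)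
    (huv : parent u = parent v) (h : prec (order (netOf I) g (parent u)) v u = true) :
    ¬ IsSink u ∧ ¬ IsSink v ∧ u ≠ v ∧ I.left p u < I.left p v := by
  obtain ⟨l, hl, hnd, hmem, hpair⟩ := hp.exists_order_eq hg (parent u)
  rw [prec_iff, hl] at h
  have h : [v, u].Sublist l := by
    obtain ⟨l', hl', he⟩ := List.sublist_map_iff.1 h
    have : [v, u].map Fin.val = l'.map Fin.val := he
    rwa [List.map_injective_iff.2 Fin.val_injective this]
  have hu : ¬ IsSink u := not_isSink_of_mem_rot ((hmem u).1 (h.subset (by simp)))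
  have hv : ¬ IsSink v :=
    not_isSink_of_mem_rot (by rw [← huv]; exact (hmem v).1 (h.subset (by simp)))
  refine ⟨hu, hv, fun he => ?_, ?_⟩
  · have := hnd.sublist h
    simp [he] at this
  · have hf := h.filter fun w => I.graph.arc w (parent u)
    have h1 := arc_parent hu
    have h2 := arc_parent hv
    rw [← huv] at h2
    simp only [List.filter_cons, h1, h2, if_true, List.filter_nil] at hf
    simpa using hpair.sublist hf

/-- The two siblings have their tops at the same height and so meet vertically. Being disjoint they
are separated in the order of their left sides, and this order passes down to `u` and `v`. -/
theorem right_le_left_of_leftOf (hp : I.HierarchicallyRealizes p) (hg : IsRightmost p g)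
    (huv : u ≠ v) (h : leftOf (netOf I) g u v = true)
    (hadj : ¬ (I.graph.arc u v = true ∨ I.graph.arc v u = true))
    (h1 : I.low p u ≤ I.high p v) (h2 : I.low p v ≤ I.high p u) : I.right p u ≤ I.left p v := by
  obtain ⟨i, j, hpar, hprec⟩ := leftOf_iff.1 h
  obtain ⟨hsu, hsv, hne, hlt⟩ := hp.left_lt_left_of_prec hg hpar hprec
  refine hp.right_le_left_of_closed hsu hsv hpar ?_ huv hadj h1 h2
  have hhigh : I.high p (parent^[i] u) = I.high p (parent^[j] v) := by
    rw [(hp.topContact_parent hsu).1, (hp.topContact_parent hsv).1, hpar]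
  refine (hp.representation.separated hne ?_ ?_).resolve_right fun hcon => ?_
  · rw [← hhigh]; exact low_lt_high p _
  · rw [hhigh]; exact low_lt_high p _
  · have := left_lt_right p (parent^[j] v)
    linarith

theorem not_adjacent_of_openMeet (hp : I.HierarchicallyRealizes p)
    (h : openMeet (netOf I) u v = true) :
    ¬ (I.graph.arc u v = true ∨ I.graph.arc v u = true) := by
  rw [hp.openMeet_iff] at h
  rintro (h' | h')
  · exact h.2.ne' (hp.upward _ _ h').1
  · exact h.1.ne' (hp.upward _ _ h').1

theorem high_le_low_iterate (hp : I.HierarchicallyRealizes p) (hu : ¬ IsSink u) (k : ℕ) :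
    I.high p u ≤ I.low p (parent^[k + 1] u) := by
  induction k with
  | zero => exact (hp.topContact_parent hu).1.le
  | succ k ih =>
    rw [Function.iterate_succ_apply']
    by_cases h : IsSink (parent^[k + 1] u)
    · rwa [h.parent_eq]
    · rw [← (hp.topContact_parent h).1]
      exact ih.trans (low_lt_high p _).le

/-- An ancestor that is not an out-neighbour is at least two arcs up, and an intermediate box of
positive height lies between. -/
theorem high_lt_low_iterate (hp : I.HierarchicallyRealizes p) {k : ℕ}
    (hne : u ≠ parent^[k] u) (harc : ¬ I.graph.arc u (parent^[k] u) = true) :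
    I.high p u < I.low p (parent^[k] u) := by
  have hu : ¬ IsSink u := fun h => hne (h.iterate_eq k).symm
  match k with
  | 0 => exact absurd rfl hne
  | 1 => exact absurd (arc_parent hu) harc
  | k + 2 =>
    by_cases h2 : IsSink (parent u)
    · rw [Function.iterate_succ_apply, h2.iterate_eq] at harc
      exact absurd (arc_parent hu) harc
    · exact (hp.high_lt_high_parent hu).trans_le (hp.high_le_low_iterate h2 k)

/-- Boxes that meet vertically are comparable. -/
theorem leftOf_total (hp : I.HierarchicallyRealizes p) (g : ℕ) (huv : u ≠ v)
    (hadj : ¬ (I.graph.arc u v = true ∨ I.graph.arc v u = true))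
    (h1 : I.low p u ≤ I.high p v) (h2 : I.low p v ≤ I.high p u) :
    leftOf (netOf I) g u v = true ∨ leftOf (netOf I) g v u = true := by
  classical
  -- Take the first vertex of the path of `u` that lies on the path of `v`. If it is `u` or `v`
  -- itself, one box is a non-adjacent ancestor of the other and lies strictly above it, against the
  -- hypotheses. Otherwise its predecessors on the two paths are distinct children of it, and the
  -- cyclic order compares them.
  have hex : ∃ i, ∃ j, parent^[i] u = parent^[j] v :=
    ⟨I.n, I.n, (isSink_iterate u).eq (isSink_iterate v)⟩
  obtain ⟨i, hi, hi'⟩ : ∃ i, (∃ j, parent^[i] u = parent^[j] v) ∧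
      ∀ i' < i, ¬ ∃ j, parent^[i'] u = parent^[j] v :=
    ⟨Nat.find hex, Nat.find_spec hex, fun _ => Nat.find_min hex⟩
  obtain ⟨j, hj, hj'⟩ : ∃ j, parent^[i] u = parent^[j] v ∧
      ∀ j' < j, ¬ parent^[i] u = parent^[j'] v :=
    ⟨Nat.find hi, Nat.find_spec hi, fun _ => Nat.find_min hi⟩
  cases i with
  | zero =>
    have hj : u = parent^[j] v := hj
    have := hp.high_lt_low_iterate (u := v) (k := j) (by rw [← hj]; exact huv.symm)
      (by rw [← hj]; exact fun h => hadj (.inr h))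
    rw [← hj] at this
    linarith
  | succ i =>
  cases j with
  | zero =>
    have hj : parent^[i + 1] u = v := hj
    have := hp.high_lt_low_iterate (u := u) (k := i + 1) (by rwa [hj])
      (by rw [hj]; exact fun h => hadj (.inl h))
    rw [hj] at this
    linarith
  | succ j =>
    have hsu : ¬ IsSink (parent^[i] u) := by
      intro h
      refine hi' i (by omega) ⟨j + 1, ?_⟩
      rw [← hj, Function.iterate_succ_apply', h.parent_eq]
    have hsv : ¬ IsSink (parent^[j] v) := by
      intro h
      refine hj' j (by omega) ?_
      rw [hj, Function.iterate_succ_apply', h.parent_eq]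
    have hne : parent^[i] u ≠ parent^[j] v := fun h => hi' i (by omega) ⟨j, h⟩
    rw [Function.iterate_succ_apply', Function.iterate_succ_apply'] at hj
    have hmu := mem_order (g := g) _ hsu
    have hmv := mem_order (g := g) _ hsv
    rw [← hj] at hmv
    rcases pair_sublist_or (fun h => hne (Fin.ext h)) hmu hmv with h | h
    · refine .inr (leftOf_iff.2 ⟨j, i, hj.symm, ?_⟩)
      rw [← hj]
      exact prec_iff.2 h
    · exact .inl (leftOf_iff.2 ⟨i, j, hj, prec_iff.2 h⟩)

/-- The constraints are satisfiable in integers. -/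
theorem exists_potential (hp : I.HierarchicallyRealizes p) (hg : IsRightmost p g) :
    ∃ z : Fin I.n → ℤ, ∀ (u v : Fin I.n) (a b : ℕ), (a, b) ∈ bound (netOf I) g u v →
      z u + a ≤ z v + b := by
  -- After multiplication by the common denominator the widths are integers `W v`, and `wid` is `n *
  -- W v`; the factor `n` in `wid` makes room for the ranks of the rounding.
  obtain ⟨z, hz⟩ := exists_int_potential fun v => I.left p v * den (netOf I)
  have hD := denR_pos I
  have hn : (0 : ℝ) < I.n := Nat.cast_pos.2 (n_pos I)
  have hdvd : ∀ v : Fin I.n, I.n ∣ wid (netOf I) v := fun v => by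
    rw [wid, length_netOf]
    exact dvd_mul_right _ _
  choose W hW using hdvd
  have hright : ∀ v, I.right p v * den (netOf I) = I.left p v * den (netOf I) + W v := by
    intro v
    rw [Instance.right, width_val, hW]
    push_cast
    rw [Instance.left]
    field_simp
  refine ⟨z, fun u v a b h => ?_⟩
  rw [bound] at h
  cases huv : u.val == v.val
  · have huv : u ≠ v := fun h => beq_eq_false_iff_ne.1 huv (congrArg Fin.val h)
    rw [beq_eq_false_iff_ne.2 (fun h => huv (Fin.ext h)), cond_false] at h
    cases hadj : adjacent (netOf I) u v
    · rw [hadj, cond_false] at h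
      have hadj' : ¬ (I.graph.arc u v = true ∨ I.graph.arc v u = true) := by
        rw [← adjacent_netOf, hadj]
        simp
      cases hl : leftOf (netOf I) g u v && closedMeet (netOf I) u v
      · simp [hl] at h
      · rw [hl, cond_true] at h
        rw [Bool.and_eq_true] at hl
        obtain ⟨h1, h2⟩ := hp.closedMeet_iff.1 hl.2
        have hle := hp.right_le_left_of_leftOf hg huv hl.1 hadj' h1 h2
        cases ho : openMeet (netOf I) u v
        · simp only [ho, cond_false, add_zero, List.mem_singleton, Prod.mk.injEq] at h
          obtain ⟨rfl, rfl⟩ := h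
          have := (hz u v (W u)).1 (by
            push_cast
            rw [← hright]
            exact mul_le_mul_of_nonneg_right hle hD.le)
          rw [hW]
          push_cast
          linarith
        · simp only [ho, cond_true, List.mem_singleton, Prod.mk.injEq] at h
          obtain ⟨rfl, rfl⟩ := h
          obtain ⟨h1, h2⟩ := hp.openMeet_iff.1 ho
          have hlt : I.right p u < I.left p v :=
            (hp.separated_strict huv h1 h2).resolve_right fun h => by
              have := left_lt_right p u
              have := left_lt_right p v
              linarith
          have := (hz u v (W u)).2 (by
            push_cast
            rw [← hright]
            exact mul_lt_mul_of_pos_right hlt hD)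
          rw [hW]
          push_cast
          linarith
    · rw [hadj, cond_true] at h
      simp only [List.mem_singleton, Prod.mk.injEq] at h
      obtain ⟨rfl, rfl⟩ := h
      have hlt : I.left p u < I.right p v := by
        rcases (adjacent_netOf u v).1 hadj with h | h
        · exact (topContact_iff.1 (hp.upward _ _ h)).2.1
        · exact (topContact_iff.1 (hp.upward _ _ h)).2.2
      -- Strict overlap of neighbours is a difference constraint with a negative shift; the gap of
      -- one unit accounts for strictness.
      have := (hz u v (-W v)).2 (by
        have := mul_lt_mul_of_pos_right hlt hD
        rw [hright] at this
        push_cast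
        linarith)
      rw [hW]
      push_cast
      linarith
  · simp [huv] at h

end Instance.HierarchicallyRealizes

theorem le_foldl_max (l : List ℕ) (a : ℕ) : a ≤ l.foldl max a ∧ ∀ b ∈ l, b ≤ l.foldl max a := by
  induction l generalizing a with
  | nil => simp
  | cons c l ih =>
    obtain ⟨h1, h2⟩ := ih (max a c)
    rw [List.foldl_cons]
    refine ⟨le_trans (le_max_left _ _) h1, fun b hb => ?_⟩
    rcases List.mem_cons.1 hb with rfl | hb
    · exact le_trans (le_max_right _ _) h1
    · exact h2 b hb

theorem foldl_max_eq_or_mem (l : List ℕ) (a : ℕ) : l.foldl max a = a ∨ l.foldl max a ∈ l := by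
  induction l generalizing a with
  | nil => simp
  | cons c l ih =>
    rw [List.foldl_cons, List.mem_cons]
    rcases ih (max a c) with h | h
    · rw [h]
      rcases max_choice a c with h | h <;> simp [h]
    · exact .inr (.inr h)

theorem relax_getD (d : List ℕ) (v : Fin I.n) : (relax (netOf I) g d).getD v 0 =
    ((List.range I.n).flatMap fun u =>
      (bound (netOf I) g u v).map fun c => d.getD u 0 + c.1 - c.2).foldl max (d.getD v 0) := by
  rw [relax, List.getD_eq_getElem?_getD, List.getElem?_eq_getElem (by simp)]
  simp only [List.getElem_map, List.getElem_range, length_netOf, Option.getD_some]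

/-- The computed abscissae satisfy the constraints if these are satisfiable. -/
theorem dist_solves {z : Fin I.n → ℤ} (hz : ∀ (u v : Fin I.n) (a b : ℕ),
    (a, b) ∈ bound (netOf I) g u v → z u + a ≤ z v + b) {a b : ℕ}
    (h : (a, b) ∈ bound (netOf I) g u v) :
    (dist (netOf I) g).getD u 0 + a ≤ (dist (netOf I) g).getD v 0 + b := by
  have key := relaxation_solves (E := fun u v a b => (a, b) ∈ bound (netOf I) g u v)
    (d := fun k v => ((relax (netOf I) g)^[k] ((netOf I).map fun _ => 0)).getD v 0) (z := z)
    ?_ ?_ ?_ hz h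
  · rw [dist, List.foldl_const, length_netOf]
    exact key
  · intro k v
    rw [Function.iterate_succ_apply', relax_getD]
    exact (le_foldl_max _ _).1
  · intro k u v a b hab
    rw [Function.iterate_succ_apply', relax_getD]
    refine (le_foldl_max _ _).2 _ ?_
    rw [List.mem_flatMap]
    exact ⟨u, List.mem_range.2 u.isLt, List.mem_map.2 ⟨_, hab, rfl⟩⟩
  · intro k v
    simp only [Function.iterate_succ_apply', relax_getD]
    rcases foldl_max_eq_or_mem ((List.range I.n).flatMap fun u => (bound (netOf I) g u v).map
      fun c => ((relax (netOf I) g)^[k] ((netOf I).map fun _ => 0)).getD u 0 + c.1 - c.2)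
      (((relax (netOf I) g)^[k] ((netOf I).map fun _ => 0)).getD v 0) with h | h
    · exact .inl h
    · right
      obtain ⟨u, hu, h⟩ := List.mem_flatMap.1 h
      obtain ⟨c, hc, h⟩ := List.mem_map.1 h
      exact ⟨⟨u, List.mem_range.1 hu⟩, c.1, c.2, hc, h.symm⟩

end HiWRAC

/-! ### Solutions of the constraints pass the check -/

namespace HiWRAC

variable {I : Instance} {p : Fin I.n → ℝ × ℝ} {u v w : Fin I.n} {g : ℕ} {x : List ℕ}

theorem le_of_adjacent (hx : ∀ (u v : Fin I.n) (a b : ℕ), (a, b) ∈ bound (netOf I) g u v →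
      x.getD u 0 + a ≤ x.getD v 0 + b)
    (hadj : I.graph.arc u v = true ∨ I.graph.arc v u = true) :
    x.getD u 0 < x.getD v 0 + wid (netOf I) v := by
  refine hx u v 1 _ ?_
  have huv : u ≠ v := hadj.elim ne_of_arc fun h => (ne_of_arc h).symm
  rw [bound, beq_eq_false_iff_ne.2 fun h => huv (Fin.ext h), (adjacent_netOf u v).2 hadj]
  simp

theorem le_of_leftOf (hx : ∀ (u v : Fin I.n) (a b : ℕ), (a, b) ∈ bound (netOf I) g u v →
      x.getD u 0 + a ≤ x.getD v 0 + b) (huv : u ≠ v)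
    (hadj : ¬ (I.graph.arc u v = true ∨ I.graph.arc v u = true))
    (hl : leftOf (netOf I) g u v = true) (hc : closedMeet (netOf I) u v = true) :
    x.getD u 0 + (wid (netOf I) u + bif openMeet (netOf I) u v then 1 else 0) ≤ x.getD v 0 := by
  refine hx u v _ 0 ?_
  rw [← adjacent_netOf, Bool.not_eq_true] at hadj
  rw [bound, beq_eq_false_iff_ne.2 fun h => huv (Fin.ext h), hadj, hl, hc]
  simp

theorem closedMeet_of_openMeet (h : openMeet (netOf I) u v = true) :
    closedMeet (netOf I) u v = true := by
  simp only [openMeet, closedMeet, Bool.and_eq_true, decide_eq_true_eq] at h ⊢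
  omega

theorem openMeet_comm : openMeet (netOf I) u v = openMeet (netOf I) v u := by
  rw [openMeet, openMeet, Bool.and_comm]

theorem closedMeet_comm : closedMeet (netOf I) u v = closedMeet (netOf I) v u := by
  rw [closedMeet, closedMeet, Bool.and_comm]

namespace Instance.HierarchicallyRealizes

/-- Solutions of the constraints keep the horizontal order of boxes that meet vertically. -/
theorem lt_of_openMeet (hp : I.HierarchicallyRealizes p) (hg : IsRightmost p g)
    (hx : ∀ (u v : Fin I.n) (a b : ℕ), (a, b) ∈ bound (netOf I) g u v →
      x.getD u 0 + a ≤ x.getD v 0 + b) (ho : openMeet (netOf I) u v = true)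
    (hlt : I.left p u < I.left p v) : x.getD u 0 < x.getD v 0 := by
  have huv : u ≠ v := by
    rintro rfl
    exact lt_irrefl _ hlt
  have hadj := hp.not_adjacent_of_openMeet ho
  have hc := closedMeet_of_openMeet ho
  obtain ⟨h1, h2⟩ := hp.closedMeet_iff.1 hc
  rcases hp.leftOf_total g huv hadj h1 h2 with hl | hl
  · have := le_of_leftOf hx huv hadj hl hc
    rw [ho] at this
    have := wid_pos u
    omega
  · have := hp.right_le_left_of_leftOf hg huv.symm hl (by rwa [or_comm]) h2 h1
    have := left_lt_right p v
    linarith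

/-- Non-adjacent boxes whose closed extents meet are comparable by `leftOf_total`, so one of the two
separating constraints is present in the system. -/
theorem checkPair_eq_true (hp : I.HierarchicallyRealizes p) (u v : Fin I.n)
    (hx : ∀ (u v : Fin I.n) (a b : ℕ), (a, b) ∈ bound (netOf I) g u v →
      x.getD u 0 + a ≤ x.getD v 0 + b) : checkPair (netOf I) x u v = true := by
  rw [checkPair, hasArc_netOf, hasArc_netOf]
  cases h1 : I.graph.arc u v
  · cases h2 : I.graph.arc v u
    · by_cases huv : u = v
      · simp [huv]
      have hadj : ¬ (I.graph.arc u v = true ∨ I.graph.arc v u = true) := by simp [h1, h2]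
      have hw1 := wid_pos u
      have hw2 := wid_pos v
      by_cases hc : closedMeet (netOf I) u v = true
      · obtain ⟨h3, h4⟩ := hp.closedMeet_iff.1 hc
        rcases hp.leftOf_total g huv hadj h3 h4 with hl | hl
        · have := le_of_leftOf hx huv hadj hl hc
          cases ho : openMeet (netOf I) u v
          all_goals
            simp only [ho, cond_true, cond_false] at this
            simp [hc, -List.getD_eq_getElem?_getD]
            omega
        · have := le_of_leftOf hx (Ne.symm huv) (by rwa [or_comm]) hl (by rwa [closedMeet_comm])
          rw [openMeet_comm] at this
          cases ho : openMeet (netOf I) u v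
          all_goals
            simp only [ho, cond_true, cond_false] at this
            simp [hc, -List.getD_eq_getElem?_getD]
            omega
      · have ho : ¬ openMeet (netOf I) u v = true := fun h => hc (closedMeet_of_openMeet h)
        rw [Bool.not_eq_true] at hc ho
        simp [hc, ho]
    · simp
  -- `depth` follows a single arc from each vertex, so consistency with the other arcs is not
  -- automatic; it comes from the assumed realization.
  · have h2 := (hp.upward _ _ h1).1
    have h3 := hp.low_le_high_iff (u := v) (v := u)
    have h4 := hp.low_lt_high_iff (u := v) (v := u)
    rw [h2] at h3 h4
    simp only [le_refl, lt_self_iff_false, true_iff, false_iff] at h3 h4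
    have h5 := le_of_adjacent hx (.inl h1)
    have h6 := le_of_adjacent (u := v) (v := u) hx (.inr h1)
    simp only [cond_true, Bool.and_eq_true, beq_iff_eq, decide_eq_true_eq]
    omega

/-- Boxes on top of `v` have level bottoms and boxes below `v` have level tops. So any two on the
same side meet vertically, and their order in the realization carries over to `x`. -/
theorem checkRot_eq_true (hp : I.HierarchicallyRealizes p) (hg : IsRightmost p g) (v : Fin I.n)
    (hx : ∀ (u v : Fin I.n) (a b : ℕ), (a, b) ∈ bound (netOf I) g u v →
      x.getD u 0 + a ≤ x.getD v 0 + b) : checkRot (netOf I) x v = true := by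
  obtain ⟨above, below, hrot, habove, hpa, hbelow, hpb⟩ := hp.rotation v
  have hnd : (ids (netOf I) v).Nodup := by
    rw [ids_netOf]
    exact (I.graph.rot_nodup v).map Fin.val_injective
  have hrot' : (ids (netOf I) v).IsRotated ((above ++ below).map Fin.val) := by
    rw [ids_netOf]
    exact hrot.map _
  have ha : ∀ w ∈ above, I.graph.arc v w = true := fun w hw => hp.arc_iff.2 (habove w hw)
  have hb : ∀ w ∈ below, I.graph.arc v w = false := fun w hw => by
    rw [← Bool.not_eq_true, hp.arc_iff]
    exact not_topContact_symm (hbelow w hw)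
  have hpair : (above ++ below).Pairwise fun (a b : Fin I.n) =>
      mayPrecede (netOf I) x v a b = true := by
    simp only [mayPrecede, hasArc_netOf]
    rw [List.pairwise_append]
    refine ⟨hpa.imp_of_mem ?_, hpb.imp_of_mem ?_, ?_⟩
    · intro a b h1 h2 hab
      have := hp.lt_of_openMeet hg hx (hp.openMeet_iff.2
        ⟨by rw [← (habove a h1).1, (habove b h2).1]; exact low_lt_high p _,
          by rw [← (habove b h2).1, (habove a h1).1]; exact low_lt_high p _⟩) hab
      simpa [ha a h1, ha b h2] using this
    · intro a b h1 h2 hab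
      have := hp.lt_of_openMeet hg hx (hp.openMeet_iff.2
        ⟨by rw [(hbelow a h1).1, ← (hbelow b h2).1]; exact low_lt_high p _,
          by rw [(hbelow b h2).1, ← (hbelow a h1).1]; exact low_lt_high p _⟩) hab
      simpa [hb a h1, hb b h2] using this
    · intro a h1 b h2
      simp [ha a h1, hb b h2]
  -- The candidate `v` serves only the case without neighbours, where the list offers no starting
  -- element.
  obtain ⟨s, hs, hr⟩ : ∃ s ∈ v.val :: ids (netOf I) v,
      rotTo s (ids (netOf I) v) = (above ++ below).map Fin.val := by
    cases hm : (above ++ below).map Fin.val with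
    | nil =>
      rw [hm] at hrot'
      refine ⟨v, by simp, ?_⟩
      rw [List.isRotated_nil_iff.1 hrot']
      rfl
    | cons s m =>
      rw [hm] at hrot'
      exact ⟨s, List.mem_cons_of_mem _ (hrot'.mem_iff.2 (by simp)), rotTo_eq hnd hrot'⟩
  rw [checkRot, List.any_eq_true]
  refine ⟨s, hs, ?_⟩
  rw [hr]
  simp only [List.all_eq_true, List.mem_map, forall_exists_index, and_imp,
    forall_apply_eq_imp_iff₂, Bool.or_eq_true, Bool.not_eq_true', ← Bool.not_eq_true, prec_iff]
  intro a _ b _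
  refine or_iff_not_imp_left.2 fun h => ?_
  rw [not_not] at h
  have h : [a, b].Sublist (above ++ below) := by
    obtain ⟨l', hl', he⟩ := List.sublist_map_iff.1 h
    have : [a, b].map Fin.val = l'.map Fin.val := he
    rwa [List.map_injective_iff.2 Fin.val_injective this]
  simpa using hpair.sublist h

end Instance.HierarchicallyRealizes

/-- Among more iterates than elements two coincide; cutting out the part between them shortens the
exponent. -/
theorem exists_iterate_le_card {β : Type} [Fintype β] (f : β → β) (a : β) (k : ℕ) :
    ∃ j ≤ Fintype.card β, f^[j] a = f^[k] a := by
  induction k using Nat.strong_induction_on with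
  | _ k ih =>
  rcases le_or_gt k (Fintype.card β) with h | h
  · exact ⟨k, h, rfl⟩
  · have hinj : ¬ Function.Injective fun j : Fin (k + 1) => f^[j.val] a := by
      intro hi
      have := Fintype.card_le_of_injective _ hi
      simp at this
      omega
    obtain ⟨i, j, hlt, he⟩ : ∃ i j : Fin (k + 1), i < j ∧ f^[i.val] a = f^[j.val] a := by
      simp only [Function.Injective, not_forall] at hinj
      obtain ⟨i, j, he, hne⟩ := hinj
      rcases lt_or_gt_of_ne hne with h | h
      · exact ⟨i, j, h, he⟩
      · exact ⟨j, i, h, he.symm⟩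
    have hlt : i.val < j.val := hlt
    have hj := j.isLt
    obtain ⟨m, hm, hm'⟩ := ih (k - j + i) (by omega)
    refine ⟨m, hm, ?_⟩
    rw [hm', Function.iterate_add_apply, he, ← Function.iterate_add_apply]
    congr 2
    omega

namespace Instance.HierarchicallyRealizes

theorem checkOuter_eq_true (hp : I.HierarchicallyRealizes p) (hg : IsRightmost p g)
    (hx : ∀ (u v : Fin I.n) (a b : ℕ), (a, b) ∈ bound (netOf I) g u v →
      x.getD u 0 + a ≤ x.getD v 0 + b) : checkOuter (netOf I) (outerOf I) x = true := by
  cases ho : I.outer with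
  | none => simp [checkOuter, outerOf, ho]
  | some d =>
    have hD : outerOf I = [d.1.val, d.2.val] := by rw [outerOf, ho]
    obtain ⟨e, ⟨he1, he2, he3⟩, k, hk⟩ := hp.outer_face d ho
    -- There are `n * n` pairs of vertices, which is the number of iterations that `face` performs.
    obtain ⟨k, hk', hk⟩ : ∃ k ≤ I.n * I.n, I.graph.faceNext^[k] d = e := by
      obtain ⟨j, hj, hj'⟩ := exists_iterate_le_card I.graph.faceNext d k
      exact ⟨j, by simpa using hj, hj'.trans hk⟩
    have hs : IsSink e.1 := by
      by_contra hs
      exact absurd (hp.high_lt_high_parent hs) (not_lt.2 (he1 _))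
    rw [checkOuter, hD]
    simp only [List.isEmpty_cons, Bool.false_or, List.getD_cons_zero, List.getD_cons_succ,
      List.any_eq_true, face, mem_iterates]
    refine ⟨(e.1.val, e.2.val), ⟨k, ?_, ?_⟩, ?_⟩
    · simpa using hk'
    · rw [nextDart_iterate (I.outer_some d ho), hk]
    · simp only [up_netOf, hs.parent_eq, hasArc_netOf, hp.arc_iff.2 he2, beq_self_eq_true,
        Bool.true_and, List.all_eq_true, List.mem_range, length_netOf]
      intro u hu
      rw [show u = (⟨u, hu⟩ : Fin I.n).val from rfl, hasArc_netOf]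
      generalize (⟨u, hu⟩ : Fin I.n) = u
      cases hu : I.graph.arc u e.1
      · rfl
      · have hu := hp.arc_iff.1 hu
        simp only [Bool.not_true, Bool.false_or, decide_eq_true_eq]
        rcases eq_or_ne u e.2 with rfl | hne
        · exact le_rfl
        have ho : I.low p u < I.high p e.2 ∧ I.low p e.2 < I.high p u :=
          ⟨by rw [he2.1, ← hu.1]; exact low_lt_high p _,
            by rw [hu.1, ← he2.1]; exact low_lt_high p _⟩
        refine (hp.lt_of_openMeet hg hx (hp.openMeet_iff.2 ho) ((he3 u hu).lt_of_ne ?_)).le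
        intro heq
        have h1 := left_lt_right p u
        have h2 := left_lt_right p e.2
        rcases hp.representation.separated hne ho.1 ho.2 with h | h <;> linarith

/-- If the instance is realizable, then the search succeeds. -/
theorem solutions_ne_nil (hp : I.HierarchicallyRealizes p) :
    solutions (netOf I) (outerOf I) ≠ [] := by
  obtain ⟨g, hgn, hg⟩ := hp.exists_isRightmost
  obtain ⟨z, hz⟩ := hp.exists_potential hg
  have hx := fun (u v : Fin I.n) (a b : ℕ) (h : (a, b) ∈ bound (netOf I) g u v) =>
    dist_solves hz h
  refine List.ne_nil_of_mem (a := dist (netOf I) g) ?_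
  rw [solutions, List.mem_filter]
  refine ⟨List.mem_map.2 ⟨g, by simpa using hgn, rfl⟩, ?_⟩
  simp only [check, Bool.and_eq_true, List.all_eq_true, List.mem_range, length_netOf]
  exact ⟨⟨fun u hu v hv => hp.checkPair_eq_true ⟨u, hu⟩ ⟨v, hv⟩ hx,
    fun v hv => hp.checkRot_eq_true hg ⟨v, hv⟩ hx⟩, hp.checkOuter_eq_true hg hx⟩

end Instance.HierarchicallyRealizes

/-! ### The answer -/

/-- The answer of the algorithm. -/
def answer (I : Instance) : Option (List (Fraction × Fraction)) :=
  (solutions (netOf I) (outerOf I)).head?.map fun x => List.ofFn (coord I x)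

theorem isCorrectOutput_answer (I : Instance) : IsCorrectOutput I (answer I) := by
  rw [answer]
  cases h : solutions (netOf I) (outerOf I) with
  | nil =>
    rintro ⟨p, hp⟩
    exact hp.solutions_ne_nil h
  | cons x l =>
    refine ⟨coord I x, rfl, check_sound ?_⟩
    have : x ∈ solutions (netOf I) (outerOf I) := by simp [h]
    exact (List.mem_filter.1 this).2

/-- The ordinates are `-depth`, so the sign in the output is `1` unless the depth is zero. -/
theorem encodeOutput_answer (I : Instance) :
    encodeOutput (answer I) = encodeNats (result (netOf I) (outerOf I)) := by
  unfold answer result encodeOutput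
  congr 1
  cases solutions (netOf I) (outerOf I) with
  | nil => rfl
  | cons x l =>
    simp only [List.head?_cons, Option.map_some, List.singleton_append, List.cons.injEq, true_and,
      length_netOf]
    rw [List.ofFn_eq_map, ← List.map_coe_finRange_eq_range, List.flatMap_map, List.flatMap_map]
    congr 1
    funext v
    rcases Nat.eq_zero_or_pos (depth (netOf I) v) with h | h
    · simp [coord, Fraction.toNats, h]
    · simp [coord, Fraction.toNats, h, beq_eq_false_iff_ne.2 h.ne']

end HiWRAC

theorem theorem3 :
    ∃ f : HiWRAC.Instance → Option (List (HiWRAC.Fraction × HiWRAC.Fraction)),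
      (∀ I : HiWRAC.Instance, HiWRAC.IsCorrectOutput I (f I)) ∧
      Nonempty (Turing.TM2ComputableInPolyTime HiWRAC.encodeInstance HiWRAC.encodeOutput f) := by
  refine ⟨HiWRAC.answer, HiWRAC.isCorrectOutput_answer, HiWRAC.computable_of_polyTime _ _ _ ?_⟩
  simp only [HiWRAC.encodeOutput_answer]
  exact HiWRAC.polyTime_result
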